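/- **Setting.** Let $n=r+k$ and consider an $[[n,k]]$ stabilizer code with $r=n-k$ generators $s_i$ and logical operators $\bar Z_a,\bar X_a$ (signed Pauli strings; the $s_i$ and $\bar Z_a$ are $n$ independent commuting operators). Let $|0\dots0\rangle_L$ be the common $+1$ eigenvector of all $s_i,\bar Z_a$, and let $E|y\rangle=\prod_a\bar X_a^{y_a}|0\dots0\rangle_L$ be the encoding isometry. A client (master node) is linked by Bell-pair channels to $n+t$ leaf nodes (the server), $n$ of which are secretly chosen as computation nodes and $t$ as trap nodes. All parties are honest and all operations are noiseless, except that magic states may be imperfect. The client wants $U|\psi\rangle$, for a unitary $U$ and a unit vector $|\psi\rangle=W|0^k\rangle$ on $k$ qubits, $W$ unitary. Her compiler supplies a gate sequence $G$ over $\{H,S,\mathrm{CNOT},T\}$ whose product $U'$ satisfies $\|e^{i\theta}U'-UW\|\le\varepsilon$ (operator norm) for some $\theta$. **Protocol.** 1. *Traps.* Each trap node receives a qubit in a BB84 state chosen and recorded by the client; along with every logical gate it is told to apply the identity. 2. *Encoding.* The master prepares $n$ qubits in $|+\rangle$, the computation nodes prepare $|0\rangle$. For each operator $s_i,\bar Z_a$,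 controlled Paulis from one master qubit to the leaves are executed by gate teleportation (SCST: with a Bell pair on $A_eB_e$, CNOT from the control to $A_e$, $Z$-measurement of $A_e$, conditional $X$ on $B_e$, controlled gate from $B_e$ to the target, $H$ and $Z$-measurement of $B_e$, conditional $Z$ on the control). The master measures its qubits in the $X$ basis, and a Pauli correction anticommuting with exactly the operators that had outcome $-1$ is applied. 3. *Logical gates.* $H,S,\mathrm{CNOT}$ are executed by the client's chosen implementations, which are built from: transversal operations $\bigotimes_jV_j$ that map the codespace to itself and act on it as the gate; a logical controlled-$Z$ (whence $\mathrm{CNOT}=H\cdot CZ\cdot H$) in which $\bar Z_a$ of the control is collected into a work qubit at one leaf, $\bar Z_{a'}$ of the target is applied controlled by it, and the work qubit is uncomputed; phase gadgets of the same kind; and pre-compiled sequences of these whose product is the gate. Each controlled Pauli between different leaves is a distributed controlled-$U$: two Bell pairs via the master, Bell measurement there, Pauli correction, then gate teleportation. A $T$ gate is executed by magic-state injection: a state within trace distance $\delta$ of the encoded $(|0\rangle+e^{i\pi/4}|1\rangle)/\sqrt2$ is supplied in a second code block; a logical CNOT is applied from data (control) to magic qubit (target); the magic qubit is measured in the logical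 $Z$ basis with outcome $m$; $S_L^m$ is applied to the data. 4. *Verification and output.* Each trap is measured in its basis. If all outcomes equal the recorded values, the client takes the computation block and inverts $E$ (a component outside the codespace gives an error state $|\mathrm{err}\rangle$ orthogonal to all outputs); otherwise she outputs $|\mathrm{err}\rangle$. **Theorem (completeness).** The data prescribed by the protocol exist: a table of Pauli corrections for all syndromes, implementations of all required logical Clifford gates for the given code, and a unitary $W$ with $W|0^k\rangle=|\psi\rangle$. For every $W$ with $W|0^k\rangle=|\psi\rangle$, every $t$, every placement and choice of trap states, every valid choice of corrections and implementations, every $G$ compiled to precision $\varepsilon$, and every supply of magic states of quality $\delta$, with $N_T$ the number of $T$ gates in $G$: * all traps pass with probability $1$; * $D\big(\rho_{\rm out},\,U|\psi\rangle\langle\psi|U^\dagger\big)\le\varepsilon+N_T\,\delta$, with $D$ the trace distance and $\rho_{\rm out}$ the client's final output state; * $D\big(\rho_{\rm joint},\,U|\psi\rangle\langle\psi|U^\dagger\otimes\sigma\big)\le\varepsilon+N_T\,\delta$, where $\rho_{\rm joint}$ is the final joint state of the output register and all remaining qubits of the network, and $\sigma$ is the final state of those remaining qubits in the same honest execution with perfect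 magic states. Moreover, for every such $W$ and every $\eta>0$ there are a gate sequence $G$ compiled to precision $\eta$ and a $\delta>0$ such that in all honest executions of $G$ with magic states of quality $\delta$ the traps pass with probability $1$ and both trace distances are at most $\eta$. So the error can be made smaller than any prescribed positive (in particular, any negligible) function of a security parameter. -/

import Mathlib

open scoped Matrix

noncomputable section

namespace DQC

open scoped ComplexOrder Matrix.Norms.L2Operator

/-! ### Registers of qubits, local operations, measurements, state preparation

A register is a finite type `Q` of qubits; the computational basis is `Q → Bool`. -/

/-- Operators on the register `Q`. -/
abbrev Op (Q : Type) : Type := Matrix (Q → Bool) (Q → Bool) ℂ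

/-- Maps on (unnormalised) density operators of the register `Q`. -/
abbrev Chan (Q : Type) : Type := Op Q → Op Q

/-- Sequential execution, first list element first. -/
def runAll {Q : Type} : List (Chan Q) → Chan Q
  | [] => id
  | c :: cs => fun ρ => runAll cs (c ρ)

/-- Execute `c` if the classical bit `m` is set, otherwise do nothing. -/
def applyIf {Q : Type} (m : Bool) (c : Chan Q) : Chan Q := if m then c else id

def gateX : Matrix Bool Bool ℂ := Matrix.of fun i j => if i = j then 0 else 1
def gateZ : Matrix Bool Bool ℂ := Matrix.diagonal fun b => if b then -1 else 1
def gateY : Matrix Bool Bool ℂ := Complex.I • (gateX * gateZ)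
def gateH : Matrix Bool Bool ℂ :=
  Matrix.of fun i j => (if i && j then -1 else 1) / (Real.sqrt 2 : ℂ)
def gateS : Matrix Bool Bool ℂ := Matrix.diagonal fun b => if b then Complex.I else 1
def gateT : Matrix Bool Bool ℂ :=
  Matrix.diagonal fun b => if b then Complex.exp (Real.pi / 4 * Complex.I) else 1

/-- Tensor product of single-qubit operators. -/
def tens {ι : Type} [Fintype ι] (A : ι → Matrix Bool Bool ℂ) : Op ι :=
  Matrix.of fun x y => ∏ i, A i (x i) (y i)

/-- The rank-one operator `|v⟩⟨v|`. -/
def pureState {m : Type} (v : m → ℂ) : Matrix m m ℂ := Matrix.vecMulVec v (star v)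

/-- The basis vector `|x⟩`. -/
def ket {m : Type} [DecidableEq m] (x : m) : m → ℂ := Pi.single x 1

section Register

variable {Q : Type} [Fintype Q] [DecidableEq Q] {ι : Type} [Fintype ι] [DecidableEq ι]

/-- The operator `A` acting on the qubits listed (without repetition) by `e`, identity elsewhere. -/
def onQubits (e : ι → Q) (A : Op ι) : Op Q :=
  Matrix.of fun x y =>
    if ∀ q, (∀ i, e i ≠ q) → x q = y q then A (fun i => x (e i)) (fun i => y (e i)) else 0

/-- The single-qubit operator `A` acting on the qubit `q`, identity elsewhere. -/
def onQubit (q : Q) (A : Matrix Bool Bool ℂ) : Op Q :=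
  Matrix.of fun x y => if ∀ p, p ≠ q → x p = y p then A (x q) (y q) else 0

/-- Controlled-`A` with control `c`, for an operator `A` that acts trivially on `c`. -/
def ctrl (c : Q) (A : Op Q) : Op Q :=
  Matrix.of fun x y => if x c then A x y else if x = y then 1 else 0

/-- Conjugation `ρ ↦ A ρ A†`. -/
def conjBy (A : Op Q) : Chan Q := fun ρ => A * ρ * Aᴴ

/-- Measure the qubits listed by `e` in the computational basis and continue with `f`, which may
depend on the classical outcome. -/
def measureAll (e : ι → Q) (f : (ι → Bool) → Chan Q) : Chan Q := fun ρ =>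
  ∑ s : ι → Bool, f s (conjBy (onQubits e (pureState (ket s))) ρ)

/-- Measure one qubit in the computational basis and continue with `f`. -/
def measureOne (q : Q) (f : Bool → Chan Q) : Chan Q := fun ρ =>
  ∑ b : Bool, f b (conjBy (onQubit q (pureState (ket b))) ρ)

/-- Discard the qubits listed by `e` and prepare them afresh in the state `τ`. -/
def prepare (e : ι → Q) (τ : Op ι) : Chan Q := fun ρ =>
  Matrix.of fun x y => τ (fun i => x (e i)) (fun i => y (e i)) *
    ∑ b : ι → Bool, ρ (Function.extend e b x) (Function.extend e b y)

/-- Distribute a Bell pair `(|00⟩ + |11⟩)/√2` on the qubits `p`, `q`. -/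
def bellPair (p q : Q) : Chan Q :=
  prepare ![p, q] (pureState fun x => if x 0 = x 1 then 1 / (Real.sqrt 2 : ℂ) else 0)

/-- Gate teleportation of a controlled-`A` from `a` (at one node) to `b` (at another node), using a
Bell pair on `ae` (held together with `a`) and `be` (held together with `b`): CNOT from `a` to `ae`;
measure `ae`; outcome-controlled `X` on `be`; local controlled-`A` from `be` to `b`;
Hadamard on `be`; measure `be`; outcome-controlled `Z` on `a`. -/
def scst (a ae be b : Q) (A : Matrix Bool Bool ℂ) : Chan Q :=
  runAll
    [ conjBy (ctrl a (onQubit ae gateX)),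
      measureOne ae fun m => applyIf m (conjBy (onQubit be gateX)),
      conjBy (ctrl be (onQubit b A)),
      conjBy (onQubit be gateH),
      measureOne be fun m => applyIf m (conjBy (onQubit a gateZ)) ]

/-- The client takes away the qubits listed by `e` (which are left in `|0⟩`), applying the operator
`K` to them; the result is in the new output register, with basis `κ`. -/
def handOver {κ : Type} (e : ι → Q) (K : Matrix κ (ι → Bool) ℂ) (ρ : Op Q) :
    Matrix (κ × (Q → Bool)) (κ × (Q → Bool)) ℂ :=
  Matrix.of fun p q =>
    if (∀ i, p.2 (e i) = false) ∧ (∀ i, q.2 (e i) = false) then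
      ∑ d : ι → Bool, ∑ d' : ι → Bool,
        K p.1 d * ρ (Function.extend e d p.2) (Function.extend e d' q.2) * star (K q.1 d')
    else 0

end Register

/-- Trace distance `½ ‖ρ - σ‖₁`, the trace norm being the sum of the singular values. -/
def traceDist {m : Type} [Fintype m] [DecidableEq m] (ρ σ : Matrix m m ℂ) : ℝ :=
  (1 / 2) * ∑ i, Real.sqrt ((Matrix.isHermitian_conjTranspose_mul_self (ρ - σ)).eigenvalues i)

/-- Density operators. -/
def IsDensity {m : Type} [Fintype m] (ρ : Matrix m m ℂ) : Prop := ρ.PosSemidef ∧ ρ.trace = 1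

/-! ### Stabilizer codes -/

/-- A Hermitian Pauli operator `± P₀ ⊗ ⋯ ⊗ Pₙ₋₁`. The letter `P_j` is `I`, `X`, `Z`, `Y` when
`(x j, z j)` is `(0,0)`, `(1,0)`, `(0,1)`, `(1,1)`. -/
structure PauliString (n : ℕ) where
  x : Fin n → ZMod 2
  z : Fin n → ZMod 2
  neg : Bool

namespace PauliString

variable {n : ℕ}

def letter (P : PauliString n) (j : Fin n) : Matrix Bool Bool ℂ :=
  if P.x j = 0 then (if P.z j = 0 then 1 else gateZ) else (if P.z j = 0 then gateX else gateY)

/-- The qubits on which `P` acts non-trivially. -/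
def support (P : PauliString n) : Finset (Fin n) :=
  Finset.univ.filter fun j => P.x j ≠ 0 ∨ P.z j ≠ 0

def mat (P : PauliString n) : Op (Fin n) := (if P.neg then (-1 : ℂ) else 1) • tens P.letter

/-- The symplectic product: `0` if `P` and `P'` commute, `1` if they anticommute. -/
def symp (P P' : PauliString n) : ZMod 2 := ∑ j, (P.x j * P'.z j + P.z j * P'.x j)

/-- A unitary carrying the eigenbasis of `P_j` to the computational basis: `B P_j B† = Z`
for `P_j ≠ I`. -/
def toZBasis (P : PauliString n) (j : Fin n) : Matrix Bool Bool ℂ :=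
  if P.x j = 0 then 1 else (if P.z j = 0 then gateH else gateH * gateSᴴ)

end PauliString

/-- An `[[n, k]]` stabilizer code, `n = r + k`: `r = n - k` stabilizer generators and the logical
operators `Z̄_a`, `X̄_a`. Independence is that of the vectors `(x | z)` over `𝔽₂`, which says that no
non-empty product of the operators is a multiple of the identity (so `-I` is not in the group). -/
structure StabilizerCode (r k : ℕ) where
  gens : Fin r → PauliString (r + k)
  zbar : Fin k → PauliString (r + k)
  xbar : Fin k → PauliString (r + k)
  gens_comm : ∀ i i', (gens i).symp (gens i') = 0
  gens_zbar : ∀ i a, (gens i).symp (zbar a) = 0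
  gens_xbar : ∀ i a, (gens i).symp (xbar a) = 0
  zbar_comm : ∀ a a', (zbar a).symp (zbar a') = 0
  xbar_comm : ∀ a a', (xbar a).symp (xbar a') = 0
  xbar_zbar : ∀ a a', (xbar a).symp (zbar a') = if a = a' then 1 else 0
  indep : LinearIndependent (ZMod 2)
    fun i : Fin (r + k) => ((Fin.append gens zbar i).x, (Fin.append gens zbar i).z)

namespace StabilizerCode

variable {r k : ℕ} (code : StabilizerCode r k)

/-- The operators enforced by the encoding: the generators followed by the logical `Z`s. -/
def ops : Fin (r + k) → PauliString (r + k) := Fin.append code.gens code.zbar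

/-- `|v⟩` is a logical zero state: a unit vector fixed by all generators and logical `Z`s. -/
def IsLogicalZero (v : (Fin (r + k) → Bool) → ℂ) : Prop :=
  ∑ x, ‖v x‖ ^ 2 = 1 ∧ ∀ i, (code.ops i).mat *ᵥ v = v

/-- The logical zero state `|0…0⟩_L` (unique up to a phase). -/
def zeroL : (Fin (r + k) → Bool) → ℂ := Classical.epsilon code.IsLogicalZero

/-- The encoding isometry `|y⟩ ↦ |y⟩_L = (∏ₐ X̄ₐ^{yₐ}) |0…0⟩_L`. -/
def enc : Matrix (Fin (r + k) → Bool) (Fin k → Bool) ℂ :=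
  Matrix.of fun x y =>
    ((List.ofFn fun a => if y a then (code.xbar a).mat else 1).prod *ᵥ code.zeroL) x

/-- The encoding of several blocks, indexed by `β`, each in its own copy of the code. -/
def encBlocks (β : Type) [Fintype β] :
    Matrix (β × Fin (r + k) → Bool) (β × Fin k → Bool) ℂ :=
  Matrix.of fun x y => ∏ b, code.enc (fun j => x (b, j)) (fun a => y (b, a))

/-- A table of Pauli corrections: for the syndrome `m` it lists a Pauli operator that anticommutes
with exactly those enforced operators for which `m i = 1`. -/
def IsCorrectionTable (C : (Fin (r + k) → Bool) → PauliString (r + k)) : Prop :=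
  ∀ m i, (C m).symp (code.ops i) = if m i then 1 else 0

/-- The magic state `(|0⟩ + e^{iπ/4}|1⟩)/√2` on logical qubit `a`, the others being `|0⟩`. -/
def magicKet (a : Fin k) : (Fin k → Bool) → ℂ := fun y =>
  if ∀ a', a' ≠ a → y a' = false then gateT (y a) (y a) / (Real.sqrt 2 : ℂ) else 0

/-- The perfect encoded magic state. -/
def magicState (a : Fin k) : Op (Fin (r + k)) := pureState (code.enc *ᵥ magicKet a)

end StabilizerCode

/-! ### The network

There are `n` computation nodes and `t` trap nodes among the `n + t` leaf nodes; the master node is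
linked by quantum channels to every leaf. -/

/-- The qubits of the network. The master holds `n` syndrome qubits and two communication qubits.
Each leaf `l` holds a code qubit for the computation block (`code false l`; on trap nodes this is
the trap qubit), one for the magic-state block (`code true l`), a work qubit and a communication
qubit. -/
inductive Qubit (n t : ℕ) : Type
  | syn (i : Fin n)
  | hub (b : Bool)
  | code (b : Bool) (l : Fin (n + t))
  | work (l : Fin (n + t))
  | comm (l : Fin (n + t))
  deriving DecidableEq, Fintype

/-- The secret placement of computation and trap nodes among the leaf nodes. -/
abbrev Placement (n t : ℕ) : Type := Fin n ⊕ Fin t ≃ Fin (n + t)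

section Network

variable {n t : ℕ} (π : Placement n t)

/-- The code qubit at position `j` of block `b`. -/
def codeQubit (b : Bool) (j : Fin n) : Qubit n t := .code b (π (.inl j))

def trapQubit (i : Fin t) : Qubit n t := .code false (π (.inr i))

/-- Controlled-`A` between the leaf nodes `lA ≠ lC`, with control qubit `c` at `lA` and target qubit
`q` at `lC`, through the master: two Bell pairs, Bell measurement at the master with outcome
`(m₁, m₂)`, correction `X^{m₂} Z^{m₁}` at `lC`, and gate teleportation over the resulting pair. -/
def distributedCU (lA lC : Fin (n + t)) (c q : Qubit n t) (A : Matrix Bool Bool ℂ) :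
    Chan (Qubit n t) :=
  runAll
    [ bellPair (.comm lA) (.hub false),
      bellPair (.comm lC) (.hub true),
      conjBy (ctrl (.hub false) (onQubit (.hub true) gateX)),
      conjBy (onQubit (.hub false) gateH),
      measureOne (.hub false) fun m₁ => measureOne (.hub true) fun m₂ =>
        runAll
          [ applyIf m₁ (conjBy (onQubit (.comm lC) gateZ)),
            applyIf m₂ (conjBy (onQubit (.comm lC) gateX)) ],
      scst c (.comm lA) (.comm lC) q A ]

/-- A controlled Pauli operator with control qubit `c`: one controlled letter, executed by `cu`, for
each qubit of the support, and `Z` on the control if the sign is negative. -/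
def ctrlPauli (P : PauliString n) (c : Qubit n t)
    (cu : Fin n → Matrix Bool Bool ℂ → Chan (Qubit n t)) : Chan (Qubit n t) :=
  runAll ((List.finRange n).map (fun j => if j ∈ P.support then cu j (P.letter j) else id) ++
    [applyIf P.neg (conjBy (onQubit c gateZ))])

/-- Distributed encoding of `|0…0⟩_L` in the computation block: the master prepares its syndrome
qubits in `|+⟩` and the leaves their data qubits in `|0⟩`; for each enforced operator a controlled
Pauli is executed by gate teleportation between the master and the leaves; the master measures its
syndrome qubits in the `X` basis and the leaves apply the Pauli correction. -/
def distributedEncoding (ops : Fin n → PauliString n)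
    (C : (Fin n → Bool) → PauliString n) : Chan (Qubit n t) :=
  runAll
    ([ prepare Qubit.syn (tens fun _ => gateH * pureState (ket false) * gateHᴴ),
       prepare (codeQubit π false) (pureState (ket fun _ => false)) ] ++
     (List.finRange n).map (fun i => ctrlPauli (ops i) (.syn i) fun j A =>
        runAll
          [ bellPair (.hub false) (.comm (π (.inl j))),
            scst (.syn i) (.hub false) (.comm (π (.inl j))) (codeQubit π false j) A ]) ++
     [ conjBy (onQubits Qubit.syn (tens fun _ => gateH)),
       measureAll Qubit.syn fun m => conjBy (onQubits (codeQubit π false) (C m).mat) ])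

/-- Controlled Pauli operator on block `b`, controlled by the work qubit of computation node `A`;
letters at other nodes are executed by `distributedCU`, a letter at the node itself locally. -/
def ctrlPauliFrom (A : Fin n) (b : Bool) (P : PauliString n) : Chan (Qubit n t) :=
  ctrlPauli P (.work (π (.inl A))) fun j B =>
    if j = A then conjBy (ctrl (.work (π (.inl A))) (onQubit (codeQubit π b j) B))
    else distributedCU (π (.inl A)) (π (.inl j)) (.work (π (.inl A))) (codeQubit π b j) B

/-- Add the eigenvalue bit of the Pauli operator `P` on block `b` into the work qubit of node `A`. -/
def collect (A : Fin n) (b : Bool) (P : PauliString n) : Chan (Qubit n t) :=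
  runAll
    [ conjBy (onQubit (.work (π (.inl A))) gateH),
      ctrlPauliFrom π A b P,
      conjBy (onQubit (.work (π (.inl A))) gateH) ]

end Network

/-! ### Logical gates and their implementations -/

/-- Implementations of logical Clifford gates on the blocks `β`.
* `transversal V`: each computation node `j` applies `V j` locally to the qubits it holds, one per
  block;
* `phase b a isX`: the phase gate `diag(1, i)` in the eigenbasis of `Z̄_a` (or of `X̄_a` if `isX`) of
  block `b`, by a gadget that collects the eigenvalue bit in a work qubit;
* `cz b a b' a'`: logical controlled-`Z`, the control being collected in a work qubit from which
  a controlled-`Z̄` is executed;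
* `seq p q`: first `p`, then `q`. -/
inductive Impl (β : Type) (n k : ℕ) : Type
  | transversal (V : Fin n → Matrix (β → Bool) (β → Bool) ℂ)
  | phase (b : β) (a : Fin k) (isX : Bool)
  | cz (b : β) (a : Fin k) (b' : β) (a' : Fin k)
  | seq (p q : Impl β n k)

namespace Impl

variable {β : Type} [Fintype β] [DecidableEq β] {r k : ℕ}

/-- The operator `⊗ⱼ V j`. -/
def transversalMat {n : ℕ} (V : Fin n → Matrix (β → Bool) (β → Bool) ℂ) : Op (β × Fin n) :=
  Matrix.of fun x y => ∏ j, V j (fun b => x (b, j)) (fun b => y (b, j))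

/-- `p.For code W`: `p` is an implementation of the logical gate `W` for the code (gates are taken
up to a global phase). A transversal operation implements `W` if it maps the codespace to itself
and acts on it as `W`; a pre-compiled sequence implements `W` if its logical gates multiply to `W`. -/
def For (code : StabilizerCode r k) : Impl β (r + k) k → Op (β × Fin k) → Prop
  | transversal V, W => (∀ j, V j ∈ Matrix.unitaryGroup (β → Bool) ℂ) ∧
      ∃ c : ℂ, ‖c‖ = 1 ∧ transversalMat V * code.encBlocks β = c • (code.encBlocks β * W)
  | phase b a isX, W =>
      W = onQubit (b, a) (if isX then gateH * gateS * gateH else gateS)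
  | cz b a b' a', W => (b, a) ≠ (b', a') ∧ W = ctrl (b, a) (onQubit (b', a') gateZ)
  | seq p q, W => ∃ W₁ W₂, p.For code W₁ ∧ q.For code W₂ ∧
      ∃ c : ℂ, ‖c‖ = 1 ∧ W = c • (W₂ * W₁)

/-- The distributed execution; `blk` tells which block of the network carries the block `b : β`. -/
def exec {t : ℕ} (code : StabilizerCode r k) (π : Placement (r + k) t) (blk : β → Bool) :
    Impl β (r + k) k → Chan (Qubit (r + k) t)
  | transversal V =>
      conjBy (onQubits (fun p : β × Fin (r + k) => codeQubit π (blk p.1) p.2) (transversalMat V))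
  | phase b a isX =>
      let A := Fin.natAdd r a
      let P := if isX then code.xbar a else code.zbar a
      runAll
        [ prepare (fun _ : Unit => Qubit.work (π (.inl A))) (pureState (ket fun _ => false)),
          collect π A (blk b) P,
          conjBy (onQubit (.work (π (.inl A))) gateS),
          collect π A (blk b) P ]
  | cz b a b' a' =>
      let A := Fin.natAdd r a
      runAll
        [ prepare (fun _ : Unit => Qubit.work (π (.inl A))) (pureState (ket fun _ => false)),
          collect π A (blk b) (code.zbar a),
          ctrlPauliFrom π A (blk b') (code.zbar a'),
          collect π A (blk b) (code.zbar a) ]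
  | seq p q => runAll [exec code π blk p, exec code π blk q]

end Impl

/-- The implementations chosen by the client for the logical gates `H`, `S`, `CNOT` of the
computation block, and for the `CNOT` from logical qubit `a` of the computation block (`false`) to
logical qubit `a` of the magic-state block (`true`). -/
structure GateLibrary (r k : ℕ) where
  h : Fin k → Impl Unit (r + k) k
  s : Fin k → Impl Unit (r + k) k
  cnot : Fin k → Fin k → Impl Unit (r + k) k
  inject : Fin k → Impl Bool (r + k) k

/-- The library implements the gates for the code. -/
structure GateLibrary.Valid {r k : ℕ} (lib : GateLibrary r k) (code : StabilizerCode r k) :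
    Prop where
  h : ∀ a, (lib.h a).For code (onQubit ((), a) gateH)
  s : ∀ a, (lib.s a).For code (onQubit ((), a) gateS)
  cnot : ∀ a a', a ≠ a' → (lib.cnot a a').For code (ctrl ((), a) (onQubit ((), a') gateX))
  inject : ∀ a, (lib.inject a).For code (ctrl (false, a) (onQubit (true, a) gateX))

/-- The elementary gates on `k` logical qubits. -/
inductive LogicalGate (k : ℕ) : Type
  | H (a : Fin k)
  | S (a : Fin k)
  | CNOT (a a' : Fin k) (h : a ≠ a')
  | T (a : Fin k)

def LogicalGate.mat {k : ℕ} : LogicalGate k → Op (Fin k)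
  | H a => onQubit a gateH
  | S a => onQubit a gateS
  | CNOT a a' _ => ctrl a (onQubit a' gateX)
  | T a => onQubit a gateT

def LogicalGate.isT {k : ℕ} : LogicalGate k → Bool
  | T _ => true
  | _ => false

/-- The unitary `g_m ⋯ g_1` of the gate sequence `(g_1, …, g_m)`. -/
def circuitMat {k : ℕ} : List (LogicalGate k) → Op (Fin k)
  | [] => 1
  | g :: gs => circuitMat gs * g.mat

/-- The gate sequence `G` approximates `V` in operator norm to precision `ε`, up to a phase. -/
def Compiles {k : ℕ} (G : List (LogicalGate k)) (V : Op (Fin k)) (ε : ℝ) : Prop :=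
  ∃ c : ℂ, ‖c‖ = 1 ∧ ‖c • circuitMat G - V‖ ≤ ε

/-! ### The protocol -/

/-- All choices of the honest client: code, correction table, gate implementations, gate sequence,
the states supplied by the magic-state factory (`factory i a` is used if the `i`-th gate is a `T` on
logical qubit `a`), placement of the `t` traps, and the trap states: trap `i` is prepared in
`|v⟩` (basis bit `0`) or `H|v⟩` (basis bit `1`), where `trap i = (basis bit, v)`. -/
structure Protocol (r k t : ℕ) where
  code : StabilizerCode r k
  table : (Fin (r + k) → Bool) → PauliString (r + k)
  lib : GateLibrary r k
  gates : List (LogicalGate k)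
  factory : ℕ → Fin k → Op (Fin (r + k))
  place : Placement (r + k) t
  trap : Fin t → Bool × Bool

namespace Protocol

variable {r k t : ℕ} (p : Protocol r k t)

/-- The protocol prescriptions: a correct correction table and correct gate implementations. -/
def Valid : Prop := p.code.IsCorrectionTable p.table ∧ p.lib.Valid p.code

/-- The factory supplies encoded magic states with trace-distance error at most `δ`. -/
def FactoryWithin (δ : ℝ) : Prop :=
  ∀ i a, IsDensity (p.factory i a) ∧ traceDist (p.factory i a) (p.code.magicState a) ≤ δ

/-- The same run with perfect magic states. -/
def withPerfectFactory : Protocol r k t := { p with factory := fun _ a => p.code.magicState a }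

/-- Logical `T` by magic-state injection: the factory fills the magic-state block; logical CNOT from
the data qubit to the magic qubit; logical `Z` measurement of the magic qubit, each leaf measuring
its qubit in the eigenbasis of its letter of `Z̄_a`; the outcome `m` is the parity of the results on
the support (and the sign); then `S_L^m` on the data qubit. -/
def injectT (i : ℕ) (a : Fin k) : Chan (Qubit (r + k) t) :=
  runAll
    [ prepare (codeQubit p.place true) (p.factory i a),
      (p.lib.inject a).exec p.code p.place id,
      conjBy (onQubits (codeQubit p.place true) (tens (p.code.zbar a).toZBasis)),
      measureAll (codeQubit p.place true) fun s =>
        let m : Bool := (p.code.zbar a).neg ^^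
          decide (Odd (((p.code.zbar a).support.filter fun j => s j = true).card))
        applyIf m ((p.lib.s a).exec p.code p.place fun _ => false) ]

def execGate (i : ℕ) : LogicalGate k → Chan (Qubit (r + k) t)
  | .H a => (p.lib.h a).exec p.code p.place fun _ => false
  | .S a => (p.lib.s a).exec p.code p.place fun _ => false
  | .CNOT a a' _ => (p.lib.cnot a a').exec p.code p.place fun _ => false
  | .T a => p.injectT i a

/-- Execution of a gate sequence, the first gate having number `i`. Along with every gate the trap
nodes are instructed to apply the identity. -/
def execGates : ℕ → List (LogicalGate k) → Chan (Qubit (r + k) t)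
  | _, [] => id
  | i, g :: gs =>
      runAll [p.execGate i g, conjBy (onQubits (trapQubit p.place) 1), execGates (i + 1) gs]

/-- The unitary carrying the trap bases to the computational basis (and back). -/
def trapBasis : Op (Fin t) := tens fun i => if (p.trap i).1 then gateH else 1

/-- The values recorded by the client for the traps. -/
def trapValue : Fin t → Bool := fun i => (p.trap i).2

/-- The state of the network before the verification check. -/
def mainState : Op (Qubit (r + k) t) :=
  runAll
    [ prepare (trapQubit p.place) (pureState (p.trapBasis *ᵥ ket p.trapValue)),
      distributedEncoding p.place p.code.ops p.table,
      p.execGates 0 p.gates ]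
    (pureState (ket fun _ => false))

/-- The unnormalised state of the network after the trap nodes have measured their qubits in the
secret bases and returned the outcomes `s`. -/
def checkedState (s : Fin t → Bool) : Op (Qubit (r + k) t) :=
  conjBy (onQubits (trapQubit p.place) (pureState (ket s)))
    (conjBy (onQubits (trapQubit p.place) p.trapBasis) p.mainState)

/-- The probability that every trap outcome is the recorded one. -/
def acceptProb : ℂ := (p.checkedState p.trapValue).trace

/-- Output of the decoded state `u` as `some u`. -/
def keepOp : Matrix (Option (Fin k → Bool)) (Fin (r + k) → Bool) ℂ :=
  Matrix.of fun o x => match o with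
    | none => 0
    | some u => star (p.code.enc x u)

/-- Output of the error state `none`, with Kraus operators `|err⟩⟨d| A`. -/
def errOp (A : Op (Fin (r + k))) (d : Fin (r + k) → Bool) :
    Matrix (Option (Fin k → Bool)) (Fin (r + k) → Bool) ℂ :=
  Matrix.of fun o x => match o with
    | none => A d x
    | some _ => 0

/-- The joint final state of the client's output register (with basis `|u⟩`, `u ∈ {0,1}^k`, and the
error state `|err⟩`, written `none`) and of all other qubits. If all traps pass, the client takes
the computation block and inverts the encoding (a component outside the codespace gives `|err⟩`);
if some trap fails, she outputs `|err⟩`. -/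
def jointState :
    Matrix (Option (Fin k → Bool) × (Qubit (r + k) t → Bool))
      (Option (Fin k → Bool) × (Qubit (r + k) t → Bool)) ℂ :=
  handOver (codeQubit p.place false) p.keepOp (p.checkedState p.trapValue) +
  ∑ d, handOver (codeQubit p.place false) (errOp (1 - p.code.enc * p.code.encᴴ) d)
    (p.checkedState p.trapValue) +
  ∑ s ∈ Finset.univ.erase p.trapValue, ∑ d,
    handOver (codeQubit p.place false) (errOp 1 d) (p.checkedState s)

/-- The final output state of the client. -/
def outputState : Matrix (Option (Fin k → Bool)) (Option (Fin k → Bool)) ℂ :=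
  Matrix.of fun o o' => ∑ x, p.jointState (o, x) (o', x)

/-- The final state of all qubits other than the output register. -/
def restState : Op (Qubit (r + k) t) :=
  Matrix.of fun x y => ∑ o, p.jointState (o, x) (o, y)

/-- The output `|φ⟩` without error. -/
def okOutput (φ : (Fin k → Bool) → ℂ) : Matrix (Option (Fin k → Bool)) (Option (Fin k → Bool)) ℂ :=
  pureState fun o => o.elim 0 φ

/-- The ideal joint state: the client holds `|φ⟩`, and the rest is in its final state in an honest
execution with perfect magic states, uncorrelated with the output. -/
def idealState (φ : (Fin k → Bool) → ℂ) :
    Matrix (Option (Fin k → Bool) × (Qubit (r + k) t → Bool))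
      (Option (Fin k → Bool) × (Qubit (r + k) t → Bool)) ℂ :=
  Matrix.kroneckerMap (· * ·) (okOutput φ) p.withPerfectFactory.restState

/-- Completeness of the run with error `ε` for the desired output `|φ⟩`: the traps pass with
certainty, and the output state and the joint final state are `ε`-close to the ideal ones. -/
def CompleteWithin (φ : (Fin k → Bool) → ℂ) (ε : ℝ) : Prop :=
  p.acceptProb = 1 ∧
  traceDist p.outputState (okOutput φ) ≤ ε ∧
  traceDist p.jointState (p.idealState φ) ≤ ε

end Protocol

end DQC

end

open scoped Matrix

noncomputable section

namespace DQC

open scoped ComplexOrder Matrix.Norms.L2Operator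

/-! ### Algebra of local operators, controlled operators and Kraus channels on a qubit register -/

section RegisterAlgebra

set_option linter.unusedSectionVars false
set_option linter.unusedDecidableInType false
set_option linter.unusedFintypeInType false

variable {Q : Type} [Fintype Q] [DecidableEq Q] {ι : Type} [Fintype ι] [DecidableEq ι]
  {ι' : Type} [Fintype ι'] [DecidableEq ι']

theorem extend_comp_self {e : ι → Q} (he : Function.Injective e) (d : ι → Bool) (x : Q → Bool) :
    (fun i => Function.extend e d x (e i)) = d := by
  funext i; exact he.extend_apply _ _ _

theorem extend_eq_iff {e : ι → Q} (he : Function.Injective e) (d : ι → Bool) (x z : Q → Bool) :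
    Function.extend e d x = z ↔ (∀ i, d i = z (e i)) ∧ ∀ q, (∀ i, e i ≠ q) → x q = z q := by
  constructor
  · rintro rfl
    refine ⟨fun i => (he.extend_apply _ _ _).symm, fun q hq => ?_⟩
    rw [Function.extend_apply' _ _ _ (by simpa using hq)]
  · rintro ⟨h1, h2⟩
    funext q
    by_cases hq : ∃ i, e i = q
    · obtain ⟨i, rfl⟩ := hq
      rw [he.extend_apply, h1]
    · rw [Function.extend_apply' _ _ _ hq, h2 q (by simpa using hq)]

/-- Summation over the configurations that agree with `x` off the range of `e`. -/
theorem sum_agree_off {M : Type*} [AddCommMonoid M] {e : ι → Q} (he : Function.Injective e)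
    (x : Q → Bool) (f : (Q → Bool) → M) :
    ∑ z, (if ∀ q, (∀ i, e i ≠ q) → x q = z q then f z else 0) =
      ∑ d : ι → Bool, f (Function.extend e d x) := by
  rw [← Finset.sum_filter]
  symm
  refine Finset.sum_bij' (fun d _ => Function.extend e d x) (fun z _ => fun i => z (e i)) ?_ ?_ ?_ ?_ ?_
  · intro d _
    simp only [Finset.mem_filter, Finset.mem_univ, true_and]
    intro q hq
    rw [Function.extend_apply' _ _ _ (by simpa using hq)]
  · simp
  · intro d _; exact extend_comp_self he d x
  · intro z hz
    simp only [Finset.mem_filter, Finset.mem_univ, true_and] at hz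
    exact (extend_eq_iff he _ _ _).2 ⟨fun _ => rfl, hz⟩
  · simp

/-- A local operator only connects configurations that agree off its qubits, so the matrix product
collapses to a sum over values on those qubits. Most entrywise computations rest on this. -/
theorem onQubits_mul_apply {m : Type} {e : ι → Q} (he : Function.Injective e) (A : Op ι)
    (M : Matrix (Q → Bool) m ℂ) (x : Q → Bool) (y : m) :
    (onQubits e A * M) x y =
      ∑ d : ι → Bool, A (fun i => x (e i)) d * M (Function.extend e d x) y := by
  simp only [Matrix.mul_apply, onQubits, Matrix.of_apply, ite_mul, zero_mul]
  rw [sum_agree_off he x fun z => A (fun i => x (e i)) (fun i => z (e i)) * M z y]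
  simp only [extend_comp_self he]

theorem onQubits_one (e : ι → Q) : onQubits e (1 : Op ι) = 1 := by
  ext x y
  simp only [onQubits, Matrix.of_apply, Matrix.one_apply]
  by_cases h : x = y
  · simp [h]
  · rw [if_neg h]
    split_ifs with h1 h2
    · exact absurd (funext fun q => by
        by_cases hq : ∃ i, e i = q
        · obtain ⟨i, rfl⟩ := hq; exact congrFun h2 i
        · exact h1 q (by simpa using hq)) h
    · rfl
    · rfl

theorem onQubits_mul {e : ι → Q} (he : Function.Injective e) (A B : Op ι) :
    onQubits e (A * B) = onQubits e A * onQubits e B := by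
  ext x y
  rw [onQubits_mul_apply he]
  simp only [onQubits, Matrix.of_apply, extend_comp_self he, Matrix.mul_apply]
  have h : ∀ d : ι → Bool, (∀ q, (∀ i, e i ≠ q) → Function.extend e d x q = y q) ↔
      ∀ q, (∀ i, e i ≠ q) → x q = y q := fun d => forall₂_congr fun q hq => by
    rw [Function.extend_apply' _ _ _ (by simpa using hq)]
  simp only [h]
  split_ifs <;> simp

theorem onQubits_conjTranspose (e : ι → Q) (A : Op ι) :
    onQubits e Aᴴ = (onQubits e A)ᴴ := by
  ext x y
  simp only [onQubits, Matrix.of_apply, Matrix.conjTranspose_apply]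
  have h : (∀ q, (∀ i, e i ≠ q) → x q = y q) ↔ ∀ q, (∀ i, e i ≠ q) → y q = x q :=
    forall₂_congr fun q hq => eq_comm
  simp only [h]
  split_ifs <;> simp

theorem onQubits_zero (e : ι → Q) : onQubits e (0 : Op ι) = 0 := by
  ext x y; simp [onQubits]

theorem onQubits_add (e : ι → Q) (A B : Op ι) :
    onQubits e (A + B) = onQubits e A + onQubits e B := by
  ext x y; simp only [onQubits, Matrix.of_apply, Matrix.add_apply]; split_ifs <;> simp

theorem onQubits_smul (e : ι → Q) (c : ℂ) (A : Op ι) :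
    onQubits e (c • A) = c • onQubits e A := by
  ext x y; simp only [onQubits, Matrix.of_apply, Matrix.smul_apply]; split_ifs <;> simp

theorem onQubits_sum {κ : Type*} (s : Finset κ) (e : ι → Q) (A : κ → Op ι) :
    onQubits e (∑ i ∈ s, A i) = ∑ i ∈ s, onQubits e (A i) := by
  classical
  induction s using Finset.induction_on with
  | empty => simp [onQubits_zero]
  | insert a s ha ih => rw [Finset.sum_insert ha, Finset.sum_insert ha, onQubits_add, ih]

theorem onQubits_sub (e : ι → Q) (A B : Op ι) :
    onQubits e (A - B) = onQubits e A - onQubits e B := by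
  ext x y; simp only [onQubits, Matrix.of_apply, Matrix.sub_apply]; split_ifs <;> simp

theorem onQubits_comp {e : ι → Q} (he : Function.Injective e) (f : ι' → ι) (A : Op ι') :
    onQubits e (onQubits f A) = onQubits (e ∘ f) A := by
  ext x y
  simp only [onQubits, Matrix.of_apply, Function.comp]
  have h : (∀ q, (∀ i, e (f i) ≠ q) → x q = y q) ↔
      (∀ q, (∀ i, e i ≠ q) → x q = y q) ∧ (∀ i, (∀ j, f j ≠ i) → x (e i) = y (e i)) := by
    constructor
    · intro h
      exact ⟨fun q hq => h q fun i => hq _, fun i hi => h _ fun j hj => hi j (he hj)⟩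
    · rintro ⟨h1, h2⟩ q hq
      by_cases hq' : ∃ i, e i = q
      · obtain ⟨i, rfl⟩ := hq'
        exact h2 i fun j hj => hq j (by rw [hj])
      · exact h1 q (by simpa using hq')
  simp only [h, ite_and]

theorem onQubits_commute {e : ι → Q} {f : ι' → Q} (he : Function.Injective e)
    (hf : Function.Injective f) (hef : ∀ i j, e i ≠ f j) (A : Op ι) (B : Op ι') :
    onQubits e A * onQubits f B = onQubits f B * onQubits e A := by
  -- The entries of the product are given by an expression symmetric in the two operators, up to the
  -- order of the scalar factors.
  have key : ∀ {ι ι' : Type} [Fintype ι] [DecidableEq ι] [Fintype ι'] [DecidableEq ι']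
      {e : ι → Q} {f : ι' → Q} (he : Function.Injective e)
      (hef : ∀ i j, e i ≠ f j) (A : Op ι) (B : Op ι') (x y : Q → Bool),
      (onQubits e A * onQubits f B) x y =
        if ∀ q, (∀ i, e i ≠ q) → (∀ j, f j ≠ q) → x q = y q then
          A (fun i => x (e i)) (fun i => y (e i)) * B (fun i => x (f i)) (fun i => y (f i))
        else 0 := by
    intro ι ι' _ _ _ _ e f he hef A B x y
    rw [onQubits_mul_apply he, Finset.sum_eq_single (fun i => y (e i))]
    · simp only [onQubits, Matrix.of_apply]
      have h : (∀ q, (∀ j, f j ≠ q) → Function.extend e (fun i => y (e i)) x q = y q) ↔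
          ∀ q, (∀ i, e i ≠ q) → (∀ j, f j ≠ q) → x q = y q := by
        refine forall_congr' fun q => ?_
        by_cases hq : ∃ i, e i = q
        · obtain ⟨i, rfl⟩ := hq
          simp only [he.extend_apply, implies_true, true_iff]
          exact fun h => absurd rfl (h i)
        · rw [Function.extend_apply' _ _ _ hq]
          simp only [ne_eq, not_exists] at hq ⊢
          simp [hq]
      have h' : (fun j => Function.extend e (fun i => y (e i)) x (f j)) = fun j => x (f j) := by
        funext j
        rw [Function.extend_apply' _ _ _ (by rintro ⟨i, hi⟩; exact hef i j hi)]
      simp only [h, h', mul_ite, mul_zero]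
    · intro d _ hd
      simp only [onQubits, Matrix.of_apply]
      rw [if_neg, mul_zero]
      intro h
      apply hd
      funext i
      have := h (e i) fun j hj => hef i j hj.symm
      rwa [he.extend_apply] at this
    · simp
  ext x y
  rw [key he hef, key hf fun i j h => hef j i h.symm]
  simp only [mul_comm]
  have : (∀ q, (∀ i, e i ≠ q) → (∀ j, f j ≠ q) → x q = y q) ↔
      (∀ q, (∀ i, f i ≠ q) → (∀ j, e j ≠ q) → x q = y q) :=
    forall_congr' fun q => by tauto
  simp only [this]

/-- A single-qubit matrix as an operator on the one-qubit register. -/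
def single (A : Matrix Bool Bool ℂ) : Op Unit := Matrix.of fun x y => A (x ()) (y ())

theorem onQubit_eq (q : Q) (A : Matrix Bool Bool ℂ) :
    onQubit q A = onQubits (fun _ : Unit => q) (single A) := by
  ext x y
  simp only [onQubit, onQubits, single, Matrix.of_apply]
  simp only [ne_eq, forall_const, eq_comm]

theorem single_mul (A B : Matrix Bool Bool ℂ) : single (A * B) = single A * single B := by
  ext x y
  simp only [single, Matrix.of_apply, Matrix.mul_apply]
  rw [← (Equiv.funUnique Unit Bool).symm.sum_comp]
  rfl

theorem single_one : single 1 = 1 := by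
  ext x y
  simp only [single, Matrix.of_apply, Matrix.one_apply]
  have : (x = y) ↔ x () = y () := ⟨fun h => h ▸ rfl, fun h => funext fun _ => h⟩
  simp only [this]

theorem const_injective (q : Q) : Function.Injective (fun _ : Unit => q) := fun _ _ _ => rfl

theorem onQubit_mul (q : Q) (A B : Matrix Bool Bool ℂ) :
    onQubit q (A * B) = onQubit q A * onQubit q B := by
  simp only [onQubit_eq, single_mul, onQubits_mul (const_injective q)]

theorem onQubit_one (q : Q) : onQubit q 1 = 1 := by
  rw [onQubit_eq, single_one, onQubits_one]

theorem onQubit_add (q : Q) (A B : Matrix Bool Bool ℂ) :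
    onQubit q (A + B) = onQubit q A + onQubit q B := by
  rw [onQubit_eq, onQubit_eq, onQubit_eq, ← onQubits_add]; rfl

theorem onQubit_smul (q : Q) (c : ℂ) (A : Matrix Bool Bool ℂ) :
    onQubit q (c • A) = c • onQubit q A := by
  rw [onQubit_eq, onQubit_eq, ← onQubits_smul]; rfl

theorem onQubit_conjTranspose (q : Q) (A : Matrix Bool Bool ℂ) :
    onQubit q Aᴴ = (onQubit q A)ᴴ := by
  rw [onQubit_eq, onQubit_eq, ← onQubits_conjTranspose]; rfl

theorem onQubits_onQubit {e : ι → Q} (he : Function.Injective e) (i : ι)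
    (A : Matrix Bool Bool ℂ) : onQubits e (onQubit i A) = onQubit (e i) A := by
  rw [onQubit_eq, onQubit_eq, onQubits_comp he]; rfl

theorem onQubit_mul_apply {m : Type} (q : Q) (A : Matrix Bool Bool ℂ)
    (M : Matrix (Q → Bool) m ℂ) (x : Q → Bool) (y : m) :
    (onQubit q A * M) x y = ∑ b, A (x q) b * M (Function.update x q b) y := by
  rw [onQubit_eq, onQubits_mul_apply (const_injective q),
    ← (Equiv.funUnique Unit Bool).symm.sum_comp]
  refine Finset.sum_congr rfl fun b _ => ?_
  congr 2
  rw [extend_eq_iff (const_injective q)]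
  constructor
  · intro i; simp
  · intro p hp; rw [Function.update_of_ne (by simpa [eq_comm] using hp)]

theorem onQubit_commute {p q : Q} (h : p ≠ q) (A B : Matrix Bool Bool ℂ) :
    onQubit p A * onQubit q B = onQubit q B * onQubit p A := by
  rw [onQubit_eq, onQubit_eq,
    onQubits_commute (const_injective p) (const_injective q) fun _ _ => h]

/-! ### Tensor products -/

theorem tens_mul (A B : ι → Matrix Bool Bool ℂ) :
    tens A * tens B = tens fun i => A i * B i := by
  ext x y
  simp only [tens, Matrix.mul_apply, Matrix.of_apply, ← Finset.prod_mul_distrib]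
  rw [Finset.prod_univ_sum, Fintype.piFinset_univ]

theorem tens_conjTranspose (A : ι → Matrix Bool Bool ℂ) :
    (tens A)ᴴ = tens fun i => (A i)ᴴ := by
  ext x y
  simp [tens, Matrix.conjTranspose_apply]

theorem prod_one_apply (x y : ι → Bool) :
    ∏ i, (1 : Matrix Bool Bool ℂ) (x i) (y i) = if x = y then 1 else 0 := by
  by_cases h : x = y
  · subst h; simp
  · rw [if_neg h]
    obtain ⟨i, hi⟩ := Function.ne_iff.1 h
    exact Finset.prod_eq_zero (Finset.mem_univ i) (Matrix.one_apply_ne hi)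

theorem tens_one : tens (fun _ : ι => (1 : Matrix Bool Bool ℂ)) = 1 := by
  ext x y
  simp only [tens, Matrix.of_apply]
  rw [prod_one_apply, Matrix.one_apply]

theorem onQubit_eq_tens (i : ι) (A : Matrix Bool Bool ℂ) :
    onQubit i A = tens (Function.update (fun _ => (1 : Matrix Bool Bool ℂ)) i A) := by
  ext x y
  simp only [onQubit, tens, Matrix.of_apply]
  rw [← Finset.mul_prod_erase _ _ (Finset.mem_univ i), Function.update_self]
  by_cases h : ∀ p, p ≠ i → x p = y p
  · rw [if_pos h, Finset.prod_eq_one, mul_one]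
    intro j hj
    rw [Function.update_of_ne (Finset.ne_of_mem_erase hj), h j (Finset.ne_of_mem_erase hj),
      Matrix.one_apply_eq]
  · rw [if_neg h]
    push Not at h
    obtain ⟨j, hj, hxy⟩ := h
    rw [Finset.prod_eq_zero (Finset.mem_erase.2 ⟨hj, Finset.mem_univ j⟩), mul_zero]
    rw [Function.update_of_ne hj, Matrix.one_apply_ne hxy]

theorem prod_onQubit_list (A : ι → Matrix Bool Bool ℂ) (l : List ι) (hl : l.Nodup) :
    (l.map fun i => onQubit i (A i)).prod = tens fun i => if i ∈ l then A i else 1 := by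
  induction l with
  | nil => simp [tens_one]
  | cons a l ih =>
    rw [List.nodup_cons] at hl
    rw [List.map_cons, List.prod_cons, ih hl.2, onQubit_eq_tens, tens_mul]
    congr 1
    funext i
    by_cases h : i = a
    · subst h; simp [hl.1]
    · simp [h]

theorem tens_eq_prod (A : ι → Matrix Bool Bool ℂ) :
    tens A = ((Finset.univ : Finset ι).toList.map fun i => onQubit i (A i)).prod := by
  rw [prod_onQubit_list _ _ (Finset.nodup_toList _)]
  simp

/-- Expansion in matrix units, each of which is a tensor product; it reduces statements about
arbitrary operators to single-qubit ones. -/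
theorem matrix_eq_sum_tens (A : Op ι) :
    A = ∑ x, ∑ y, A x y • tens fun i => Matrix.single (x i) (y i) (1 : ℂ) := by
  ext a b
  simp only [Matrix.sum_apply, Matrix.smul_apply, tens, Matrix.of_apply, smul_eq_mul,
    Matrix.single_apply]
  rw [Finset.sum_eq_single a, Finset.sum_eq_single b]
  · simp
  · intro y _ hy
    obtain ⟨i, hi⟩ := Function.ne_iff.1 hy
    rw [Finset.prod_eq_zero (Finset.mem_univ i) (by simp [hi]), mul_zero]
  · simp
  · intro x _ hx
    obtain ⟨i, hi⟩ := Function.ne_iff.1 hx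
    exact Finset.sum_eq_zero fun y _ => by
      rw [Finset.prod_eq_zero (Finset.mem_univ i) (by simp [hi]), mul_zero]
  · simp

/-- An operator that commutes with all single-qubit operators on the qubits of `e` commutes with
all operators on these qubits. -/
theorem commute_onQubits {e : ι → Q} (he : Function.Injective e) {K : Op Q}
    (h : ∀ i B, Commute K (onQubit (e i) B)) (A : Op ι) : Commute K (onQubits e A) := by
  rw [matrix_eq_sum_tens A, onQubits_sum]
  refine Commute.sum_right _ _ _ fun x _ => ?_
  rw [onQubits_sum]
  refine Commute.sum_right _ _ _ fun y _ => ?_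
  rw [onQubits_smul]
  refine Commute.smul_right ?_ _
  rw [tens_eq_prod]
  generalize (Finset.univ : Finset ι).toList = l
  induction l with
  | nil => simp [onQubits_one]
  | cons a l ih =>
    rw [List.map_cons, List.prod_cons, onQubits_mul he, onQubits_onQubit he]
    exact (h a _).mul_right ih

/-! ### Locality -/

/-- Operators supported on the set `S` of qubits. -/
def Loc (S : Set Q) : Subalgebra ℂ (Op Q) :=
  Subalgebra.centralizer ℂ {A | ∃ q ∉ S, ∃ B, A = onQubit q B}

/-- Operators that commute with all operators supported on `S`. -/
def Off (S : Set Q) : Subalgebra ℂ (Op Q) := Subalgebra.centralizer ℂ (Loc S : Set (Op Q))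

theorem mem_Loc {S : Set Q} {A : Op Q} :
    A ∈ Loc S ↔ ∀ q ∉ S, ∀ B, Commute A (onQubit q B) := by
  simp only [Loc, Subalgebra.mem_centralizer_iff, Set.mem_ofPred_eq, forall_exists_index, and_imp]
  constructor
  · intro h q hq B; exact (h _ q hq B rfl).symm
  · rintro h _ q hq B rfl; exact (h q hq B).symm

theorem mem_Off {S : Set Q} {A : Op Q} : A ∈ Off S ↔ ∀ K ∈ Loc S, Commute K A := by
  simp only [Off, Subalgebra.mem_centralizer_iff]; rfl

theorem Loc_mono {S T : Set Q} (h : S ⊆ T) : Loc S ≤ Loc T := fun _ hA =>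
  mem_Loc.2 fun q hq => mem_Loc.1 hA q fun hS => hq (h hS)

theorem onQubits_mem_Loc {S : Set Q} {e : ι → Q} (he : Function.Injective e) (hS : ∀ i, e i ∈ S)
    (A : Op ι) : onQubits e A ∈ Loc S :=
  mem_Loc.2 fun q hq B => by
    rw [onQubit_eq]
    exact onQubits_commute he (const_injective q) (fun i _ h => hq (h ▸ hS i)) _ _

theorem onQubits_mem_Off {S : Set Q} {e : ι → Q} (he : Function.Injective e)
    (hS : ∀ i, e i ∉ S) (A : Op ι) : onQubits e A ∈ Off S :=
  mem_Off.2 fun _ hK => commute_onQubits he (fun i B => mem_Loc.1 hK _ (hS i) B) A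

theorem onQubit_mem_Off {S : Set Q} {q : Q} (hq : q ∉ S) (A : Matrix Bool Bool ℂ) :
    onQubit q A ∈ Off S :=
  mem_Off.2 fun _ hK => mem_Loc.1 hK _ hq A

/-! ### Controlled operators -/

/-- The form `|0⟩⟨0| + |1⟩⟨1| A`, in which controlled operators are handled by commutation with
operators on the control. -/
theorem ctrl_eq (c : Q) (A : Op Q) :
    ctrl c A = onQubit c (Matrix.diagonal fun b => if b then 0 else 1) +
      onQubit c (Matrix.diagonal fun b => if b then 1 else 0) * A := by
  ext x y
  rw [Matrix.add_apply, onQubit_mul_apply]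
  simp only [ctrl, onQubit, Matrix.of_apply, Fintype.sum_bool, Matrix.diagonal_apply]
  cases hx : x c
  · simp only [Bool.false_eq_true, if_false, zero_mul, add_zero, ite_self]
    by_cases h : x = y
    · subst h; simp [hx]
    · rw [if_neg h]
      split_ifs with h1 h2
      · exact absurd (funext fun q => by
          by_cases hq : q = c
          · rw [hq, hx]; exact h2
          · exact h1 q hq) h
      · rfl
      · rfl
  · have : Function.update x c true = x := by rw [← hx, Function.update_eq_self]
    simp [this]

theorem ctrl_mem {S : Subalgebra ℂ (Op Q)} {c : Q} {A : Op Q} (hc : ∀ B, onQubit c B ∈ S)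
    (hA : A ∈ S) : ctrl c A ∈ S := by
  rw [ctrl_eq]; exact S.add_mem (hc _) (S.mul_mem (hc _) hA)

theorem ctrl_mul_apply {m : Type} (c : Q) (A : Op Q) (M : Matrix (Q → Bool) m ℂ) (x : Q → Bool)
    (y : m) : (ctrl c A * M) x y = if x c then (A * M) x y else M x y := by
  simp only [Matrix.mul_apply, ctrl, Matrix.of_apply]
  split_ifs <;> simp

/-- Only the left factor has to commute with operators on the control: this kills the cross term
`|1⟩⟨1| A |0⟩⟨0|`. -/
theorem ctrl_mul {c : Q} {A B : Op Q} (hA : ∀ C, Commute (onQubit c C) A) :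
    ctrl c (A * B) = ctrl c A * ctrl c B := by
  ext x y
  rw [ctrl_mul_apply]
  have h1 : A * ctrl c B = onQubit c (Matrix.diagonal fun b => if b then 0 else 1) * A +
      onQubit c (Matrix.diagonal fun b => if b then 1 else 0) * (A * B) := by
    rw [ctrl_eq, mul_add, ← (hA _).eq, ← mul_assoc, ← (hA _).eq, mul_assoc]
  rw [h1, Matrix.add_apply, onQubit_mul_apply, onQubit_mul_apply]
  simp only [ctrl, Matrix.of_apply, Fintype.sum_bool, Matrix.diagonal_apply]
  cases hx : x c
  · simp
  · have : Function.update x c true = x := by rw [← hx, Function.update_eq_self]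
    simp [this]

theorem ctrl_one (c : Q) : ctrl c (1 : Op Q) = 1 := by
  ext x y; simp [ctrl, Matrix.one_apply]

theorem ctrl_conjTranspose {c : Q} {A : Op Q} (hA : ∀ C, Commute (onQubit c C) A) :
    (ctrl c A)ᴴ = ctrl c Aᴴ := by
  have h := (hA (Matrix.diagonal fun b => if b then 1 else 0)).eq
  have hd : ∀ f : Bool → ℂ, (∀ b, star (f b) = f b) →
      (onQubit c (Matrix.diagonal f))ᴴ = onQubit c (Matrix.diagonal f) := fun f hf => by
    rw [← onQubit_conjTranspose, Matrix.diagonal_conjTranspose]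
    congr 2; funext b; exact hf b
  have hd1 := hd (fun b => if b then 0 else 1) (by intro b; cases b <;> simp)
  have hd2 := hd (fun b => if b then 1 else 0) (by intro b; cases b <;> simp)
  have h2 := congrArg Matrix.conjTranspose h
  rw [Matrix.conjTranspose_mul, Matrix.conjTranspose_mul, hd2] at h2
  rw [ctrl_eq, ctrl_eq, Matrix.conjTranspose_add, Matrix.conjTranspose_mul, hd1, hd2, h2]

theorem ctrl_unitary {c : Q} {A : Op Q} (hA : ∀ C, Commute (onQubit c C) A) (hU : Aᴴ * A = 1) :
    (ctrl c A)ᴴ * ctrl c A = 1 := by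
  have hA' : ∀ C, Commute (onQubit c C) Aᴴ := fun C => by
    have h2 := congrArg Matrix.conjTranspose (hA Cᴴ).eq
    rw [Matrix.conjTranspose_mul, Matrix.conjTranspose_mul, onQubit_conjTranspose,
      Matrix.conjTranspose_conjTranspose] at h2
    exact h2.symm
  rw [ctrl_conjTranspose hA, ← ctrl_mul hA', hU, ctrl_one]

/-! ### Channels with Kraus operators -/

/-- The map `c` has a Kraus representation, normalised to preserve the trace, with operators
from `M`. -/
def KrausBy (M : Subalgebra ℂ (Op Q)) (c : Chan Q) : Prop :=
  ∃ (κ : Type) (_ : Fintype κ) (K : κ → Op Q), (∀ i, K i ∈ M) ∧ ∑ i, (K i)ᴴ * K i = 1 ∧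
    ∀ ρ, c ρ = ∑ i, conjBy (K i) ρ

variable {M : Subalgebra ℂ (Op Q)}

theorem conjBy_conjBy (A B : Op Q) (ρ : Op Q) : conjBy A (conjBy B ρ) = conjBy (A * B) ρ := by
  simp only [conjBy, Matrix.conjTranspose_mul, mul_assoc]

theorem conjBy_sum {κ : Type*} (s : Finset κ) (A : Op Q) (ρ : κ → Op Q) :
    conjBy A (∑ i ∈ s, ρ i) = ∑ i ∈ s, conjBy A (ρ i) := by
  simp only [conjBy, Finset.mul_sum, Finset.sum_mul]

theorem KrausBy.mono {N : Subalgebra ℂ (Op Q)} (h : M ≤ N) {c : Chan Q} (hc : KrausBy M c) :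
    KrausBy N c := by
  obtain ⟨κ, _, K, hK, h1, h2⟩ := hc
  exact ⟨κ, inferInstance, K, fun i => h (hK i), h1, h2⟩

theorem KrausBy.conjBy {A : Op Q} (hA : A ∈ M) (hU : Aᴴ * A = 1) : KrausBy M (conjBy A) :=
  ⟨Unit, inferInstance, fun _ => A, fun _ => hA, by simpa using hU, fun ρ => by simp⟩

theorem KrausBy.id : KrausBy M (id : Chan Q) :=
  ⟨Unit, inferInstance, fun _ => 1, fun _ => M.one_mem, by simp, fun ρ => by simp [DQC.conjBy]⟩

theorem KrausBy.comp {c d : Chan Q} (hc : KrausBy M c) (hd : KrausBy M d) :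
    KrausBy M fun ρ => d (c ρ) := by
  obtain ⟨κ, _, K, hK, h1, h2⟩ := hc
  obtain ⟨κ', _, K', hK', h1', h2'⟩ := hd
  refine ⟨κ' × κ, inferInstance, fun p => K' p.1 * K p.2, fun p => M.mul_mem (hK' _) (hK _), ?_, ?_⟩
  · rw [Fintype.sum_prod_type_right]
    calc ∑ j, ∑ i, (K' i * K j)ᴴ * (K' i * K j) = ∑ j, (K j)ᴴ * (∑ i, (K' i)ᴴ * K' i) * K j := by
          simp only [Finset.mul_sum, Finset.sum_mul, Matrix.conjTranspose_mul, mul_assoc]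
      _ = 1 := by rw [h1']; simpa using h1
  · intro ρ
    simp only [h2, h2', conjBy_sum, conjBy_conjBy, Fintype.sum_prod_type]

theorem KrausBy.runAll {l : List (Chan Q)} (h : ∀ c ∈ l, KrausBy M c) : KrausBy M (runAll l) := by
  induction l with
  | nil => exact KrausBy.id
  | cons c l ih =>
    exact (h c (by simp)).comp (ih fun d hd => h d (by simp [hd]))

theorem KrausBy.applyIf {c : Chan Q} (hc : KrausBy M c) (m : Bool) : KrausBy M (applyIf m c) := by
  cases m
  · exact KrausBy.id
  · exact hc

/-- Measurement with classical feed-forward: the Kraus operators are indexed by an outcome together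
with a Kraus index of the continuation chosen for it. -/
theorem KrausBy.sum {κ : Type} [Fintype κ] (P : κ → Op Q) (hP : ∀ s, P s ∈ M)
    (h1 : ∑ s, (P s)ᴴ * P s = 1) (f : κ → Chan Q) (hf : ∀ s, KrausBy M (f s)) :
    KrausBy M fun ρ => ∑ s, f s (DQC.conjBy (P s) ρ) := by
  choose κ' h K hK h2 h3 using hf
  refine ⟨Σ s, κ' s, inferInstance, fun p => K p.1 p.2 * P p.1,
    fun p => M.mul_mem (hK _ _) (hP _), ?_, ?_⟩
  · rw [Fintype.sum_sigma, ← h1]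
    refine Finset.sum_congr rfl fun s _ => ?_
    calc ∑ i, (K s i * P s)ᴴ * (K s i * P s) = (P s)ᴴ * (∑ i, (K s i)ᴴ * K s i) * P s := by
          simp only [Finset.mul_sum, Finset.sum_mul, Matrix.conjTranspose_mul, mul_assoc]
      _ = _ := by rw [h2]; simp
  · intro ρ
    simp only [h3, conjBy_conjBy, Fintype.sum_sigma]

theorem pureState_conjTranspose {m : Type} (v : m → ℂ) : (pureState v)ᴴ = pureState v := by
  ext i j; simp [pureState, Matrix.vecMulVec_apply, mul_comm]

theorem pureState_ket_apply {m : Type} [DecidableEq m] (s i j : m) :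
    pureState (ket s) i j = if i = s ∧ j = s then 1 else 0 := by
  simp only [pureState, ket, Matrix.vecMulVec_apply, Pi.star_apply, Pi.single_apply]
  by_cases hi : i = s <;> by_cases hj : j = s <;> simp [hi, hj]

theorem pureState_ket_mul_self {m : Type} [Fintype m] [DecidableEq m] (s : m) :
    pureState (ket s) * pureState (ket s) = pureState (ket s) := by
  ext i j
  simp only [Matrix.mul_apply, pureState_ket_apply]
  rw [Finset.sum_eq_single s]
  · by_cases hi : i = s <;> by_cases hj : j = s <;> simp [hi, hj]
  · intro b _ hb; simp [hb]
  · simp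

theorem sum_pureState_ket {m : Type} [Fintype m] [DecidableEq m] :
    ∑ s : m, pureState (ket s) = 1 := by
  ext i j
  simp only [Matrix.sum_apply, pureState_ket_apply, Matrix.one_apply]
  rw [Finset.sum_eq_single i] <;> simp +contextual [eq_comm]

theorem KrausBy.measureAll {e : ι → Q} (he : Function.Injective e) (hM : ∀ A, onQubits e A ∈ M)
    {f : (ι → Bool) → Chan Q} (hf : ∀ s, KrausBy M (f s)) : KrausBy M (measureAll e f) := by
  refine KrausBy.sum _ (fun s => hM _) ?_ f hf
  simp only [← onQubits_conjTranspose, pureState_conjTranspose, ← onQubits_mul he,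
    pureState_ket_mul_self, ← onQubits_sum, sum_pureState_ket, onQubits_one]


theorem mul_onQubits_conjTranspose_apply {m : Type} {e : ι → Q} (he : Function.Injective e)
    (A : Op ι) (N : Matrix m (Q → Bool) ℂ) (x : m) (y : Q → Bool) :
    (N * (onQubits e A)ᴴ) x y =
      ∑ d : ι → Bool, N x (Function.extend e d y) * star (A (fun i => y (e i)) d) := by
  have h : N * (onQubits e A)ᴴ = (onQubits e A * Nᴴ)ᴴ := by simp
  rw [h, Matrix.conjTranspose_apply, onQubits_mul_apply he, star_sum]
  simp [mul_comm]

/-- Discarding is a sum over the values `b` found on the old qubits, so the Kraus operators of a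
preparation are `|t k⟩⟨b|`. -/
theorem prepare_eq_sum {e : ι → Q} (he : Function.Injective e) {κ : Type} [Fintype κ]
    (t : κ → (ι → Bool) → ℂ) (ρ : Op Q) :
    prepare e (∑ k, pureState (t k)) ρ =
      ∑ p : κ × (ι → Bool),
        conjBy (onQubits e (Matrix.vecMulVec (t p.1) (ket p.2))) ρ := by
  ext x y
  simp only [prepare, Matrix.of_apply, Matrix.sum_apply, Fintype.sum_prod_type]
  rw [Finset.sum_mul]
  refine Finset.sum_congr rfl fun k _ => ?_
  rw [Finset.mul_sum]
  refine Finset.sum_congr rfl fun b _ => ?_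
  rw [conjBy, mul_onQubits_conjTranspose_apply he]
  simp only [onQubits_mul_apply he, Matrix.vecMulVec_apply, ket, Pi.single_apply]
  rw [Finset.sum_eq_single b, Finset.sum_eq_single b]
  · simp only [pureState, Matrix.vecMulVec_apply, Pi.star_apply, if_true, mul_one]
    ring
  · intro d _ hd; simp [hd]
  · simp
  · intro d _ hd; simp [hd]
  · simp

theorem prepare_pureState {e : ι → Q} (he : Function.Injective e) (v : (ι → Bool) → ℂ)
    (ρ : Op Q) : prepare e (pureState v) ρ =
      ∑ b : ι → Bool, conjBy (onQubits e (Matrix.vecMulVec v (ket b))) ρ := by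
  have := prepare_eq_sum he (fun _ : Unit => v) ρ
  simpa [Fintype.sum_prod_type] using this

open scoped MatrixOrder in
-- Write `τ = B†B`; the vectors are the conjugated rows of `B`. No spectral decomposition is needed.
theorem exists_sum_pureState {m : Type} [Fintype m] [DecidableEq m] {τ : Matrix m m ℂ}
    (hτ : τ.PosSemidef) : ∃ t : m → m → ℂ, τ = ∑ k, pureState (t k) := by
  obtain ⟨B, hB⟩ := CStarAlgebra.nonneg_iff_eq_star_mul_self.mp hτ.nonneg
  refine ⟨fun k i => star (B k i), ?_⟩
  rw [hB, Matrix.star_eq_conjTranspose]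
  ext i j
  simp [Matrix.mul_apply, Matrix.sum_apply, pureState, Matrix.vecMulVec_apply]

theorem trace_pureState {m : Type} [Fintype m] (v : m → ℂ) :
    (pureState v).trace = ((∑ x, ‖v x‖ ^ 2 : ℝ) : ℂ) := by
  simp [Matrix.trace, pureState, Matrix.vecMulVec_apply, Complex.mul_conj, Complex.normSq_eq_norm_sq]

theorem KrausBy.prepare {e : ι → Q} (he : Function.Injective e) (hM : ∀ A, onQubits e A ∈ M)
    {τ : Op ι} (hτ : IsDensity τ) : KrausBy M (prepare e τ) := by
  obtain ⟨t, ht⟩ := exists_sum_pureState hτ.1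
  refine ⟨_ × (ι → Bool), inferInstance, fun p => onQubits e (Matrix.vecMulVec (t p.1) (ket p.2)),
    fun p => hM _, ?_, fun ρ => by rw [ht, prepare_eq_sum he]⟩
  simp only [← onQubits_conjTranspose, ← onQubits_mul he, ← onQubits_sum]
  convert onQubits_one e
  have h1 := hτ.2
  rw [ht, Matrix.trace_sum] at h1
  ext i j
  simp only [Fintype.sum_prod_type, Matrix.sum_apply, Matrix.mul_apply,
    Matrix.conjTranspose_apply, Matrix.vecMulVec_apply, ket, Pi.single_apply, Matrix.one_apply]
  have : ∀ k, (pureState (t k)).trace = ∑ x, star (t k x) * t k x := fun k => by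
    simp [Matrix.trace, pureState, Matrix.vecMulVec_apply, mul_comm]
  simp only [this] at h1
  by_cases hij : i = j
  · subst hij
    rw [if_pos rfl]
    refine Eq.trans ?_ h1
    refine Finset.sum_congr rfl fun k _ => ?_
    rw [Finset.sum_eq_single i]
    · simp
    · intro d _ hd; simp [hd.symm]
    · simp
  · rw [if_neg hij]
    refine Finset.sum_eq_zero fun k _ => Finset.sum_eq_zero fun d _ =>
      Finset.sum_eq_zero fun x _ => ?_
    by_cases hi : i = d
    · subst hi; simp [Ne.symm hij]
    · simp [hi]

theorem isDensity_pureState {m : Type} [Fintype m] {v : m → ℂ} (hv : ∑ x, ‖v x‖ ^ 2 = 1) :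
    IsDensity (pureState v) :=
  ⟨Matrix.posSemidef_vecMulVec_self_star v, by rw [trace_pureState, hv]; simp⟩

theorem isDensity_ket {m : Type} [Fintype m] [DecidableEq m] (s : m) :
    IsDensity (pureState (ket s)) :=
  isDensity_pureState (by
    rw [Finset.sum_eq_single s] <;> simp +contextual [ket])

/-! ### Realization of an operator up to operations on ancillary qubits -/

/-- `c` acts as the operator `A`, followed by operations on the qubits in `S`. -/
def Realizes (S : Set Q) (c : Chan Q) (A : Op Q) : Prop :=
  ∃ J, KrausBy (Loc S) J ∧ ∀ ρ, c ρ = J (conjBy A ρ)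

theorem Realizes.conjBy (S : Set Q) (A : Op Q) : Realizes S (conjBy A) A :=
  ⟨_, KrausBy.id, fun _ => rfl⟩

theorem Realizes.of_kraus {S : Set Q} {c : Chan Q} (hc : KrausBy (Loc S) c) : Realizes S c 1 :=
  ⟨_, hc, fun ρ => by simp [DQC.conjBy]⟩

theorem Realizes.mono {S T : Set Q} (h : S ⊆ T) {c : Chan Q} {A : Op Q} (hc : Realizes S c A) :
    Realizes T c A := by
  obtain ⟨J, hJ, h1⟩ := hc
  exact ⟨J, hJ.mono (Loc_mono h), h1⟩

theorem KrausBy.conjBy_comm {S : Set Q} {J : Chan Q} (hJ : KrausBy (Loc S) J) {A : Op Q}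
    (hA : A ∈ Off S) (ρ : Op Q) : DQC.conjBy A (J ρ) = J (DQC.conjBy A ρ) := by
  obtain ⟨κ, _, K, hK, _, h⟩ := hJ
  rw [h, h, conjBy_sum]
  refine Finset.sum_congr rfl fun i _ => ?_
  rw [conjBy_conjBy, conjBy_conjBy, (mem_Off.1 hA _ (hK i)).eq]

/-- The residue of the first step is pushed through `B`, with which it commutes, and merged with the
residue of the second. -/
theorem Realizes.comp {S : Set Q} {c d : Chan Q} {A B : Op Q} (hc : Realizes S c A)
    (hd : Realizes S d B) (hB : B ∈ Off S) : Realizes S (fun ρ => d (c ρ)) (B * A) := by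
  obtain ⟨J, hJ, h1⟩ := hc
  obtain ⟨J', hJ', h1'⟩ := hd
  exact ⟨_, hJ.comp hJ', fun ρ => by
    simp only [h1', h1, hJ.conjBy_comm hB, conjBy_conjBy]⟩

/-- Passes from a realization to trace preservation and locality of the whole step; used to show
that no step touches the traps. -/
theorem Realizes.krausBy {S : Set Q} {c : Chan Q} {A : Op Q} (hc : Realizes S c A)
    (hM : Loc S ≤ M) (hA : A ∈ M) (hU : Aᴴ * A = 1) : KrausBy M c := by
  obtain ⟨J, hJ, h1⟩ := hc
  obtain rfl : c = _ := funext h1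
  exact (KrausBy.conjBy hA hU).comp (hJ.mono hM)

/-- A property of the state that survives operations on ancillary qubits. -/
theorem Realizes.mul_eq {S : Set Q} {c : Chan Q} {A : Op Q} (hc : Realizes S c A) {P P' ρ : Op Q}
    (hP' : P' ∈ Off S) (h : P' * A = A * P) (hρ : P * ρ = ρ) : P' * c ρ = c ρ := by
  obtain ⟨J, ⟨κ, _, K, hK, _, h2⟩, h1⟩ := hc
  rw [h1, h2, Finset.mul_sum]
  refine Finset.sum_congr rfl fun i _ => ?_
  simp only [DQC.conjBy]
  calc P' * (K i * (A * ρ * Aᴴ) * (K i)ᴴ) = P' * K i * (A * ρ * Aᴴ) * (K i)ᴴ := by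
        simp only [mul_assoc]
    _ = K i * (P' * A * ρ * Aᴴ) * (K i)ᴴ := by
        rw [← (mem_Off.1 hP' _ (hK i)).eq]; simp only [mul_assoc]
    _ = _ := by rw [h, mul_assoc A, hρ]

theorem KrausBy.mul_eq {S : Set Q} {c : Chan Q} (hc : KrausBy (Loc S) c) {P ρ : Op Q}
    (hP : P ∈ Off S) (hρ : P * ρ = ρ) : P * c ρ = c ρ :=
  (Realizes.of_kraus hc).mul_eq hP (by simp) hρ

end RegisterAlgebra

/-! ### Trace distance through positive and negative parts -/

section TraceDistance

set_option linter.unusedSectionVars false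
set_option linter.unusedDecidableInType false
set_option linter.unusedFintypeInType false

variable {m m' : Type} [Fintype m] [DecidableEq m] [Fintype m'] [DecidableEq m']

/-- A bound on the trace distance by a decomposition of the difference into a positive and a
negative part. -/
def Close (ρ σ : Matrix m m ℂ) (d : ℝ) : Prop :=
  ∃ P N : Matrix m m ℂ, P.PosSemidef ∧ N.PosSemidef ∧ ρ - σ = P - N ∧
    (P.trace + N.trace).re ≤ 2 * d

theorem hermitian_eq {D : Matrix m m ℂ} (hD : D.IsHermitian) :
    D = (hD.eigenvectorUnitary : Matrix m m ℂ) *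
      Matrix.diagonal (fun i => (hD.eigenvalues i : ℂ)) * (hD.eigenvectorUnitary : Matrix m m ℂ)ᴴ := by
  conv_lhs => rw [hD.spectral_theorem, Unitary.conjStarAlgAut_apply]
  rfl

theorem eigenvectorUnitary_mul {D : Matrix m m ℂ} (hD : D.IsHermitian) :
    (hD.eigenvectorUnitary : Matrix m m ℂ) * (hD.eigenvectorUnitary : Matrix m m ℂ)ᴴ = 1 :=
  Unitary.coe_mul_star_self hD.eigenvectorUnitary

theorem eigenvectorUnitary_mul' {D : Matrix m m ℂ} (hD : D.IsHermitian) :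
    (hD.eigenvectorUnitary : Matrix m m ℂ)ᴴ * (hD.eigenvectorUnitary : Matrix m m ℂ) = 1 :=
  Unitary.coe_star_mul_self hD.eigenvectorUnitary

/-- For a Hermitian difference `D` one has `D†D = D²`, whose eigenvalues are the squares of those of
`D`. -/
theorem traceDist_eq {ρ σ : Matrix m m ℂ} (h : (ρ - σ).IsHermitian) :
    traceDist ρ σ = (1 / 2) * ∑ i, |h.eigenvalues i| := by
  unfold traceDist
  congr 1
  set D := ρ - σ with hDdef
  have hH := Matrix.isHermitian_conjTranspose_mul_self D
  have e1 := hH.roots_charpoly_eq_eigenvalues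
  have e2 : (Dᴴ * D).charpoly.roots =
      Multiset.map (fun i => ((h.eigenvalues i ^ 2 : ℝ) : ℂ)) Finset.univ.val := by
    have : Dᴴ * D = (h.eigenvectorUnitary : Matrix m m ℂ) *
      Matrix.diagonal (fun i => ((h.eigenvalues i ^ 2 : ℝ) : ℂ)) *
        (h.eigenvectorUnitary : Matrix m m ℂ)ᴴ := by
      rw [h.eq]
      conv_lhs => rw [hermitian_eq h]
      calc _ = (h.eigenvectorUnitary : Matrix m m ℂ) *
            (Matrix.diagonal (fun i => (h.eigenvalues i : ℂ)) *
            ((h.eigenvectorUnitary : Matrix m m ℂ)ᴴ * (h.eigenvectorUnitary : Matrix m m ℂ)) *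
            Matrix.diagonal (fun i => (h.eigenvalues i : ℂ))) *
            (h.eigenvectorUnitary : Matrix m m ℂ)ᴴ := by simp only [mul_assoc]
        _ = _ := by
          rw [eigenvectorUnitary_mul', mul_one, Matrix.diagonal_mul_diagonal]
          congr 3; funext i; push_cast; ring
    rw [this, Matrix.charpoly_mul_comm, ← mul_assoc, eigenvectorUnitary_mul', one_mul,
      Matrix.charpoly_diagonal, Polynomial.roots_prod]
    · simp only [Polynomial.roots_X_sub_C, Multiset.bind_singleton]
    · exact Finset.prod_ne_zero_iff.2 fun i _ => Polynomial.X_sub_C_ne_zero _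
  -- The two eigenvalue families are equal only as multisets, being roots of the same characteristic
  -- polynomial; this suffices for the sum of square roots.
  have e3 := congrArg (fun s => (s.map fun z : ℂ => Real.sqrt z.re).sum) (e1.symm.trans e2)
  simp only [Multiset.map_map, Function.comp_def] at e3
  refine Eq.trans ?_ (e3.trans ?_)
  · rfl
  · change ∑ i, Real.sqrt (((h.eigenvalues i ^ 2 : ℝ) : ℂ).re) = _
    simp only [Complex.ofReal_re, Real.sqrt_sq_eq_abs]

theorem Close.isHermitian {ρ σ : Matrix m m ℂ} {d : ℝ} (h : Close ρ σ d) :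
    (ρ - σ).IsHermitian := by
  obtain ⟨P, N, hP, hN, h1, _⟩ := h
  rw [h1]; exact hP.isHermitian.sub hN.isHermitian

/-- In an eigenbasis of `P - N` each eigenvalue is a difference of nonnegative diagonal entries of
`P` and `N`, so its absolute value is at most their sum. -/
theorem Close.traceDist_le {ρ σ : Matrix m m ℂ} {d : ℝ} (h : Close ρ σ d) :
    traceDist ρ σ ≤ d := by
  have hH := h.isHermitian
  obtain ⟨P, N, hP, hN, h1, h2⟩ := h
  rw [traceDist_eq hH]
  set U := (hH.eigenvectorUnitary : Matrix m m ℂ) with hU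
  have hdiag : Uᴴ * (P - N) * U = Matrix.diagonal (fun i => (hH.eigenvalues i : ℂ)) := by
    rw [← h1]
    conv_lhs => rw [hermitian_eq hH]
    rw [mul_assoc, mul_assoc, mul_assoc, eigenvectorUnitary_mul', mul_one, ← mul_assoc,
      eigenvectorUnitary_mul', one_mul]
  have hP' := hP.conjTranspose_mul_mul_same U
  have hN' := hN.conjTranspose_mul_mul_same U
  have htr : ∀ M : Matrix m m ℂ, (Uᴴ * M * U).trace = M.trace := fun M => by
    rw [Matrix.trace_mul_comm, ← mul_assoc, eigenvectorUnitary_mul, one_mul]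
  have key : ∀ i, |hH.eigenvalues i| ≤ ((Uᴴ * P * U) i i).re + ((Uᴴ * N * U) i i).re := fun i => by
    have h3 : ((hH.eigenvalues i : ℂ)).re = ((Uᴴ * P * U) i i).re - ((Uᴴ * N * U) i i).re := by
      have := congrFun (congrFun hdiag i) i
      rw [Matrix.diagonal_apply_eq] at this
      rw [← this, mul_sub, sub_mul, Matrix.sub_apply, Complex.sub_re]
    rw [Complex.ofReal_re] at h3
    have hp : 0 ≤ ((Uᴴ * P * U) i i).re := (Complex.le_def.1 (hP'.diag_nonneg (i := i))).1
    have hn : 0 ≤ ((Uᴴ * N * U) i i).re := (Complex.le_def.1 (hN'.diag_nonneg (i := i))).1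
    rw [h3, abs_le]; constructor <;> linarith
  have := Finset.sum_le_sum fun i (_ : i ∈ Finset.univ) => key i
  rw [Finset.sum_add_distrib, ← Complex.re_sum, ← Complex.re_sum] at this
  have e1 : ∑ i, (Uᴴ * P * U) i i = P.trace := htr P
  have e2 : ∑ i, (Uᴴ * N * U) i i = N.trace := htr N
  rw [e1, e2] at this
  rw [Complex.add_re] at h2
  linarith

/-- The Jordan decomposition, splitting the eigenvalues by sign, attains the bound. -/
theorem Close.of_traceDist_le {ρ σ : Matrix m m ℂ} {d : ℝ} (h : (ρ - σ).IsHermitian)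
    (hd : traceDist ρ σ ≤ d) : Close ρ σ d := by
  rw [traceDist_eq h] at hd
  set U := (h.eigenvectorUnitary : Matrix m m ℂ) with hU
  have psd : ∀ f : m → ℝ, (∀ i, 0 ≤ f i) →
      (U * Matrix.diagonal (fun i => (f i : ℂ)) * Uᴴ).PosSemidef := fun f hf =>
    (Matrix.PosSemidef.diagonal fun i => by
      exact Complex.zero_le_real.2 (hf i)).mul_mul_conjTranspose_same U
  have tr : ∀ f : m → ℝ, (U * Matrix.diagonal (fun i => (f i : ℂ)) * Uᴴ).trace =
      ((∑ i, f i : ℝ) : ℂ) := fun f => by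
    rw [Matrix.trace_mul_comm, ← mul_assoc, eigenvectorUnitary_mul', one_mul,
      Matrix.trace_diagonal]
    push_cast; rfl
  refine ⟨_, _, psd (fun i => max (h.eigenvalues i) 0) fun i => le_max_right _ _,
    psd (fun i => max (-h.eigenvalues i) 0) fun i => le_max_right _ _, ?_, ?_⟩
  · conv_lhs => rw [hermitian_eq h]
    rw [← sub_mul, ← mul_sub, Matrix.diagonal_sub]
    congr 3; funext i
    rw [← Complex.ofReal_sub]
    congr 1
    rcases le_total 0 (h.eigenvalues i) with h0 | h0
    · rw [max_eq_left h0, max_eq_right (by linarith)]; ring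
    · rw [max_eq_right h0, max_eq_left (by linarith)]; ring
  · rw [tr, tr, ← Complex.ofReal_add, Complex.ofReal_re, ← Finset.sum_add_distrib]
    have : ∀ i, max (h.eigenvalues i) 0 + max (-h.eigenvalues i) 0 = |h.eigenvalues i| := fun i => by
      rcases le_total 0 (h.eigenvalues i) with h0 | h0
      · rw [max_eq_left h0, max_eq_right (by linarith), abs_of_nonneg h0]; ring
      · rw [max_eq_right h0, max_eq_left (by linarith), abs_of_nonpos h0]; ring
    rw [Finset.sum_congr rfl fun i _ => this i]
    linarith

theorem Close.refl (ρ : Matrix m m ℂ) : Close ρ ρ 0 :=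
  ⟨0, 0, Matrix.PosSemidef.zero, Matrix.PosSemidef.zero, by simp, by simp⟩

theorem Close.mono {ρ σ : Matrix m m ℂ} {d d' : ℝ} (h : Close ρ σ d) (hd : d ≤ d') :
    Close ρ σ d' := by
  obtain ⟨P, N, hP, hN, h1, h2⟩ := h
  exact ⟨P, N, hP, hN, h1, by linarith⟩

theorem Close.trans {ρ σ τ : Matrix m m ℂ} {d d' : ℝ} (h : Close ρ σ d) (h' : Close σ τ d') :
    Close ρ τ (d + d') := by
  obtain ⟨P, N, hP, hN, h1, h2⟩ := h
  obtain ⟨P', N', hP', hN', h1', h2'⟩ := h'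
  refine ⟨P + P', N + N', hP.add hP', hN.add hN', ?_, ?_⟩
  · rw [← sub_add_sub_cancel ρ σ τ, h1, h1']; abel
  · rw [Matrix.trace_add, Matrix.trace_add]
    simp only [Complex.add_re] at *
    linarith

/-- Positive linear maps that preserve the trace do not increase the trace distance. -/
theorem Close.map {ρ σ : Matrix m m ℂ} {d : ℝ} (h : Close ρ σ d)
    (f : Matrix m m ℂ → Matrix m' m' ℂ) (hsub : ∀ A B, f (A - B) = f A - f B)
    (hpos : ∀ A, A.PosSemidef → (f A).PosSemidef) (htr : ∀ A, (f A).trace = A.trace) :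
    Close (f ρ) (f σ) d := by
  obtain ⟨P, N, hP, hN, h1, h2⟩ := h
  exact ⟨f P, f N, hpos _ hP, hpos _ hN, by rw [← hsub, h1, hsub], by rwa [htr, htr]⟩

/-- With `s ^ 2 = d / 2` the two projectors have total trace `(s²‖u + v‖² + s⁻²‖u - v‖²) / 2`. Since
`‖u + v‖² ≤ 4` and `‖u - v‖² ≤ d²`, both terms are at most `d`, which is why this `s` is chosen. The
case `d = 0` has no such `s` and is separate. -/
theorem Close.of_norm_sub_le {u v : m → ℂ} (hu : ∑ x, ‖u x‖ ^ 2 = 1) (hv : ∑ x, ‖v x‖ ^ 2 = 1)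
    {d : ℝ} (hd0 : 0 ≤ d) (hd : ∑ x, ‖u x - v x‖ ^ 2 ≤ d ^ 2) :
    Close (pureState u) (pureState v) d := by
  rcases hd0.eq_or_lt with rfl | hpos
  · have : u = v := by
      have h0 : ∑ x, ‖u x - v x‖ ^ 2 = 0 :=
        le_antisymm (by simpa using hd) (Finset.sum_nonneg fun _ _ => by positivity)
      rw [Finset.sum_eq_zero_iff_of_nonneg fun _ _ => by positivity] at h0
      funext x
      have := h0 x (Finset.mem_univ x)
      simpa [sub_eq_zero] using this
    rw [this]; exact Close.refl _
  · -- `|u⟩⟨u| - |v⟩⟨v|` is a combination of the projectors on `s (u + v) ± s⁻¹ (u - v)`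
    set s : ℝ := Real.sqrt (d / 2) with hs
    have hs2 : s ^ 2 = d / 2 := Real.sq_sqrt (by linarith)
    have hs0 : s ≠ 0 := by
      rw [hs]; exact (Real.sqrt_pos.2 (by linarith)).ne'
    have hsc : (s : ℂ) ≠ 0 := by exact_mod_cast hs0
    let a : m → ℂ := fun x => (s * (u x + v x) + (s : ℂ)⁻¹ * (u x - v x)) / 2
    let b : m → ℂ := fun x => (s * (u x + v x) - (s : ℂ)⁻¹ * (u x - v x)) / 2
    refine ⟨pureState a, pureState b, Matrix.posSemidef_vecMulVec_self_star a,
      Matrix.posSemidef_vecMulVec_self_star b, ?_, ?_⟩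
    · ext x y
      simp only [a, b, pureState, Matrix.sub_apply, Matrix.vecMulVec_apply, Pi.star_apply,
        Complex.star_def, map_div₀, map_add, map_sub, map_mul, map_inv₀, Complex.conj_ofReal,
        map_ofNat]
      field_simp
      ring
    · rw [trace_pureState, trace_pureState, ← Complex.ofReal_add, Complex.ofReal_re,
        ← Finset.sum_add_distrib]
      have par : ∀ z w : ℂ, ‖(z + w) / 2‖ ^ 2 + ‖(z - w) / 2‖ ^ 2 = (‖z‖ ^ 2 + ‖w‖ ^ 2) / 2 := by
        intro z w
        have := parallelogram_law_with_norm ℝ z w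
        rw [norm_div, norm_div, Complex.norm_ofNat]
        nlinarith
      have h1 : ∀ x, ‖a x‖ ^ 2 + ‖b x‖ ^ 2 =
          (s ^ 2 * ‖u x + v x‖ ^ 2 + (s ^ 2)⁻¹ * ‖u x - v x‖ ^ 2) / 2 := fun x => by
        simp only [a, b]
        rw [par, norm_mul, norm_mul, mul_pow, mul_pow, norm_inv, Complex.norm_real, inv_pow,
          Real.norm_eq_abs, sq_abs]
      rw [Finset.sum_congr rfl fun x _ => h1 x, ← Finset.sum_div, Finset.sum_add_distrib,
        ← Finset.mul_sum, ← Finset.mul_sum, hs2]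
      have h4 : ∑ x, ‖u x + v x‖ ^ 2 ≤ 4 := by
        calc ∑ x, ‖u x + v x‖ ^ 2 ≤ ∑ x, (2 * ‖u x‖ ^ 2 + 2 * ‖v x‖ ^ 2) := by
              refine Finset.sum_le_sum fun x _ => ?_
              have := norm_add_le (u x) (v x)
              nlinarith [norm_nonneg (u x + v x), sq_nonneg (‖u x‖ - ‖v x‖), norm_nonneg (u x),
                norm_nonneg (v x)]
          _ = 4 := by
              rw [Finset.sum_add_distrib, ← Finset.mul_sum, ← Finset.mul_sum, hu, hv]; norm_num
      have h5 : (d / 2)⁻¹ * ∑ x, ‖u x - v x‖ ^ 2 ≤ 2 * d := by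
        rw [inv_mul_le_iff₀ (by linarith)]
        nlinarith
      nlinarith

/-! ### Channels on states -/

variable {Q : Type} [Fintype Q] [DecidableEq Q] {M : Subalgebra ℂ (Op Q)}

theorem KrausBy.posSemidef {c : Chan Q} (hc : KrausBy M c) {ρ : Op Q} (hρ : ρ.PosSemidef) :
    (c ρ).PosSemidef := by
  obtain ⟨κ, _, K, _, _, h⟩ := hc
  rw [h]
  exact Matrix.posSemidef_sum _ fun i _ => hρ.mul_mul_conjTranspose_same (K i)

theorem KrausBy.trace {c : Chan Q} (hc : KrausBy M c) (ρ : Op Q) :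
    (c ρ).trace = ρ.trace := by
  obtain ⟨κ, _, K, _, h1, h⟩ := hc
  rw [h, Matrix.trace_sum]
  calc ∑ i, (DQC.conjBy (K i) ρ).trace = ((∑ i, (K i)ᴴ * K i) * ρ).trace := by
        rw [Finset.sum_mul, Matrix.trace_sum]
        refine Finset.sum_congr rfl fun i _ => ?_
        rw [DQC.conjBy, Matrix.trace_mul_comm, mul_assoc]
    _ = _ := by rw [h1, one_mul]

theorem KrausBy.map_sub {c : Chan Q} (hc : KrausBy M c) (ρ σ : Op Q) :
    c (ρ - σ) = c ρ - c σ := by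
  obtain ⟨κ, _, K, _, _, h⟩ := hc
  simp only [h, DQC.conjBy, mul_sub, sub_mul, Finset.sum_sub_distrib]

theorem KrausBy.isDensity {c : Chan Q} (hc : KrausBy M c) {ρ : Op Q} (hρ : IsDensity ρ) :
    IsDensity (c ρ) := ⟨hc.posSemidef hρ.1, by rw [hc.trace, hρ.2]⟩

theorem KrausBy.close {c : Chan Q} (hc : KrausBy M c) {ρ σ : Op Q} {d : ℝ} (h : Close ρ σ d) :
    Close (c ρ) (c σ) d :=
  h.map c hc.map_sub (fun _ => hc.posSemidef) hc.trace

variable {ι : Type} [Fintype ι] [DecidableEq ι]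

theorem prepare_sub (e : ι → Q) (τ τ' : Op ι) (ρ : Op Q) :
    prepare e (τ - τ') ρ = prepare e τ ρ - prepare e τ' ρ := by
  ext x y; simp [prepare, sub_mul]

theorem prepare_posSemidef {e : ι → Q} (he : Function.Injective e) {τ : Op ι} (hτ : τ.PosSemidef)
    {ρ : Op Q} (hρ : ρ.PosSemidef) : (prepare e τ ρ).PosSemidef := by
  obtain ⟨t, rfl⟩ := exists_sum_pureState hτ
  rw [prepare_eq_sum he]
  exact Matrix.posSemidef_sum _ fun i _ => hρ.mul_mul_conjTranspose_same _

/-- Exchanging the values on the qubits of `e` with the summation variable `b` is an involution of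
the pairs `(x, b)`. It makes the trace of a preparation multiplicative. -/
theorem sum_extend_swap {e : ι → Q} (he : Function.Injective e)
    (F : (ι → Bool) → (Q → Bool) → ℂ) :
    ∑ x : Q → Bool, ∑ b : ι → Bool, F (fun i => x (e i)) (Function.extend e b x) =
      ∑ x : Q → Bool, ∑ b : ι → Bool, F b x := by
  rw [← Fintype.sum_prod_type', ← Fintype.sum_prod_type']
  have hinv : Function.Involutive fun p : (Q → Bool) × (ι → Bool) =>
      (Function.extend e p.2 p.1, fun i => p.1 (e i)) := by
    rintro ⟨x, b⟩
    refine Prod.ext ?_ (extend_comp_self he _ _)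
    rw [extend_eq_iff he]
    exact ⟨fun _ => rfl, fun q hq => Function.extend_apply' _ _ _ (by simpa using hq)⟩
  exact Equiv.sum_comp hinv.toPerm fun p : (Q → Bool) × (ι → Bool) => F p.2 p.1

theorem trace_prepare {e : ι → Q} (he : Function.Injective e) (τ : Op ι) (ρ : Op Q) :
    (prepare e τ ρ).trace = τ.trace * ρ.trace := by
  simp only [Matrix.trace, Matrix.diag, prepare, Matrix.of_apply, Finset.mul_sum]
  rw [sum_extend_swap he fun b x => τ b b * ρ x x]
  simp only [Finset.sum_mul]

/-- For a fixed density operator `ρ`, preparation is a positive trace-preserving map of the supplied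
state. Errors of the magic-state factory enter here. -/
theorem Close.prepare {e : ι → Q} (he : Function.Injective e) {τ τ' : Op ι} {d : ℝ}
    (h : Close τ τ' d) {ρ : Op Q} (hρ : IsDensity ρ) :
    Close (prepare e τ ρ) (prepare e τ' ρ) d :=
  h.map (fun τ => DQC.prepare e τ ρ) (fun _ _ => prepare_sub e _ _ ρ)
    (fun _ hA => prepare_posSemidef he hA hρ.1) fun A => by rw [trace_prepare he, hρ.2, mul_one]

end TraceDistance

/-! ### Gate teleportation and entanglement swapping -/

section Teleportation

set_option linter.unusedSectionVars false
set_option linter.unusedDecidableInType false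
set_option linter.unusedFintypeInType false

variable {Q : Type} [Fintype Q] [DecidableEq Q]

theorem pair_injective {p q : Q} (h : p ≠ q) : Function.Injective ![p, q] := by
  intro i j hij
  fin_cases i <;> fin_cases j <;> simp_all [eq_comm]

theorem extend_pair {p q : Q} (h : p ≠ q) (d : Fin 2 → Bool) (x : Q → Bool) :
    Function.extend ![p, q] d x = Function.update (Function.update x p (d 0)) q (d 1) := by
  rw [extend_eq_iff (pair_injective h)]
  constructor
  · intro i; fin_cases i <;> simp [h]
  · intro r hr
    have h0 := hr 0
    have h1 := hr 1
    simp only [Matrix.cons_val_zero, Matrix.cons_val_one] at h0 h1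
    rw [Function.update_of_ne h1.symm, Function.update_of_ne h0.symm]

theorem onQubits_pair_mul_apply {m : Type} {p q : Q} (h : p ≠ q) (v : (Fin 2 → Bool) → ℂ)
    (b : Fin 2 → Bool) (N : Matrix (Q → Bool) m ℂ) (x : Q → Bool) (y : m) :
    (onQubits ![p, q] (Matrix.vecMulVec v (ket b)) * N) x y =
      v (fun i => x (![p, q] i)) *
        N (Function.update (Function.update x p (b 0)) q (b 1)) y := by
  rw [onQubits_mul_apply (pair_injective h), Finset.sum_eq_single b]
  · simp [Matrix.vecMulVec_apply, ket, extend_pair h]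
  · intro d _ hd; simp [Matrix.vecMulVec_apply, ket, hd]
  · simp

/-- The Bell state. -/
def bellKet : (Fin 2 → Bool) → ℂ := fun x => if x 0 = x 1 then 1 / (Real.sqrt 2 : ℂ) else 0

theorem sqrt_two_mul_self : (Real.sqrt 2 : ℂ) * (Real.sqrt 2 : ℂ) = 2 := by
  rw [← Complex.ofReal_mul, Real.mul_self_sqrt (by norm_num)]; norm_num

theorem gateX_mul_apply {m : Type} (q : Q) (N : Matrix (Q → Bool) m ℂ) (x : Q → Bool) (y : m) :
    (onQubit q gateX * N) x y = N (Function.update x q (!x q)) y := by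
  rw [onQubit_mul_apply]
  cases x q <;> simp [gateX]

theorem gateZ_mul_apply {m : Type} (q : Q) (N : Matrix (Q → Bool) m ℂ) (x : Q → Bool) (y : m) :
    (onQubit q gateZ * N) x y = (if x q then -1 else 1) * N x y := by
  rw [onQubit_mul_apply, Finset.sum_eq_single (x q)]
  · simp [gateZ]
  · intro b _ hb; simp [gateZ, hb.symm]
  · simp

theorem proj_mul_apply {m : Type} (q : Q) (s : Bool) (N : Matrix (Q → Bool) m ℂ) (x : Q → Bool)
    (y : m) : (onQubit q (pureState (ket s)) * N) x y = if x q = s then N x y else 0 := by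
  rw [onQubit_mul_apply]
  simp only [pureState_ket_apply]
  by_cases h : x q = s
  · subst h
    rw [Finset.sum_eq_single (x q)] <;> simp +contextual
  · simp [h]

theorem gateH_mul_apply {m : Type} (q : Q) (N : Matrix (Q → Bool) m ℂ) (x : Q → Bool) (y : m) :
    (onQubit q gateH * N) x y = (Real.sqrt 2 : ℂ)⁻¹ * (N (Function.update x q false) y +
      (if x q then -1 else 1) * N (Function.update x q true) y) := by
  rw [onQubit_mul_apply]
  cases x q <;> simp [gateH] <;> ring

theorem ite_mul_apply {m : Type} (b : Bool) (A : Op Q) (N : Matrix (Q → Bool) m ℂ) (x : Q → Bool)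
    (y : m) : ((if b then A else 1) * N) x y = if b then (A * N) x y else N x y := by
  cases b <;> simp

theorem sqrt_two_inv_mul_self : (Real.sqrt 2 : ℂ)⁻¹ * (Real.sqrt 2 : ℂ)⁻¹ = 1 / 2 := by
  rw [← mul_inv, sqrt_two_mul_self]; norm_num

theorem ket_pair_apply (m m' : Bool) (f : Fin 2 → Bool) :
    ket ![m, m'] f = if f 0 = m ∧ f 1 = m' then 1 else 0 := by
  simp [ket, Pi.single_apply, funext_iff, Fin.forall_fin_two]

/-- One branch of gate teleportation: for outcomes `m`, `m'` and discarded ancilla values `d`, the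
corrections turn the whole product into the controlled gate, with the ancillas in `|m, m'⟩` and
amplitude `1/2` independent of everything. -/
theorem scst_kraus {a ae be b : Q} (h1 : a ≠ ae) (h2 : a ≠ be) (h3 : a ≠ b) (h4 : ae ≠ be)
    (h5 : ae ≠ b) (h6 : be ≠ b) (A : Matrix Bool Bool ℂ) (m m' : Bool) (d : Fin 2 → Bool)
    (N : Op Q) :
    (if m' then onQubit a gateZ else 1) * (onQubit be (pureState (ket m')) * (onQubit be gateH *
      (ctrl be (onQubit b A) * ((if m then onQubit be gateX else 1) *
        (onQubit ae (pureState (ket m)) * (ctrl a (onQubit ae gateX) *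
          (onQubits ![ae, be] (Matrix.vecMulVec bellKet (ket d)) * N))))))) =
    onQubits ![ae, be] (Matrix.vecMulVec ((1 / 2 : ℂ) • ket ![m, m']) (ket d)) *
      (ctrl a (onQubit b A) * N) := by
  have s2 : (2 : ℂ)⁻¹ = (Real.sqrt 2 : ℂ)⁻¹ * (Real.sqrt 2 : ℂ)⁻¹ := by
    rw [sqrt_two_inv_mul_self]; norm_num
  ext x y
  rw [onQubits_pair_mul_apply h4]
  simp only [ite_mul_apply, gateZ_mul_apply, proj_mul_apply]
  by_cases e1 : x be = m'
  swap
  · simp [e1, ket_pair_apply]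
  subst e1
  simp only [if_true, gateH_mul_apply, ctrl_mul_apply, Function.update_self, Bool.false_eq_true,
    if_false, onQubit_mul_apply b]
  by_cases e2 : x ae = m
  swap
  · simp [e2, ket_pair_apply, ite_mul_apply, gateX_mul_apply, proj_mul_apply, h4, h5]
  subst e2
  -- Normal forms for iterated updates, so that both sides of each bit case refer to the same
  -- entries of `N`.
  have hb : ∀ (z : Q → Bool) (c d₀ d₁ : Bool),
      Function.update (Function.update (Function.update z be c) ae d₀) be d₁ =
        Function.update (Function.update z ae d₀) be d₁ := fun z c d₀ d₁ => by
    rw [Function.update_comm h4.symm, Function.update_idem]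
  have hc : ∀ (z : Q → Bool) (c d₀ d₁ : Bool),
      Function.update (Function.update (Function.update z b c) ae d₀) be d₁ =
        Function.update (Function.update (Function.update z ae d₀) be d₁) b c := fun z c d₀ d₁ => by
    rw [Function.update_comm h5.symm, Function.update_comm h6.symm]
  cases hxa : x a <;> cases hxe : x ae <;> cases hxb : x be <;>
    simp [gateX_mul_apply, ctrl_mul_apply, proj_mul_apply,
      onQubits_pair_mul_apply h4, bellKet, ket_pair_apply, hxa, hxe, hxb, h1, h2, h3, h4, h5, h6,
      h4.symm, h5.symm, h6.symm]
  all_goals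
    simp only [hb, hc, s2]
    ring

/-- One branch of entanglement swapping. The correction leaves the Bell state up to a sign, which is
negative exactly when both outcomes are `1`; the sign disappears on conjugation. -/
theorem swap_kraus {A g C h : Q} (h1 : A ≠ g) (h2 : A ≠ C) (h3 : A ≠ h) (h4 : g ≠ C)
    (h5 : g ≠ h) (h6 : C ≠ h) (m₁ m₂ : Bool) (d d' : Fin 2 → Bool) (N : Op Q) :
    (if m₂ then onQubit C gateX else 1) * ((if m₁ then onQubit C gateZ else 1) *
      (onQubit h (pureState (ket m₂)) * (onQubit g (pureState (ket m₁)) * (onQubit g gateH *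
        (ctrl g (onQubit h gateX) * (onQubits ![C, h] (Matrix.vecMulVec bellKet (ket d')) *
          (onQubits ![A, g] (Matrix.vecMulVec bellKet (ket d)) * N))))))) =
    onQubits ![g, h] (Matrix.vecMulVec ((if m₁ && m₂ then -(1 / 2) else 1 / 2 : ℂ) • ket ![m₁, m₂])
        (ket ![d 1, d' 1])) *
      (onQubits ![A, C] (Matrix.vecMulVec bellKet (ket ![d 0, d' 0])) * N) := by
  have s2 : (2 : ℂ)⁻¹ = (Real.sqrt 2 : ℂ)⁻¹ * (Real.sqrt 2 : ℂ)⁻¹ := by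
    rw [sqrt_two_inv_mul_self]; norm_num
  have hu : ∀ (z : Q → Bool) (a b c d : Bool),
      Function.update (Function.update (Function.update (Function.update z C a) h b) A c) g d =
      Function.update (Function.update (Function.update (Function.update z g d) h b) A c) C a :=
    fun z a b c d => by
      rw [Function.update_comm h6, Function.update_comm h2.symm, Function.update_comm h4.symm,
        Function.update_comm h3.symm, Function.update_comm h5.symm, Function.update_comm h1,
        Function.update_comm h3]
  have hg : ∀ (z : Q → Bool) (a b : Bool) (c d e : Bool),
      Function.update (Function.update (Function.update (Function.update (Function.update z g a)
        C b) h c) A d) g e = Function.update (Function.update (Function.update (Function.update z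
        C b) h c) A d) g e := fun z a b c d e => by
      rw [Function.update_comm h4, Function.update_comm h5, Function.update_comm h1.symm,
        Function.update_idem]
  have hh : ∀ (z : Q → Bool) (a b c : Bool),
      Function.update (Function.update (Function.update z h a) C b) h c =
        Function.update (Function.update z C b) h c := fun z a b c => by
      rw [Function.update_comm h6.symm, Function.update_idem]
  have hC : ∀ (z : Q → Bool) (a b c d e : Bool),
      Function.update (Function.update (Function.update (Function.update (Function.update z C a)
        g b) h c) A d) C e = Function.update (Function.update (Function.update (Function.update z
        g b) h c) A d) C e := fun z a b c d e => by
      rw [Function.update_comm h4.symm, Function.update_comm h6, Function.update_comm h2.symm,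
        Function.update_idem]
  ext x y
  rw [onQubits_pair_mul_apply h5, onQubits_pair_mul_apply h2]
  simp only [ite_mul_apply, gateZ_mul_apply, gateX_mul_apply C, proj_mul_apply]
  by_cases e1 : x h = m₂
  swap
  · simp [e1, ket_pair_apply, h6.symm]
  by_cases e2 : x g = m₁
  swap
  · simp [e2, ket_pair_apply, h4]
  subst e1 e2
  cases hxh : x h <;> cases hxg : x g <;> cases hxA : x A <;> cases hxC : x C <;>
    simp [gateX_mul_apply, gateH_mul_apply, ctrl_mul_apply,
      onQubits_pair_mul_apply h1, onQubits_pair_mul_apply h6, bellKet, ket_pair_apply,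
      hxA, hxh, hxg, hxC, h1, h2, h3, h4, h5, h6, h4.symm, h5.symm, h6.symm]
  all_goals
    simp only [hg, hh, hu, hC, s2]
    ring

/-- The maximally mixed state of two qubits. -/
def mixedPair : Op (Fin 2) := (1 / 4 : ℂ) • 1

/-- Only the moduli of the amplitudes matter, so the outcome-dependent signs of the branches are
harmless. -/
theorem mixedPair_eq (c : Bool → Bool → ℂ) (hc : ∀ m m', c m m' * star (c m m') = 1 / 4) :
    mixedPair = ∑ p : Bool × Bool, pureState (c p.1 p.2 • ket ![p.1, p.2]) := by
  have : ∑ p : Bool × Bool, pureState (ket ![p.1, p.2]) = 1 := by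
    rw [← sum_pureState_ket]
    refine Fintype.sum_equiv (finTwoArrowEquiv Bool).symm _ _ fun p => rfl
  rw [mixedPair, ← this, Finset.smul_sum]
  refine Finset.sum_congr rfl fun p _ => ?_
  rw [← hc p.1 p.2]
  ext i j
  simp only [pureState, Matrix.smul_apply, Matrix.vecMulVec_apply, Pi.smul_apply, Pi.star_apply,
    smul_eq_mul, star_mul']
  ring

theorem isDensity_mixedPair : IsDensity mixedPair := by
  constructor
  · exact Matrix.PosSemidef.one.smul (by norm_num [Complex.le_def])
  · simp [mixedPair, Matrix.trace_smul, Matrix.trace_one]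

theorem prepare_mixedPair {p q : Q} (h : p ≠ q) (c : Bool → Bool → ℂ)
    (hc : ∀ m m', c m m' * star (c m m') = 1 / 4) (ρ : Op Q) :
    prepare ![p, q] mixedPair ρ = ∑ m, ∑ m', ∑ d : Fin 2 → Bool,
      conjBy (onQubits ![p, q] (Matrix.vecMulVec (c m m' • ket ![m, m']) (ket d))) ρ := by
  rw [mixedPair_eq c hc, prepare_eq_sum (pair_injective h), Fintype.sum_prod_type,
    Fintype.sum_prod_type]

theorem applyIf_conjBy (m : Bool) (A : Op Q) :
    applyIf m (conjBy A) = conjBy (if m then A else 1) := by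
  cases m
  · funext ρ; simp [applyIf, conjBy]
  · rfl

theorem bellPair_eq {p q : Q} (h : p ≠ q) (ρ : Op Q) : bellPair p q ρ =
    ∑ d, conjBy (onQubits ![p, q] (Matrix.vecMulVec bellKet (ket d))) ρ :=
  prepare_pureState (pair_injective h) _ _

/-- Gate teleportation acts as the controlled operation and leaves the ancillas maximally mixed. -/
theorem scst_eq {a ae be b : Q} (h1 : a ≠ ae) (h2 : a ≠ be) (h3 : a ≠ b) (h4 : ae ≠ be)
    (h5 : ae ≠ b) (h6 : be ≠ b) (A : Matrix Bool Bool ℂ) (ρ : Op Q) :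
    scst a ae be b A (bellPair ae be ρ) =
      prepare ![ae, be] mixedPair (conjBy (ctrl a (onQubit b A)) ρ) := by
  rw [prepare_mixedPair h4 (fun _ _ => 1 / 2) (by intros; norm_num), bellPair_eq h4]
  simp only [scst, runAll, measureOne, applyIf_conjBy, conjBy_sum, conjBy_conjBy, id]
  rw [Finset.sum_comm]
  refine Finset.sum_congr rfl fun m _ => Finset.sum_congr rfl fun m' _ =>
    Finset.sum_congr rfl fun d _ => ?_
  congr 1
  have := scst_kraus h1 h2 h3 h4 h5 h6 A m m' d 1
  simpa only [mul_one] using this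

theorem krausBy_prepare_pair {p q : Q} (h : p ≠ q) {τ : Op (Fin 2)} (hτ : IsDensity τ) :
    KrausBy (Loc {p, q}) (prepare ![p, q] τ) :=
  KrausBy.prepare (pair_injective h) (fun A => onQubits_mem_Loc (pair_injective h)
    (Fin.forall_fin_two.2 ⟨Or.inl rfl, Or.inr rfl⟩) A) hτ

theorem realizes_scst {a ae be b : Q} (h1 : a ≠ ae) (h2 : a ≠ be) (h3 : a ≠ b) (h4 : ae ≠ be)
    (h5 : ae ≠ b) (h6 : be ≠ b) (A : Matrix Bool Bool ℂ) :
    Realizes {ae, be} (runAll [bellPair ae be, scst a ae be b A]) (ctrl a (onQubit b A)) :=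
  ⟨prepare ![ae, be] mixedPair, krausBy_prepare_pair h4 isDensity_mixedPair,
    fun ρ => by
      simp only [runAll, id]
      exact scst_eq h1 h2 h3 h4 h5 h6 A ρ⟩

/-- Entanglement swapping at the master. -/
theorem swap_eq {A g C h : Q} (h1 : A ≠ g) (h2 : A ≠ C) (h3 : A ≠ h) (h4 : g ≠ C)
    (h5 : g ≠ h) (h6 : C ≠ h) (ρ : Op Q) :
    runAll
      [ bellPair A g, bellPair C h, conjBy (ctrl g (onQubit h gateX)), conjBy (onQubit g gateH),
        measureOne g fun m₁ => measureOne h fun m₂ =>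
          runAll [applyIf m₁ (conjBy (onQubit C gateZ)), applyIf m₂ (conjBy (onQubit C gateX))] ] ρ =
      prepare ![g, h] mixedPair (bellPair A C ρ) := by
  rw [prepare_mixedPair h5 (fun m₁ m₂ => if m₁ && m₂ then -(1 / 2) else 1 / 2) (by
    intro m m'; split_ifs <;> norm_num), bellPair_eq h2]
  simp only [runAll, measureOne, applyIf_conjBy, conjBy_sum, conjBy_conjBy, id, bellPair_eq h1,
    bellPair_eq h6]
  refine Finset.sum_congr rfl fun m _ => Finset.sum_congr rfl fun m' _ => ?_
  have key := fun d d' => swap_kraus h1 h2 h3 h4 h5 h6 m m' d d' (1 : Op Q)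
  simp only [mul_one] at key
  simp only [key]
  -- The four discarded bits are regrouped: one bit of each pair belongs to the surviving Bell pair,
  -- the other to the measured qubits.
  let E : (Fin 2 → Bool) ≃ Bool × Bool := finTwoArrowEquiv Bool
  have hE : ∀ F : (Fin 2 → Bool) → Op Q, ∑ d, F d = ∑ a, ∑ b, F ![a, b] := fun F => by
    rw [← Fintype.sum_prod_type', ← E.symm.sum_comp]; rfl
  simp only [hE, Matrix.cons_val_zero, Matrix.cons_val_one]
  simp only [Fintype.sum_bool]
  abel

/-- A distributed controlled operation acts as the controlled operation. -/
theorem realizes_swap_scst {A g C h c q : Q} (h1 : A ≠ g) (h2 : A ≠ C) (h3 : A ≠ h) (h4 : g ≠ C)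
    (h5 : g ≠ h) (h6 : C ≠ h) (hcA : c ≠ A) (hcC : c ≠ C) (hcq : c ≠ q) (hqA : q ≠ A)
    (hqC : q ≠ C) (hcg : c ≠ g) (hch : c ≠ h) (hqg : q ≠ g) (hqh : q ≠ h) {S : Set Q} (hA : A ∈ S) (hg : g ∈ S) (hC : C ∈ S) (hh : h ∈ S)
    (B : Matrix Bool Bool ℂ) :
    Realizes S (runAll
      [ bellPair A g, bellPair C h, conjBy (ctrl g (onQubit h gateX)), conjBy (onQubit g gateH),
        measureOne g fun m₁ => measureOne h fun m₂ =>
          runAll [applyIf m₁ (conjBy (onQubit C gateZ)), applyIf m₂ (conjBy (onQubit C gateX))],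
        scst c A C q B ]) (ctrl c (onQubit q B)) := by
  -- The residue of the swap sits on the hub qubits and the new Bell pair on other ones, so the two
  -- preparations commute and the teleportation lemma applies.
  have hcomm : ∀ ρ, scst c A C q B (prepare ![g, h] mixedPair (bellPair A C ρ)) =
      scst c A C q B (bellPair A C (prepare ![g, h] mixedPair ρ)) := by
    intro ρ
    congr 1
    rw [bellPair_eq h2, bellPair_eq h2]
    have hk := krausBy_prepare_pair (Q := Q) h5 isDensity_mixedPair
    obtain ⟨κ, _, K, hK, _, h7⟩ := hk
    simp only [h7, conjBy_sum, conjBy_conjBy]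
    rw [Finset.sum_comm]
    refine Finset.sum_congr rfl fun d _ => Finset.sum_congr rfl fun i _ => ?_
    congr 1
    exact (commute_onQubits (pair_injective h2) (fun j D => mem_Loc.1 (hK i) _ (by
      fin_cases j <;> simp [h1, h3, h4.symm, h6]) D) _).eq
  refine ⟨fun ρ => prepare ![A, C] mixedPair (prepare ![g, h] mixedPair ρ), ?_, ?_⟩
  · exact ((krausBy_prepare_pair h5 isDensity_mixedPair).mono (Loc_mono (by
      simp [Set.insert_subset_iff, hg, hh]))).comp
      ((krausBy_prepare_pair h2 isDensity_mixedPair).mono (Loc_mono (by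
      simp [Set.insert_subset_iff, hA, hC])))
  · intro ρ
    have h8 := swap_eq h1 h2 h3 h4 h5 h6 ρ
    simp only [runAll, id] at h8 ⊢
    rw [h8, hcomm, scst_eq hcA hcC hcq h2 hqA.symm hqC.symm,
      (krausBy_prepare_pair h5 isDensity_mixedPair).conjBy_comm]
    exact ctrl_mem (fun B => onQubit_mem_Off (by simp [hcg, hch]) B)
      (onQubit_mem_Off (by simp [hqg, hqh]) B)

end Teleportation

/-! ### Pauli matrices, Pauli strings and syndromes -/

section Pauli

set_option linter.unusedSectionVars false
set_option linter.unusedDecidableInType false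
set_option linter.unusedFintypeInType false

theorem bool_matrix_ext {A B : Matrix Bool Bool ℂ} (h1 : A false false = B false false)
    (h2 : A false true = B false true) (h3 : A true false = B true false)
    (h4 : A true true = B true true) : A = B := by
  ext i j; cases i <;> cases j <;> assumption

theorem gateX_mul_self : gateX * gateX = 1 := by
  apply bool_matrix_ext <;> simp [gateX, Matrix.mul_apply]

theorem gateZ_mul_self : gateZ * gateZ = 1 := by
  apply bool_matrix_ext <;> simp [gateZ, Matrix.mul_apply]

theorem gateY_mul_self : gateY * gateY = 1 := by
  apply bool_matrix_ext <;> simp [gateY, gateX, gateZ, Matrix.mul_apply]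

theorem gateH_mul_self : gateH * gateH = 1 := by
  have h := sqrt_two_inv_mul_self
  apply bool_matrix_ext <;> simp [gateH, Matrix.mul_apply, div_eq_mul_inv, h]; norm_num

theorem gateX_conjTranspose : gateXᴴ = gateX := by
  apply bool_matrix_ext <;> simp [gateX, Matrix.conjTranspose_apply]

theorem gateZ_conjTranspose : gateZᴴ = gateZ := by
  apply bool_matrix_ext <;> simp [gateZ, Matrix.conjTranspose_apply]

theorem gateY_conjTranspose : gateYᴴ = gateY := by
  apply bool_matrix_ext <;> simp [gateY, gateX, gateZ, Matrix.conjTranspose_apply, Matrix.mul_apply]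

theorem gateH_conjTranspose : gateHᴴ = gateH := by
  apply bool_matrix_ext <;> simp [gateH, Matrix.conjTranspose_apply]

theorem gateS_unitary : gateSᴴ * gateS = 1 := by
  apply bool_matrix_ext <;> simp [gateS, Matrix.mul_apply]

theorem gateS_unitary' : gateS * gateSᴴ = 1 := by
  apply bool_matrix_ext <;> simp [gateS, Matrix.mul_apply]

theorem gateX_mul_gateZ : gateX * gateZ = -(gateZ * gateX) := by
  apply bool_matrix_ext <;> simp [gateX, gateZ, Matrix.mul_apply]

theorem gateH_mul_gateX : gateH * gateX = gateZ * gateH := by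
  apply bool_matrix_ext <;> simp [gateX, gateZ, gateH, Matrix.mul_apply, div_eq_mul_inv]

theorem gateH_mul_gateZ : gateH * gateZ = gateX * gateH := by
  apply bool_matrix_ext <;> simp [gateX, gateZ, gateH, Matrix.mul_apply, div_eq_mul_inv]

theorem gateS_mul_gateX : gateS * gateX = gateY * gateS := by
  apply bool_matrix_ext <;> simp [gateX, gateZ, gateY, gateS, Matrix.mul_apply]

theorem zmod_two_cases (a : ZMod 2) : a = 0 ∨ a = 1 := by
  revert a; decide

/-- The character `a ↦ (-1)^a`. -/
def sgn (a : ZMod 2) : ℂ := if a = 0 then 1 else -1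

theorem sgn_zero : sgn 0 = 1 := by simp [sgn]

theorem sgn_one : sgn 1 = -1 := by simp [sgn]

theorem sgn_add (a b : ZMod 2) : sgn (a + b) = sgn a * sgn b := by
  rcases zmod_two_cases a with rfl | rfl <;> rcases zmod_two_cases b with rfl | rfl <;>
    simp [sgn, show (1 + 1 : ZMod 2) = 0 from rfl]

theorem sgn_sum {κ : Type*} (s : Finset κ) (f : κ → ZMod 2) :
    sgn (∑ i ∈ s, f i) = ∏ i ∈ s, sgn (f i) := by
  classical
  induction s using Finset.induction_on with
  | empty => simp [sgn]
  | insert a s ha ih => rw [Finset.sum_insert ha, Finset.prod_insert ha, sgn_add, ih]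

theorem tens_smul {ι : Type} [Fintype ι] (c : ι → ℂ) (A : ι → Matrix Bool Bool ℂ) :
    (tens fun i => c i • A i) = (∏ i, c i) • tens A := by
  ext x y
  simp [tens, Finset.prod_mul_distrib]

namespace PauliString

variable {n : ℕ}

theorem letter_mul_self (P : PauliString n) (j : Fin n) : P.letter j * P.letter j = 1 := by
  unfold letter
  split_ifs <;> simp [gateX_mul_self, gateY_mul_self, gateZ_mul_self]

theorem letter_conjTranspose (P : PauliString n) (j : Fin n) : (P.letter j)ᴴ = P.letter j := by
  unfold letter
  split_ifs <;> simp [gateX_conjTranspose, gateY_conjTranspose, gateZ_conjTranspose]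

theorem letter_comm (P P' : PauliString n) (j : Fin n) :
    P.letter j * P'.letter j =
      sgn (P.x j * P'.z j + P.z j * P'.x j) • (P'.letter j * P.letter j) := by
  have hYX : gateY * gateX = -(gateX * gateY) := by
    apply bool_matrix_ext <;> simp [gateY, gateX, gateZ, Matrix.mul_apply]
  have hYZ : gateY * gateZ = -(gateZ * gateY) := by
    apply bool_matrix_ext <;> simp [gateY, gateX, gateZ, Matrix.mul_apply]
  unfold letter
  rcases zmod_two_cases (P.x j) with h1 | h1 <;> rcases zmod_two_cases (P.z j) with h2 | h2 <;>
    rcases zmod_two_cases (P'.x j) with h3 | h3 <;> rcases zmod_two_cases (P'.z j) with h4 | h4 <;>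
    simp [h1, h2, h3, h4, sgn, gateX_mul_gateZ, hYX, hYZ, show (1 + 1 : ZMod 2) = 0 from rfl]

theorem letter_eq_one {P : PauliString n} {j : Fin n} (h : j ∉ P.support) : P.letter j = 1 := by
  simp only [support, Finset.mem_filter, Finset.mem_univ, true_and, not_or, not_not] at h
  simp [letter, h]

/-- The sign of a Pauli string. -/
def sign (P : PauliString n) : ℂ := if P.neg then -1 else 1

theorem sign_mul_self (P : PauliString n) : P.sign * P.sign = 1 := by
  unfold sign; split_ifs <;> simp

theorem mat_eq (P : PauliString n) : P.mat = P.sign • tens P.letter := rfl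

theorem mat_mul_self (P : PauliString n) : P.mat * P.mat = 1 := by
  rw [mat_eq, smul_mul_smul_comm, sign_mul_self, one_smul, tens_mul]
  simp only [letter_mul_self, tens_one]

theorem mat_conjTranspose (P : PauliString n) : P.matᴴ = P.mat := by
  rw [mat_eq, Matrix.conjTranspose_smul, tens_conjTranspose]
  simp only [letter_conjTranspose]
  congr 1
  unfold sign; split_ifs <;> simp

/-- Each position contributes a sign, and the signs multiply to the character of the symplectic
product. -/
theorem mat_comm (P P' : PauliString n) : P.mat * P'.mat = sgn (P.symp P') • (P'.mat * P.mat) := by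
  rw [mat_eq, mat_eq, smul_mul_smul_comm, smul_mul_smul_comm, tens_mul, tens_mul]
  simp only [letter_comm P P']
  rw [tens_smul, symp, sgn_sum, smul_comm, mul_comm P.sign]

theorem mat_commute {P P' : PauliString n} (h : P.symp P' = 0) : Commute P.mat P'.mat := by
  have := mat_comm P P'
  rwa [h, sgn_zero, one_smul] at this

theorem symp_comm (P P' : PauliString n) : P.symp P' = P'.symp P := by
  unfold symp
  refine Finset.sum_congr rfl fun j _ => ?_
  ring

/-- Measuring in the eigenbases of the letters measures the Pauli operator. -/
theorem proj_mul_toZBasis_mul (P : PauliString n) (s : Fin n → Bool) :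
    pureState (ket s) * (tens P.toZBasis * P.mat) =
      (if P.neg ^^ decide (Odd (P.support.filter fun j => s j = true).card) then -1 else 1 : ℂ) •
        (pureState (ket s) * tens P.toZBasis) := by
  -- On the support the change of basis turns the letter into `Z`; the string then acts on `|s⟩` by
  -- the parity of `s` over the support.
  have h1 : ∀ j, P.toZBasis j * P.letter j =
      (if j ∈ P.support then gateZ else 1) * P.toZBasis j := fun j => by
    by_cases hj : j ∈ P.support
    · have hj' := hj
      simp only [support, Finset.mem_filter, Finset.mem_univ, true_and] at hj'
      rw [if_pos hj]
      unfold toZBasis letter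
      rcases zmod_two_cases (P.x j) with hx | hx <;> rcases zmod_two_cases (P.z j) with hz | hz <;>
        simp [hx, hz] at hj' ⊢
      · exact gateH_mul_gateX
      · have : gateSᴴ * gateY = gateX * gateSᴴ := by
          apply bool_matrix_ext <;>
            simp [gateX, gateZ, gateY, gateS, Matrix.mul_apply]
        rw [mul_assoc, this, ← mul_assoc, gateH_mul_gateX, mul_assoc]
    · rw [if_neg hj, letter_eq_one hj, mul_one, one_mul]
  have h2 : tens P.toZBasis * P.mat =
      P.sign • (tens (fun j => if j ∈ P.support then gateZ else 1) * tens P.toZBasis) := by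
    rw [mat_eq, mul_smul_comm, tens_mul, tens_mul]
    simp only [h1]
  have h3 : pureState (ket s) * tens (fun j => if j ∈ P.support then gateZ else 1) =
      (∏ j, if j ∈ P.support ∧ s j = true then -1 else 1 : ℂ) • pureState (ket s) := by
    ext x y
    rw [Matrix.mul_apply, Finset.sum_eq_single s]
    · rw [Matrix.smul_apply, pureState_ket_apply, pureState_ket_apply]
      by_cases hx : x = s
      · by_cases hy : y = s
        · rw [hx, hy]
          simp only [and_self, if_true, tens, Matrix.of_apply, one_mul, smul_eq_mul, mul_one]
          refine Finset.prod_congr rfl fun j _ => ?_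
          by_cases hj : j ∈ P.support <;> by_cases hs : s j = true <;> simp [hj, hs, gateZ]
        · obtain ⟨j, hj⟩ := Function.ne_iff.1 hy
          simp only [hx, hy, and_self, if_true, and_false, if_false, smul_zero, tens,
            Matrix.of_apply]
          rw [Finset.prod_eq_zero (Finset.mem_univ j), mul_zero]
          split_ifs
          · simp [gateZ, Ne.symm hj]
          · simp [Ne.symm hj]
      · simp [hx]
    · intro z _ hz
      rw [pureState_ket_apply, if_neg (fun h => hz h.2), zero_mul]
    · simp
  rw [h2, mul_smul_comm, ← mul_assoc, h3, smul_mul_assoc, smul_smul]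
  congr 1
  have h4 : (∏ j, if j ∈ P.support ∧ s j = true then -1 else 1 : ℂ) =
      (-1) ^ (P.support.filter fun j => s j = true).card := by
    rw [← Finset.prod_filter, Finset.prod_const]
    congr 2
    ext j; simp
  rw [h4]
  unfold sign
  by_cases ho : Odd (P.support.filter fun j => s j = true).card
  · rw [ho.neg_one_pow]; cases P.neg <;> simp [ho]
  · rw [(Nat.not_odd_iff_even.1 ho).neg_one_pow]; cases P.neg <;> simp [ho]

end PauliString

namespace StabilizerCode

variable {r k : ℕ} (code : StabilizerCode r k)

/-- By independence a functional on `𝔽₂²ⁿ` takes prescribed values on the enforced operators, and by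
nondegeneracy of the symplectic form it is the product with some Pauli string. This gives both the
correction table and the sign flips that compute the dimension of the stabilized space. -/
theorem exists_symp (f : Fin (r + k) → ZMod 2) :
    ∃ P : PauliString (r + k), ∀ i, P.symp (code.ops i) = f i := by
  obtain ⟨g, hg⟩ : ∃ g : ((Fin (r + k) → ZMod 2) × (Fin (r + k) → ZMod 2)) →ₗ[ZMod 2] ZMod 2,
      ∀ i, g ((code.ops i).x, (code.ops i).z) = f i := by
    obtain ⟨g, hg⟩ := ((Module.Basis.span code.indep).constr (ZMod 2) f).exists_extend
    refine ⟨g, fun i => ?_⟩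
    have h1 := (Module.Basis.span code.indep).constr_basis (ZMod 2) f i
    rw [← hg, LinearMap.comp_apply, Submodule.subtype_apply, Module.Basis.span_apply] at h1
    exact h1
  -- The components are swapped because the symplectic form pairs `x` with `z`; the sign of the
  -- string plays no role.
  refine ⟨⟨fun j => g (0, Pi.single j 1), fun j => g (Pi.single j 1, 0), false⟩, fun i => ?_⟩
  rw [← hg i, PauliString.symp]
  have hsing : ∀ i : Fin (r + k), (fun j => if i = j then (1 : ZMod 2) else 0) = Pi.single i 1 :=
    fun i => by ext j; simp [Pi.single_apply, eq_comm]
  have h1 : ∀ v : Fin (r + k) → ZMod 2, g (v, 0) = ∑ j, g (Pi.single j 1, 0) * v j := fun v => by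
    have := LinearMap.pi_apply_eq_sum_univ (g.comp (LinearMap.inl _ _ _)) v
    simpa [mul_comm, hsing, LinearMap.inl_apply] using this
  have h2 : ∀ v : Fin (r + k) → ZMod 2, g (0, v) = ∑ j, g (0, Pi.single j 1) * v j := fun v => by
    have := LinearMap.pi_apply_eq_sum_univ (g.comp (LinearMap.inr _ _ _)) v
    simpa [mul_comm, hsing, LinearMap.inr_apply] using this
  have h3 : ((code.ops i).x, (code.ops i).z) = ((code.ops i).x, 0) + (0, (code.ops i).z) := by simp
  rw [h3, map_add, h1, h2, ← Finset.sum_add_distrib]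
  refine Finset.sum_congr rfl fun j _ => by ring

theorem exists_isCorrectionTable : ∃ C, code.IsCorrectionTable C := by
  choose C hC using fun m : Fin (r + k) → Bool => code.exists_symp fun i => if m i then 1 else 0
  exact ⟨C, fun m i => hC m i⟩

end StabilizerCode

end Pauli

section Codes

set_option linter.unusedSectionVars false
set_option linter.unusedDecidableInType false
set_option linter.unusedFintypeInType false

/-! ### Joint eigenspaces of commuting involutions -/

section Involutions

variable {m : Type} [Fintype m] [DecidableEq m] {κ : Type} (P : κ → Matrix m m ℂ)

/-- The projection onto the joint `+1` eigenspace of the operators `P i`, `i ∈ l`. -/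
def stabProj (l : List κ) : Matrix m m ℂ := (l.map fun i => (1 / 2 : ℂ) • (1 + P i)).prod

variable {P}

theorem commute_stabProj {A : Matrix m m ℂ} {l : List κ} (h : ∀ i ∈ l, Commute A (P i)) :
    Commute A (stabProj P l) := by
  induction l with
  | nil => exact Commute.one_right A
  | cons a l ih =>
    rw [stabProj, List.map_cons, List.prod_cons]
    exact (((Commute.one_right A).add_right (h a (by simp))).smul_right _).mul_right
      (ih fun i hi => h i (by simp [hi]))

variable (hsq : ∀ i, P i * P i = 1) (hherm : ∀ i, (P i)ᴴ = P i) (hcomm : ∀ i j, Commute (P i) (P j))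

include hsq hcomm in
theorem mul_stabProj {l : List κ} {i : κ} (hi : i ∈ l) : P i * stabProj P l = stabProj P l := by
  induction l with
  | nil => simp at hi
  | cons a l ih =>
    rw [stabProj, List.map_cons, List.prod_cons]
    rcases List.mem_cons.1 hi with rfl | hi
    · rw [← mul_assoc, mul_smul_comm, mul_add, hsq, mul_one, add_comm]
    · rw [← mul_assoc, (((Commute.one_right (P i)).add_right (hcomm i a)).smul_right _).eq,
        mul_assoc]
      congr 1
      exact ih hi

theorem stabProj_mul {l : List κ} {m' : Type} {K : Matrix m m' ℂ} (h : ∀ i ∈ l, P i * K = K) :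
    stabProj P l * K = K := by
  induction l with
  | nil => exact Matrix.one_mul K
  | cons a l ih =>
    rw [stabProj, List.map_cons, List.prod_cons, Matrix.mul_assoc]
    have := ih fun i hi => h i (by simp [hi])
    rw [stabProj] at this
    rw [this, Matrix.smul_mul, Matrix.add_mul, Matrix.one_mul, h a (by simp), ← two_smul ℂ K,
      smul_smul]
    norm_num

include hherm hcomm in
theorem stabProj_conjTranspose (l : List κ) : (stabProj P l)ᴴ = stabProj P l := by
  induction l with
  | nil => simp [stabProj]
  | cons a l ih =>
    have h : Commute ((1 / 2 : ℂ) • (1 + P a)) (stabProj P l) :=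
      ((Commute.one_left _).add_left (commute_stabProj fun i _ => hcomm a i)).smul_left _
    have h2 : stabProj P (a :: l) = ((1 / 2 : ℂ) • (1 + P a)) * stabProj P l := by
      simp [stabProj]
    rw [h2, Matrix.conjTranspose_mul, ih, Matrix.conjTranspose_smul, Matrix.conjTranspose_add,
      hherm, Matrix.conjTranspose_one, h.eq]
    simp

include hsq hcomm in
theorem stabProj_mul_self (l : List κ) : stabProj P l * stabProj P l = stabProj P l :=
  stabProj_mul fun _ hi => mul_stabProj hsq hcomm hi

/-- If each sign can be flipped by a unitary, the joint eigenspace shrinks by half with each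
operator. -/
theorem trace_stabProj (hflip : ∀ i, ∃ C : Matrix m m ℂ, C * C = 1 ∧ C * P i = -(P i * C) ∧
      ∀ j, j ≠ i → Commute C (P j)) (l : List κ) (hl : l.Nodup) :
    (stabProj P l).trace * 2 ^ l.length = Fintype.card m := by
  induction l with
  | nil => simp [stabProj, Matrix.trace_one]
  | cons a l ih =>
    rw [List.nodup_cons] at hl
    have h2 : stabProj P (a :: l) = (1 / 2 : ℂ) • (stabProj P l + P a * stabProj P l) := by
      simp [stabProj, add_mul]
    obtain ⟨C, hC, hCa, hCj⟩ := hflip a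
    have h3 : Commute C (stabProj P l) := commute_stabProj fun j hj =>
      hCj j fun h => hl.1 (h ▸ hj)
    -- Conjugation by `C` preserves the trace but negates `P a`, while fixing the projection for the
    -- remaining operators.
    have h4 : (P a * stabProj P l).trace = 0 := by
      have : (P a * stabProj P l).trace = -(P a * stabProj P l).trace := by
        calc (P a * stabProj P l).trace = ((C * C) * (P a * stabProj P l)).trace := by
              rw [hC, one_mul]
          _ = (C * (P a * stabProj P l * C)).trace := by
              rw [mul_assoc, Matrix.trace_mul_comm, mul_assoc]
          _ = (C * P a * (C * stabProj P l)).trace := by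
              rw [h3.eq]; simp only [mul_assoc]
          _ = -(P a * (C * C) * stabProj P l).trace := by
              rw [hCa, neg_mul, Matrix.trace_neg]; simp only [mul_assoc]
          _ = _ := by rw [hC, mul_one]
      linear_combination (1 / 2 : ℂ) * this
    rw [h2, Matrix.trace_smul, Matrix.trace_add, h4, List.length_cons, ← ih hl.2, pow_succ,
      smul_eq_mul]
    ring

end Involutions

/-! ### Projections of trace one -/

section RankOne

variable {m : Type} [Fintype m] [DecidableEq m] {R : Matrix m m ℂ}

theorem mul_pureState {m' : Type} [Fintype m'] (A : Matrix m' m ℂ) (v : m → ℂ) :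
    A * pureState v * Aᴴ = pureState (A *ᵥ v) := by
  rw [pureState, Matrix.mul_vecMulVec, Matrix.vecMulVec_mul, pureState, Matrix.star_mulVec]

theorem pureState_mulVec (v w : m → ℂ) : pureState v *ᵥ w = (star v ⬝ᵥ w) • v := by
  rw [pureState, Matrix.vecMulVec_mulVec]
  ext i; simp [mul_comm]

theorem star_dotProduct_self (v : m → ℂ) : star v ⬝ᵥ v = ((∑ x, ‖v x‖ ^ 2 : ℝ) : ℂ) := by
  simp only [dotProduct, Pi.star_apply]
  push_cast
  refine Finset.sum_congr rfl fun x _ => ?_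
  rw [Complex.star_def, Complex.conj_mul']

theorem pureState_mul_self {v : m → ℂ} (hv : ∑ x, ‖v x‖ ^ 2 = 1) :
    pureState v * pureState v = pureState v := by
  rw [pureState, Matrix.vecMulVec_mul_vecMulVec, star_dotProduct_self, hv]
  simp

/-- The difference `R - |v⟩⟨v|` is again an orthogonal projection, now of trace zero, hence zero. -/
theorem eq_pureState (hherm : Rᴴ = R) (hsq : R * R = R) (htr : R.trace = 1) {v : m → ℂ}
    (hv : ∑ x, ‖v x‖ ^ 2 = 1) (hRv : R *ᵥ v = v) : R = pureState v := by
  have h1 : R * pureState v = pureState v := by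
    rw [pureState, Matrix.mul_vecMulVec, hRv]
  have h2 : pureState v * R = pureState v := by
    have := congrArg Matrix.conjTranspose h1
    rwa [Matrix.conjTranspose_mul, hherm, pureState_conjTranspose] at this
  have h3 : (R - pureState v)ᴴ * (R - pureState v) = R - pureState v := by
    rw [Matrix.conjTranspose_sub, hherm, pureState_conjTranspose, sub_mul, mul_sub, mul_sub, hsq,
      h1, h2, pureState_mul_self hv]
    abel
  have h4 : ((R - pureState v)ᴴ * (R - pureState v)).trace = 0 := by
    rw [h3, Matrix.trace_sub, htr, trace_pureState, hv]; simp
  exact sub_eq_zero.1 (Matrix.trace_conjTranspose_mul_self_eq_zero_iff.1 h4)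

/-- A nonzero column of `R` lies in its range; normalize it. -/
theorem exists_unit_fixed (hsq : R * R = R) (htr : R.trace = 1) :
    ∃ v : m → ℂ, ∑ x, ‖v x‖ ^ 2 = 1 ∧ R *ᵥ v = v := by
  obtain ⟨j, hj⟩ : ∃ j, R *ᵥ ket j ≠ 0 := by
    by_contra h
    push Not at h
    have : R = 0 := by
      ext i j
      have := congrFun (h j) i
      simpa [ket] using this
    rw [this] at htr
    simp at htr
  set w := R *ᵥ ket j with hw
  have hRw : R *ᵥ w = w := by rw [hw, Matrix.mulVec_mulVec, hsq]
  set N : ℝ := ∑ x, ‖w x‖ ^ 2 with hN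
  have hN0 : 0 < N := by
    refine lt_of_le_of_ne (Finset.sum_nonneg fun _ _ => by positivity) fun h => hj ?_
    rw [eq_comm, hN, Finset.sum_eq_zero_iff_of_nonneg fun _ _ => by positivity] at h
    funext x
    simpa using h x (Finset.mem_univ x)
  refine ⟨((Real.sqrt N : ℝ) : ℂ)⁻¹ • w, ?_, by rw [Matrix.mulVec_smul, hRw]⟩
  have : ∀ x, ‖(((Real.sqrt N : ℝ) : ℂ)⁻¹ • w) x‖ ^ 2 = N⁻¹ * ‖w x‖ ^ 2 := fun x => by
    rw [Pi.smul_apply, smul_eq_mul, norm_mul, mul_pow, norm_inv, Complex.norm_real, inv_pow,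
      Real.norm_eq_abs, sq_abs, Real.sq_sqrt hN0.le]
  rw [Finset.sum_congr rfl fun x _ => this x, ← Finset.mul_sum, ← hN, inv_mul_cancel₀ hN0.ne']

end RankOne

theorem mul_onQubit_apply {Q : Type} [Fintype Q] [DecidableEq Q] {m : Type} (q : Q)
    (A : Matrix Bool Bool ℂ) (N : Matrix m (Q → Bool) ℂ) (x : m) (y : Q → Bool) :
    (N * onQubit q A) x y = ∑ b, N x (Function.update y q b) * A b (y q) := by
  have h : N * onQubit q A = (onQubit q Aᴴ * Nᴴ)ᴴ := by
    rw [onQubit_conjTranspose]; simp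
  rw [h, Matrix.conjTranspose_apply, onQubit_mul_apply, star_sum]
  simp [mul_comm]

/-! ### Logical zero state and encoding isometry -/

namespace StabilizerCode

variable {r k : ℕ} (code : StabilizerCode r k)

theorem ops_symp (i j : Fin (r + k)) : (code.ops i).symp (code.ops j) = 0 := by
  unfold ops
  refine Fin.addCases (fun i => ?_) (fun i => ?_) i <;>
    refine Fin.addCases (fun j => ?_) (fun j => ?_) j
  · simpa using code.gens_comm i j
  · simpa using code.gens_zbar i j
  · simpa using (PauliString.symp_comm _ _).trans (code.gens_zbar j i)
  · simpa using code.zbar_comm i j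

theorem ops_commute (i j : Fin (r + k)) : Commute (code.ops i).mat (code.ops j).mat :=
  PauliString.mat_commute (code.ops_symp i j)

/-- The projection onto the logical zero state. -/
def zeroProj : Op (Fin (r + k)) := stabProj (fun i => (code.ops i).mat) (List.finRange (r + k))

/-- There are as many enforced operators as qubits, and each halves the dimension, so `2 ^ (r + k)`
shrinks to one. -/
theorem trace_zeroProj : code.zeroProj.trace = 1 := by
  have h := trace_stabProj (P := fun i => (code.ops i).mat) (fun i => by
    obtain ⟨C, hC⟩ := code.exists_symp (fun j => if j = i then 1 else 0)
    refine ⟨C.mat, C.mat_mul_self, ?_, fun j hj => PauliString.mat_commute (by rw [hC, if_neg hj])⟩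
    rw [PauliString.mat_comm, hC, if_pos rfl, sgn_one, neg_one_smul]) (List.finRange (r + k))
    (List.nodup_finRange _)
  rw [List.length_finRange] at h
  have h2 : (Fintype.card (Fin (r + k) → Bool) : ℂ) = 2 ^ (r + k) := by simp
  rw [h2] at h
  exact mul_right_cancel₀ (by positivity : (2 : ℂ) ^ (r + k) ≠ 0) (by rw [one_mul]; exact h)

theorem exists_isLogicalZero : ∃ v, code.IsLogicalZero v := by
  obtain ⟨v, hv, hR⟩ := exists_unit_fixed (R := code.zeroProj)
    (stabProj_mul_self (fun i => (code.ops i).mat_mul_self) code.ops_commute _) code.trace_zeroProj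
  refine ⟨v, hv, fun i => ?_⟩
  conv_lhs => rw [← hR]
  rw [Matrix.mulVec_mulVec, zeroProj,
    mul_stabProj (fun i => (code.ops i).mat_mul_self) code.ops_commute (List.mem_finRange i)]
  exact hR

/-- Existence turns the choice operator in `zeroL` into the defining property. -/
theorem isLogicalZero_zeroL : code.IsLogicalZero code.zeroL :=
  Classical.epsilon_spec code.exists_isLogicalZero

/-- Uniqueness of the logical zero up to phase: a state fixed by all enforced operators is fixed by
this rank-one projection, which is how the encoding step is verified. -/
theorem zeroProj_eq : code.zeroProj = pureState code.zeroL := by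
  refine eq_pureState (stabProj_conjTranspose (fun i => (code.ops i).mat_conjTranspose)
    code.ops_commute _) (stabProj_mul_self (fun i => (code.ops i).mat_mul_self) code.ops_commute _)
    code.trace_zeroProj code.isLogicalZero_zeroL.1 ?_
  have : code.zeroProj * Matrix.replicateCol Unit code.zeroL = Matrix.replicateCol Unit code.zeroL := by
    refine stabProj_mul fun i _ => ?_
    rw [← Matrix.replicateCol_mulVec, code.isLogicalZero_zeroL.2 i]
  rw [← Matrix.replicateCol_mulVec] at this
  exact Matrix.replicateCol_injective this

theorem zbar_mulVec_zeroL (a : Fin k) : (code.zbar a).mat *ᵥ code.zeroL = code.zeroL := by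
  have := code.isLogicalZero_zeroL.2 (Fin.natAdd r a)
  simpa [ops] using this

/-- The product of the logical `X` operators selected by `y`. -/
def xProd (l : List (Fin k)) (y : Fin k → Bool) : Op (Fin (r + k)) :=
  (l.map fun a => if y a then (code.xbar a).mat else 1).prod

theorem xProd_conjTranspose_mul (l : List (Fin k)) (y : Fin k → Bool) :
    (code.xProd l y)ᴴ * code.xProd l y = 1 := by
  induction l with
  | nil => simp [xProd]
  | cons a l ih =>
    have h : code.xProd (a :: l) y = (if y a then (code.xbar a).mat else 1) * code.xProd l y := by
      simp [xProd]
    rw [h, Matrix.conjTranspose_mul, mul_assoc, ← mul_assoc _ _ (code.xProd l y)]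
    have h2 : (if y a then (code.xbar a).mat else 1)ᴴ * (if y a then (code.xbar a).mat else 1) =
        1 := by
      split_ifs
      · rw [PauliString.mat_conjTranspose, PauliString.mat_mul_self]
      · simp
    rw [h2, one_mul, ih]

/-- Moving `Z̄_b` to the right it anticommutes only with `X̄_b`, which occurs at most once. -/
theorem zbar_mul_xProd (b : Fin k) {l : List (Fin k)} (hl : l.Nodup) (y : Fin k → Bool) :
    (code.zbar b).mat * code.xProd l y =
      (if b ∈ l ∧ y b then -1 else 1 : ℂ) • (code.xProd l y * (code.zbar b).mat) := by
  induction l with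
  | nil => simp [xProd]
  | cons a l ih =>
    rw [List.nodup_cons] at hl
    have h : code.xProd (a :: l) y = (if y a then (code.xbar a).mat else 1) * code.xProd l y := by
      simp [xProd]
    have h2 : (code.zbar b).mat * (if y a then (code.xbar a).mat else 1) =
        (if b = a ∧ y a then -1 else 1 : ℂ) •
          ((if y a then (code.xbar a).mat else 1) * (code.zbar b).mat) := by
      by_cases hy : y a = true
      · rw [if_pos hy, PauliString.mat_comm, PauliString.symp_comm, code.xbar_zbar]
        by_cases hab : a = b
        · simp [hab, sgn_one, hab ▸ hy]
        · simp [hab, sgn_zero, Ne.symm hab]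
      · simp [hy]
    rw [h, ← mul_assoc, h2, Matrix.smul_mul, mul_assoc, ih hl.2, mul_smul_comm, smul_smul,
      mul_assoc]
    congr 1
    by_cases hab : b = a
    · subst hab; simp [hl.1]
    · simp [hab]

/-- `X̄_b` commutes to its own place in the product and toggles that factor, since it squares to
one. -/
theorem xbar_mul_xProd (b : Fin k) {l : List (Fin k)} (hl : l.Nodup) (hb : b ∈ l)
    (y : Fin k → Bool) :
    (code.xbar b).mat * code.xProd l y = code.xProd l (Function.update y b (!y b)) := by
  induction l with
  | nil => simp at hb
  | cons a l ih =>
    rw [List.nodup_cons] at hl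
    have h : ∀ y, code.xProd (a :: l) y =
        (if y a then (code.xbar a).mat else 1) * code.xProd l y := by
      intro y; simp [xProd]
    rw [h, h, ← mul_assoc]
    by_cases hab : b = a
    · subst hab
      have h3 : code.xProd l (Function.update y b (!y b)) = code.xProd l y := by
        unfold xProd
        congr 1
        refine List.map_congr_left fun a ha => ?_
        rw [Function.update_of_ne (fun h : a = b => hl.1 (h ▸ ha))]
      rw [h3, Function.update_self]
      congr 1
      cases y b <;> simp [PauliString.mat_mul_self]
    · have hb' : b ∈ l := by simpa [hab] using hb
      rw [Function.update_of_ne (Ne.symm hab), ← ih hl.2 hb', ← mul_assoc]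
      congr 1
      split_ifs
      · exact (PauliString.mat_commute (code.xbar_comm b a)).eq
      · simp

theorem enc_col (y : Fin k → Bool) :
    (fun x => code.enc x y) = code.xProd (List.finRange k) y *ᵥ code.zeroL := by
  funext x
  rw [enc, Matrix.of_apply, List.ofFn_eq_map, xProd]

theorem mul_enc_apply (A : Op (Fin (r + k))) (x : Fin (r + k) → Bool) (y : Fin k → Bool) :
    (A * code.enc) x y = ((A * code.xProd (List.finRange k) y) *ᵥ code.zeroL) x := by
  rw [← Matrix.mulVec_mulVec, ← code.enc_col]
  rfl

/-- With `xbar_mul_enc` this is all that is needed about the code to compute logical actions: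
physical `Z̄`, `X̄` become `Z`, `X` under the encoding. -/
theorem zbar_mul_enc (a : Fin k) : (code.zbar a).mat * code.enc = code.enc * onQubit a gateZ := by
  ext x y
  rw [mul_enc_apply, code.zbar_mul_xProd a (List.nodup_finRange k), Matrix.smul_mulVec,
    ← Matrix.mulVec_mulVec, code.zbar_mulVec_zeroL, ← code.enc_col, mul_onQubit_apply,
    Finset.sum_eq_single (y a)]
  · simp [gateZ, mul_comm]
  · intro b _ hb; simp [gateZ, hb]
  · simp

theorem xbar_mul_enc (a : Fin k) : (code.xbar a).mat * code.enc = code.enc * onQubit a gateX := by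
  ext x y
  rw [mul_enc_apply, code.xbar_mul_xProd a (List.nodup_finRange k) (List.mem_finRange a),
    ← code.enc_col, mul_onQubit_apply]
  cases h : y a <;> simp [gateX]

/-- Columns are unit vectors, being unitary images of the logical zero. Distinct columns are
orthogonal because some `Z̄_a` has different eigenvalues on them. -/
theorem enc_conjTranspose_mul_enc : code.encᴴ * code.enc = 1 := by
  ext y y'
  by_cases h : y = y'
  · subst h
    have h1 : (code.encᴴ * code.enc) y y =
        star (fun x => code.enc x y) ⬝ᵥ (fun x => code.enc x y) := by
      simp [Matrix.mul_apply, dotProduct]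
    rw [h1, code.enc_col, Matrix.star_mulVec, ← Matrix.dotProduct_mulVec, Matrix.mulVec_mulVec,
      xProd_conjTranspose_mul, Matrix.one_mulVec, star_dotProduct_self,
      code.isLogicalZero_zeroL.1, Matrix.one_apply_eq]
    simp
  · rw [Matrix.one_apply_ne h]
    obtain ⟨a, ha⟩ := Function.ne_iff.1 h
    -- The Gram matrix commutes with `Z` on qubit `a`, so its entry between labels that differ at
    -- `a` equals its own negative.
    have h1 : onQubit a gateZ * (code.encᴴ * code.enc) =
        code.encᴴ * code.enc * onQubit a gateZ := by
      have h2 := congrArg Matrix.conjTranspose (code.zbar_mul_enc a)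
      rw [Matrix.conjTranspose_mul, Matrix.conjTranspose_mul, PauliString.mat_conjTranspose,
        ← onQubit_conjTranspose, gateZ_conjTranspose] at h2
      rw [← Matrix.mul_assoc, ← h2, Matrix.mul_assoc, code.zbar_mul_enc, Matrix.mul_assoc]
    have h3 := congrFun (congrFun h1 y) y'
    rw [gateZ_mul_apply, mul_onQubit_apply, Finset.sum_eq_single (y' a)] at h3
    · rw [Function.update_eq_self] at h3
      cases hy : y a <;> cases hy' : y' a <;> simp [hy, hy', gateZ] at h3 ha
      · linear_combination (1 / 2 : ℂ) * h3
      · linear_combination (-1 / 2 : ℂ) * h3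
    · intro b _ hb; simp [gateZ, hb]
    · simp

theorem sum_norm_sq_enc {φ : (Fin k → Bool) → ℂ} (hφ : ∑ x, ‖φ x‖ ^ 2 = 1) :
    ∑ x, ‖(code.enc *ᵥ φ) x‖ ^ 2 = 1 := by
  have h1 := star_dotProduct_self (code.enc *ᵥ φ)
  rw [Matrix.star_mulVec, ← Matrix.dotProduct_mulVec, Matrix.mulVec_mulVec,
    enc_conjTranspose_mul_enc, Matrix.one_mulVec, star_dotProduct_self, hφ] at h1
  exact_mod_cast h1.symm

theorem enc_mulVec_ket_zero : code.enc *ᵥ ket (fun _ => false) = code.zeroL := by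
  have h : code.enc *ᵥ ket (fun _ => false) = fun x => code.enc x (fun _ => false) := by
    funext x; simp [ket]
  rw [h, code.enc_col]
  simp [xProd]

theorem extend_block {β : Type} [DecidableEq β] {n : ℕ} (b b' : β) (d : Fin n → Bool)
    (x : β × Fin n → Bool) :
    (fun j => Function.extend (fun j => (b, j)) d x (b', j)) =
      if b' = b then d else fun j => x (b', j) := by
  have hinj : Function.Injective (fun j : Fin n => (b, j)) := fun i j h => (Prod.ext_iff.1 h).2
  funext j
  by_cases h : b' = b
  · subst h
    rw [if_pos rfl]
    exact hinj.extend_apply d x j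
  · rw [if_neg h, Function.extend_apply' _ _ _ (by rintro ⟨i, hi⟩; exact h (Prod.ext_iff.1 hi).1.symm)]

theorem encBlocks_apply_extend {β : Type} [Fintype β] [DecidableEq β] (b : β)
    (d : Fin (r + k) → Bool) (x : β × Fin (r + k) → Bool) (y : β × Fin k → Bool) :
    code.encBlocks β (Function.extend (fun j => (b, j)) d x) y = code.enc d (fun a => y (b, a)) *
      ∏ b' ∈ Finset.univ.erase b, code.enc (fun j => x (b', j)) (fun a => y (b', a)) := by
  rw [encBlocks, Matrix.of_apply, ← Finset.mul_prod_erase _ _ (Finset.mem_univ b)]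
  congr 1
  · rw [extend_block, if_pos rfl]
  · refine Finset.prod_congr rfl fun b' hb' => ?_
    rw [extend_block, if_neg (Finset.ne_of_mem_erase hb')]

theorem encBlocks_apply_extend' {β : Type} [Fintype β] [DecidableEq β] (b : β)
    (d : Fin k → Bool) (x : β × Fin (r + k) → Bool) (y : β × Fin k → Bool) :
    code.encBlocks β x (Function.extend (fun j => (b, j)) d y) = code.enc (fun j => x (b, j)) d *
      ∏ b' ∈ Finset.univ.erase b, code.enc (fun j => x (b', j)) (fun a => y (b', a)) := by
  rw [encBlocks, Matrix.of_apply, ← Finset.mul_prod_erase _ _ (Finset.mem_univ b)]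
  congr 1
  · rw [extend_block, if_pos rfl]
  · refine Finset.prod_congr rfl fun b' hb' => ?_
    rw [extend_block, if_neg (Finset.ne_of_mem_erase hb')]

theorem block_injective {β : Type} {n : ℕ} (b : β) :
    Function.Injective (fun j : Fin n => (b, j)) := fun _ _ h => (Prod.ext_iff.1 h).2

/-- The encoding of several blocks is a product over blocks, so an intertwining on one block leaves
the factors of the others alone. -/
theorem encBlocks_intertwine {β : Type} [Fintype β] [DecidableEq β] (b : β)
    {A : Op (Fin (r + k))} {B : Op (Fin k)} (h : A * code.enc = code.enc * B) :
    onQubits (fun j => (b, j)) A * code.encBlocks β =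
      code.encBlocks β * onQubits (fun a => (b, a)) B := by
  ext x y
  rw [onQubits_mul_apply (block_injective b)]
  have h2 : code.encBlocks β * onQubits (fun a => (b, a)) B =
      code.encBlocks β * (onQubits (fun a => (b, a)) Bᴴ)ᴴ := by
    rw [onQubits_conjTranspose, Matrix.conjTranspose_conjTranspose]
  rw [h2, mul_onQubits_conjTranspose_apply (block_injective b)]
  simp only [encBlocks_apply_extend, encBlocks_apply_extend', Matrix.conjTranspose_apply, star_star]
  have h3 := congrFun (congrFun h fun j => x (b, j)) fun a => y (b, a)
  simp only [Matrix.mul_apply] at h3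
  simp only [← mul_assoc, ← Finset.sum_mul]
  rw [h3, Finset.sum_mul]
  refine Finset.sum_congr rfl fun d _ => by ring

end StabilizerCode

end Codes

section Implementations

set_option linter.unusedSectionVars false
set_option linter.unusedDecidableInType false
set_option linter.unusedFintypeInType false

/-! ### Controlled Pauli strings and work-qubit gadgets -/

section Gadgets

variable {Q : Type} [Fintype Q] [DecidableEq Q]

theorem runAll_append (l l' : List (Chan Q)) (ρ : Op Q) :
    runAll (l ++ l') ρ = runAll l' (runAll l ρ) := by
  induction l generalizing ρ with
  | nil => rfl
  | cons c l ih => exact ih _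

theorem gateZ_mul_ctrl (c : Q) (A : Op Q) : onQubit c gateZ * ctrl c A = ctrl c (-A) := by
  ext x y
  rw [gateZ_mul_apply]
  simp only [ctrl, Matrix.of_apply, Matrix.neg_apply]
  cases x c <;> simp

theorem commute_onQubit_onQubits {ι : Type} [Fintype ι] [DecidableEq ι] {f : ι → Q}
    (hf : Function.Injective f) {c : Q} (hc : ∀ j, f j ≠ c) (A : Op ι) (C : Matrix Bool Bool ℂ) :
    Commute (onQubit c C) (onQubits f A) := by
  rw [onQubit_eq]
  exact onQubits_commute (const_injective c) hf (fun _ j => (hc j).symm) _ _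

/-- Controlled letters with a common control multiply to the controlled string, letters off the
support being trivial. A final `Z` on the control changes controlled `P` into controlled `-P`. -/
theorem realizes_ctrlPauli {n t : ℕ} {S : Set (Qubit n t)} {f : Fin n → Qubit n t}
    (hf : Function.Injective f) {c : Qubit n t} (hcS : c ∉ S) (hfS : ∀ j, f j ∉ S)
    (hc : ∀ j, f j ≠ c) (P : PauliString n) {cu : Fin n → Matrix Bool Bool ℂ → Chan (Qubit n t)}
    (hcu : ∀ j A, Realizes S (cu j A) (ctrl c (onQubit (f j) A))) :
    Realizes S (ctrlPauli P c cu) (ctrl c (onQubits f P.mat)) := by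
  have hoff : ∀ A, ctrl c (onQubits f A) ∈ Off S := fun A =>
    ctrl_mem (fun B => onQubit_mem_Off hcS B) (onQubits_mem_Off hf hfS A)
  have key : ∀ l : List (Fin n), l.Nodup →
      Realizes S (runAll (l.map fun j => if j ∈ P.support then cu j (P.letter j) else id))
        (ctrl c (onQubits f (tens fun j => if j ∈ l then P.letter j else 1))) := by
    intro l hl
    induction l with
    | nil =>
      simp only [List.not_mem_nil, if_false, tens_one, onQubits_one, ctrl_one]
      exact Realizes.of_kraus KrausBy.id
    | cons a l ih =>
      rw [List.nodup_cons] at hl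
      have h1 : Realizes S (if a ∈ P.support then cu a (P.letter a) else id)
          (ctrl c (onQubit (f a) (P.letter a))) := by
        split_ifs with ha
        · exact hcu a _
        · rw [PauliString.letter_eq_one ha, onQubit_one, ctrl_one]
          exact Realizes.of_kraus KrausBy.id
      have h2 := h1.comp (ih hl.2) (hoff _)
      rw [← ctrl_mul fun C => commute_onQubit_onQubits hf hc _ C, ← onQubits_onQubit hf,
        ← onQubits_mul hf, onQubit_eq_tens, tens_mul] at h2
      have h3 : (fun j => if j ∈ a :: l then P.letter j else 1) = fun j =>
          (if j ∈ l then P.letter j else 1) *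
            Function.update (fun _ => (1 : Matrix Bool Bool ℂ)) a (P.letter a) j := by
        funext j
        by_cases h : j = a
        · subst h; simp [hl.1]
        · simp [h]
      rw [h3]
      exact h2
  have h1 := key _ (List.nodup_finRange n)
  simp only [List.mem_finRange, if_true] at h1
  have h2 : Realizes S (applyIf P.neg (conjBy (onQubit c gateZ)))
      (if P.neg then onQubit c gateZ else 1) := by
    rw [applyIf_conjBy]; exact Realizes.conjBy _ _
  have h3 := h1.comp h2 (by
    split_ifs
    · exact onQubit_mem_Off hcS _
    · exact one_mem _)
  have h4 : (if P.neg then onQubit c gateZ else 1) * ctrl c (onQubits f (tens P.letter)) =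
      ctrl c (onQubits f P.mat) := by
    unfold PauliString.mat
    split_ifs
    · rw [gateZ_mul_ctrl, onQubits_smul, neg_one_smul]
    · rw [one_mul, one_smul]
  rw [← h4]
  convert h3 using 1
  funext ρ
  rw [ctrlPauli, runAll_append]
  rfl

/-- Conjugation of a controlled operator by Hadamard gates on the control. -/
theorem hadamard_ctrl_hadamard {w : Q} {P : Op Q} (hP : ∀ C, Commute (onQubit w C) P) :
    onQubit w gateH * (ctrl w P * onQubit w gateH) =
      onQubit w ((1 / 2 : ℂ) • (1 + gateX)) + onQubit w ((1 / 2 : ℂ) • (1 - gateX)) * P := by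
  have h0 : gateH * (Matrix.diagonal (fun b => if b then 0 else 1) * gateH) =
      (1 / 2 : ℂ) • (1 + gateX) := by
    have h := sqrt_two_inv_mul_self
    apply bool_matrix_ext <;>
      simp [gateH, gateX, Matrix.mul_apply, Matrix.diagonal_apply, div_eq_mul_inv, h]
  have h1 : gateH * (Matrix.diagonal (fun b => if b then 1 else 0) * gateH) =
      (1 / 2 : ℂ) • (1 - gateX) := by
    have h := sqrt_two_inv_mul_self
    apply bool_matrix_ext <;>
      simp [gateH, gateX, Matrix.mul_apply, Matrix.diagonal_apply, div_eq_mul_inv, h]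
  rw [ctrl_eq, ← h0, ← h1, add_mul, mul_add, mul_assoc, ← (hP gateH).eq]
  simp only [onQubit_mul, mul_assoc]

/-- An operation on the work qubit between collecting and removing the eigenvalue bit. -/
theorem collect_sandwich {w : Q} {P : Op Q} (hP : ∀ C, Commute (onQubit w C) P) (hsq : P * P = 1)
    (f : Bool → ℂ) :
    (onQubit w ((1 / 2 : ℂ) • (1 + gateX)) + onQubit w ((1 / 2 : ℂ) • (1 - gateX)) * P) *
      (onQubit w (Matrix.diagonal f) *
      (onQubit w ((1 / 2 : ℂ) • (1 + gateX)) + onQubit w ((1 / 2 : ℂ) • (1 - gateX)) * P)) =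
    ((f false + f true) / 2) • 1 + ((f false - f true) / 2) • (onQubit w gateZ * P) := by
  set e := (1 / 2 : ℂ) • (1 + gateX) with he
  set e' := (1 / 2 : ℂ) • (1 - gateX) with he'
  set M := Matrix.diagonal f with hM
  have h1 : e * (M * e) + e' * (M * e') = ((f false + f true) / 2) • 1 := by
    apply bool_matrix_ext <;>
      simp [he, he', hM, gateX, Matrix.mul_apply, Matrix.diagonal_apply] <;> ring
  have h2 : e * (M * e') + e' * (M * e) = ((f false - f true) / 2) • gateZ := by
    apply bool_matrix_ext <;>
      simp [he, he', hM, gateX, gateZ, Matrix.mul_apply, Matrix.diagonal_apply] <;> ring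
  have h3 : ∀ A B : Matrix Bool Bool ℂ, onQubit w A * P * (onQubit w M * onQubit w B) =
      onQubit w (A * (M * B)) * P := fun A B => by
    rw [mul_assoc, ← onQubit_mul, ← (hP _).eq, ← mul_assoc, ← onQubit_mul]
  have h4 : ∀ A B : Matrix Bool Bool ℂ, onQubit w A * (onQubit w M * onQubit w B) =
      onQubit w (A * (M * B)) := fun A B => by
    rw [← onQubit_mul, ← onQubit_mul]
  have h5 : ∀ A B : Matrix Bool Bool ℂ, onQubit w A * (onQubit w M * (onQubit w B * P)) =
      onQubit w (A * (M * B)) * P := fun A B => by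
    rw [← h4]; simp only [mul_assoc]
  have h6 : ∀ A B : Matrix Bool Bool ℂ, onQubit w A * P * (onQubit w M * (onQubit w B * P)) =
      onQubit w (A * (M * B)) := fun A B => by
    rw [← mul_assoc (onQubit w M), ← mul_assoc, h3, mul_assoc, hsq, mul_one]
  rw [mul_add, mul_add, add_mul, add_mul, h4, h3, h5, h6]
  calc _ = onQubit w (e * (M * e) + e' * (M * e')) +
        onQubit w (e * (M * e') + e' * (M * e)) * P := by
          rw [onQubit_add, onQubit_add, add_mul]; abel
    _ = _ := by
      rw [h1, h2, onQubit_smul, onQubit_smul, onQubit_one, smul_mul_assoc]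

theorem onQubits_const_vecMulVec (w : Q) (b : Unit → Bool) :
    onQubits (fun _ : Unit => w) (Matrix.vecMulVec (ket fun _ => false) (ket b)) =
      onQubit w (Matrix.vecMulVec (ket false) (ket (b ()))) := by
  rw [onQubit_eq]
  congr 1
  ext x y
  have h1 : x = (fun _ => false) ↔ x () = false :=
    ⟨fun h => h ▸ rfl, fun h => funext fun _ => h⟩
  have h2 : y = b ↔ y () = b () := ⟨fun h => h ▸ rfl, fun h => funext fun _ => h⟩
  simp only [single, Matrix.of_apply, Matrix.vecMulVec_apply, ket, Pi.single_apply, h1, h2]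

/-- If `D` acts as `L` once the work qubit is in `|0⟩`, the gadget may be replaced by `L` before the
preparation. The work qubit then belongs to the residue. -/
theorem conjBy_prepare_ket {w : Q} {D L : Op Q}
    (h : ∀ b, D * onQubit w (Matrix.vecMulVec (ket false) (ket b)) =
      onQubit w (Matrix.vecMulVec (ket false) (ket b)) * L) (ρ : Op Q) :
    conjBy D (prepare (fun _ : Unit => w) (pureState (ket fun _ => false)) ρ) =
      prepare (fun _ : Unit => w) (pureState (ket fun _ => false)) (conjBy L ρ) := by
  rw [prepare_pureState (const_injective w), prepare_pureState (const_injective w), conjBy_sum]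
  refine Finset.sum_congr rfl fun b _ => ?_
  rw [conjBy_conjBy, conjBy_conjBy, onQubits_const_vecMulVec, h]

theorem runAll_four (a b c d : Chan Q) : runAll [a, b, c, d] = fun ρ => d (c (b (a ρ))) := rfl

theorem Realizes.after_prepare {S T : Set Q} (hST : S ⊆ T) {w : Q} (hw : w ∈ T) {c : Chan Q}
    {D L : Op Q} (hc : Realizes S c D)
    (h : ∀ b, D * onQubit w (Matrix.vecMulVec (ket false) (ket b)) =
      onQubit w (Matrix.vecMulVec (ket false) (ket b)) * L) :
    Realizes T (fun ρ => c (prepare (fun _ : Unit => w) (pureState (ket fun _ => false)) ρ)) L := by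
  obtain ⟨J, hJ, h1⟩ := hc
  have hk : KrausBy (Loc T) (prepare (fun _ : Unit => w) (pureState (ket fun _ => false))) :=
    KrausBy.prepare (const_injective w) (fun A => onQubits_mem_Loc (const_injective w)
      (fun _ => hw) A) (isDensity_ket _)
  refine ⟨fun ρ => J (prepare (fun _ : Unit => w) (pureState (ket fun _ => false)) ρ),
    hk.comp (hJ.mono (Loc_mono hST)), fun ρ => ?_⟩
  simp only [h1]
  rw [conjBy_prepare_ket h]

theorem gateZ_mul_vecMulVec (b : Bool) : gateZ * Matrix.vecMulVec (ket false) (ket b) =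
    Matrix.vecMulVec (ket false) (ket b) := by
  ext i j; cases i <;> simp [gateZ, Matrix.vecMulVec_apply, ket]

end Gadgets

/-! ### Operations of the network -/

section NetworkOps

variable {n t : ℕ} (π : Placement n t)

/-- The communication qubits of the master and the leaves. -/
def linkQubits (n t : ℕ) : Set (Qubit n t) :=
  {q | (∃ b, q = .hub b) ∨ ∃ l, q = .comm l}

/-- The communication and work qubits. -/
def helperQubits (n t : ℕ) : Set (Qubit n t) := linkQubits n t ∪ {q | ∃ l, q = .work l}

theorem code_notMem_helperQubits (b : Bool) (l : Fin (n + t)) :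
    Qubit.code b l ∉ helperQubits n t := by
  simp [helperQubits, linkQubits]

theorem linkQubits_subset : linkQubits n t ⊆ helperQubits n t := Set.subset_union_left

theorem code_notMem_linkQubits (b : Bool) (l : Fin (n + t)) : Qubit.code b l ∉ linkQubits n t :=
  fun h => code_notMem_helperQubits b l (linkQubits_subset h)

theorem codeQubit_injective (b : Bool) : Function.Injective (codeQubit π b) := fun i j h => by
  simpa [codeQubit] using h

theorem trapQubit_injective : Function.Injective (trapQubit π) := fun i j h => by
  simpa [trapQubit] using h

theorem codeQubit_ne_trapQubit (b : Bool) (j : Fin n) (i : Fin t) :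
    codeQubit π b j ≠ trapQubit π i := by
  simp [codeQubit, trapQubit]

theorem realizes_distributedCU {lA lC : Fin (n + t)} (hl : lA ≠ lC) {c q : Qubit n t} (hcq : c ≠ q)
    (hc : c ∉ linkQubits n t) (hq : q ∉ linkQubits n t) (A : Matrix Bool Bool ℂ) :
    Realizes (linkQubits n t) (distributedCU lA lC c q A) (ctrl c (onQubit q A)) := by
  have hhub : ∀ b, Qubit.hub b ∈ linkQubits n t := fun b => Or.inl ⟨b, rfl⟩
  have hcomm : ∀ l, Qubit.comm l ∈ linkQubits n t := fun l => Or.inr ⟨l, rfl⟩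
  refine realizes_swap_scst (by simp) (by simpa using hl) (by simp) (by simp) (by simp) (by simp)
    ?_ ?_ hcq ?_ ?_ ?_ ?_ ?_ ?_ (hcomm _) (hhub _) (hcomm _) (hhub _) A
  all_goals rintro rfl
  all_goals first
    | exact hc (hcomm _) | exact hc (hhub _) | exact hq (hcomm _) | exact hq (hhub _)

theorem realizes_ctrlPauliFrom (A : Fin n) (b : Bool) (P : PauliString n) :
    Realizes (linkQubits n t) (ctrlPauliFrom π A b P)
      (ctrl (.work (π (.inl A))) (onQubits (codeQubit π b) P.mat)) := by
  have hw : Qubit.work (π (.inl A)) ∉ linkQubits n t := by simp [linkQubits]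
  refine realizes_ctrlPauli (codeQubit_injective π b) hw (fun j => code_notMem_linkQubits _ _)
    (fun j => by simp [codeQubit]) P fun j B => ?_
  -- A letter at the node holding the work qubit is applied locally, since the distributed version
  -- requires two different leaves.
  split_ifs with hj
  · exact Realizes.conjBy _ _
  · exact realizes_distributedCU (by simpa [eq_comm] using hj) (by simp) hw
      (code_notMem_linkQubits _ _) B

theorem realizes_collect (A : Fin n) (b : Bool) (P : PauliString n) :
    Realizes (linkQubits n t) (collect π A b P)
      (onQubit (.work (π (.inl A))) ((1 / 2 : ℂ) • (1 + gateX)) +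
        onQubit (.work (π (.inl A))) ((1 / 2 : ℂ) • (1 - gateX)) *
          onQubits (codeQubit π b) P.mat) := by
  have hw : Qubit.work (π (.inl A)) ∉ linkQubits n t := by simp [linkQubits]
  rw [← hadamard_ctrl_hadamard fun C => commute_onQubit_onQubits (codeQubit_injective π b)
    (fun j => by simp [codeQubit]) _ C]
  exact ((Realizes.conjBy _ _).comp (realizes_ctrlPauliFrom π A b P)
    (ctrl_mem (fun B => onQubit_mem_Off hw B) (onQubits_mem_Off (codeQubit_injective π b)
      (fun j => code_notMem_linkQubits _ _) _))).comp (Realizes.conjBy _ _) (onQubit_mem_Off hw _)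

/-- The qubits of a family of blocks. -/
def blockQubit {β : Type} (blk : β → Bool) (p : β × Fin n) : Qubit n t := codeQubit π (blk p.1) p.2

theorem blockQubit_injective {β : Type} {blk : β → Bool} (hblk : Function.Injective blk) :
    Function.Injective (blockQubit (t := t) π blk) := fun p q h => by
  simp only [blockQubit, codeQubit, Qubit.code.injEq, EmbeddingLike.apply_eq_iff_eq,
    Sum.inl.injEq] at h
  exact Prod.ext (hblk h.1) h.2

theorem onQubits_blockQubit {β : Type} [Fintype β] [DecidableEq β] {blk : β → Bool}
    (hblk : Function.Injective blk) (b : β) (A : Op (Fin n)) :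
    onQubits (blockQubit (t := t) π blk) (onQubits (fun j => (b, j)) A) =
      onQubits (codeQubit π (blk b)) A := by
  rw [onQubits_comp (blockQubit_injective π hblk)]
  rfl

/-- `collect_sandwich` with the diagonal `(1, i)` gives `(1 + i)/2 + (1 - i)/2 · Z_w P`, and `Z_w`
is trivial on the freshly prepared work qubit. -/
theorem realizes_phase (A : Fin n) (b : Bool) (P : PauliString n) :
    Realizes (helperQubits n t) (runAll
        [ prepare (fun _ : Unit => Qubit.work (π (.inl A))) (pureState (ket fun _ => false)),
          collect π A b P,
          conjBy (onQubit (.work (π (.inl A))) gateS),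
          collect π A b P ])
      (onQubits (codeQubit π b) (((1 + Complex.I) / 2) • 1 + ((1 - Complex.I) / 2) • P.mat)) := by
  have hinj := codeQubit_injective (t := t) π b
  have hoff : ∀ A, onQubits (codeQubit π b) A ∈ Off (linkQubits n t) :=
    onQubits_mem_Off hinj (fun j => code_notMem_linkQubits _ _)
  have hw : Qubit.work (π (.inl A)) ∉ linkQubits n t := by simp [linkQubits]
  have hcomm : ∀ C, Commute (onQubit (.work (π (.inl A))) C) (onQubits (codeQubit π b) P.mat) :=
    commute_onQubit_onQubits hinj (fun j => by simp [codeQubit]) _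
  have hS : Realizes (linkQubits n t) (conjBy (onQubit (.work (π (.inl A))) gateS))
      (onQubit (.work (π (.inl A))) gateS) := Realizes.conjBy _ _
  have hcoll := realizes_collect π A b P
  have hSoff := onQubit_mem_Off hw gateS
  have hoff' := add_mem (onQubit_mem_Off hw ((1 / 2 : ℂ) • (1 + gateX)))
    (mul_mem (onQubit_mem_Off hw ((1 / 2 : ℂ) • (1 - gateX))) (hoff P.mat))
  have h0 := hcoll.comp hS hSoff
  have h1 := h0.comp hcoll hoff'
  have hsq : onQubits (codeQubit π b) P.mat * onQubits (codeQubit (t := t) π b) P.mat = 1 := by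
    rw [← onQubits_mul hinj, P.mat_mul_self, onQubits_one]
  have h2 := collect_sandwich hcomm hsq (fun b => if b then Complex.I else 1)
  rw [← gateS] at h2
  rw [h2] at h1
  rw [runAll_four]
  refine h1.after_prepare linkQubits_subset (Or.inr ⟨_, rfl⟩) fun b' => ?_
  simp only [Bool.false_eq_true, if_false, if_true]
  rw [onQubits_add, onQubits_smul, onQubits_smul, onQubits_one, add_mul, mul_add, smul_mul_assoc,
    smul_mul_assoc, mul_smul_comm, mul_smul_comm, one_mul, mul_one, (hcomm gateZ).eq, mul_assoc,
    ← onQubit_mul, gateZ_mul_vecMulVec, (hcomm _).eq]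

/-- After collecting, controlling and uncomputing, the block operator is the polynomial `(1 + P + P'
- P P')/2`, which is controlled-`Z` with `Z` replaced by commuting involutions. -/
theorem realizes_cz (A : Fin n) (b b' : Bool) (P P' : PauliString n)
    (hPP : Commute (onQubits (codeQubit (t := t) π b) P.mat) (onQubits (codeQubit π b') P'.mat)) :
    Realizes (helperQubits n t) (runAll
        [ prepare (fun _ : Unit => Qubit.work (π (.inl A))) (pureState (ket fun _ => false)),
          collect π A b P,
          ctrlPauliFrom π A b' P',
          collect π A b P ])
      ((1 / 2 : ℂ) • (1 + onQubits (codeQubit π b) P.mat + onQubits (codeQubit π b') P'.mat -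
        onQubits (codeQubit π b) P.mat * onQubits (codeQubit π b') P'.mat)) := by
  have hinj := fun b => codeQubit_injective (t := t) π b
  have hoff : ∀ b A, onQubits (codeQubit π b) A ∈ Off (linkQubits n t) := fun b =>
    onQubits_mem_Off (hinj b) (fun j => code_notMem_linkQubits _ _)
  have hw : Qubit.work (π (.inl A)) ∉ linkQubits n t := by simp [linkQubits]
  have hcomm : ∀ b (P : PauliString n) C,
      Commute (onQubit (.work (π (.inl A))) C) (onQubits (codeQubit π b) P.mat) := fun b P =>
    commute_onQubit_onQubits (hinj b) (fun j => by simp [codeQubit]) _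
  have h1 := ((realizes_collect π A b P).comp (realizes_ctrlPauliFrom π A b' P')
    (ctrl_mem (onQubit_mem_Off hw) (hoff _ _))).comp (realizes_collect π A b P)
    (add_mem (onQubit_mem_Off hw _) (mul_mem (onQubit_mem_Off hw _) (hoff _ _)))
  have hsq : onQubits (codeQubit π b) P.mat * onQubits (codeQubit (t := t) π b) P.mat = 1 := by
    rw [← onQubits_mul (hinj b), P.mat_mul_self, onQubits_one]
  -- The controlled operator splits along the two projectors of the work qubit, and each term is a
  -- sandwich with a diagonal matrix.
  have h2 := collect_sandwich (hcomm b P) hsq (fun b => if b then 0 else 1)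
  have h3 := collect_sandwich (hcomm b P) hsq (fun b => if b then 1 else 0)
  set w := Qubit.work (t := t) (π (.inl A))
  set R := onQubits (codeQubit π b) P.mat
  set R' := onQubits (codeQubit π b') P'.mat
  set E := onQubit w ((1 / 2 : ℂ) • (1 + gateX)) + onQubit w ((1 / 2 : ℂ) • (1 - gateX)) * R
  -- The target operator passes through the uncomputing step because the two Pauli operators
  -- commute, even on the same block.
  have hE : Commute R' E := ((hcomm b' P' _).symm.add_right
    ((hcomm b' P' _).symm.mul_right hPP.symm))
  clear_value E
  have h4 : E * (ctrl w R' * E) = (1 / 2 : ℂ) • (1 + onQubit w gateZ * R + R' -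
      onQubit w gateZ * R * R') := by
    rw [ctrl_eq, add_mul, mul_add, h2, mul_assoc _ R' E, hE.eq, ← mul_assoc _ E R',
      ← mul_assoc E, h3]
    simp only [Bool.false_eq_true, if_false, if_true]
    rw [add_mul, smul_mul_assoc, smul_mul_assoc, one_mul]
    module
  rw [h4] at h1
  rw [runAll_four]
  refine h1.after_prepare linkQubits_subset (Or.inr ⟨_, rfl⟩) fun b'' => ?_
  set K := onQubit w (Matrix.vecMulVec (ket false) (ket b''))
  have hK : onQubit w gateZ * K = K := by rw [← onQubit_mul, gateZ_mul_vecMulVec]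
  have hRK : R * K = K * R := (hcomm b P _).eq.symm
  have hRK' : R' * K = K * R' := (hcomm b' P' _).eq.symm
  have h5 : onQubit w gateZ * R * K = K * R := by
    rw [mul_assoc, hRK, ← mul_assoc, hK]
  have h6 : onQubit w gateZ * R * R' * K = K * (R * R') := by
    rw [mul_assoc _ R', hRK', ← mul_assoc, h5, mul_assoc]
  rw [smul_mul_assoc, mul_smul_comm, sub_mul, add_mul, add_mul, mul_sub, mul_add, mul_add, h5, h6,
    hRK', one_mul, mul_one]

end NetworkOps

/-! ### Gate implementations -/

section Impl

variable {β : Type} [Fintype β] [DecidableEq β] {r k : ℕ} (code : StabilizerCode r k)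

theorem onQubit_block (b : β) (a : Fin k) (A : Matrix Bool Bool ℂ) :
    onQubits (fun a => (b, a)) (onQubit a A) = onQubit (b, a) A :=
  onQubits_onQubit (StabilizerCode.block_injective b) a A

theorem zbar_mul_encBlocks (b : β) (a : Fin k) :
    onQubits (fun j => (b, j)) (code.zbar a).mat * code.encBlocks β =
      code.encBlocks β * onQubit (b, a) gateZ := by
  rw [code.encBlocks_intertwine b (code.zbar_mul_enc a), onQubit_block]

theorem xbar_mul_encBlocks (b : β) (a : Fin k) :
    onQubits (fun j => (b, j)) (code.xbar a).mat * code.encBlocks β =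
      code.encBlocks β * onQubit (b, a) gateX := by
  rw [code.encBlocks_intertwine b (code.xbar_mul_enc a), onQubit_block]

theorem gateS_eq : gateS = ((1 + Complex.I) / 2) • 1 + ((1 - Complex.I) / 2) • gateZ := by
  apply bool_matrix_ext <;> simp [gateS, gateZ] <;> ring

theorem gateH_gateS_gateH :
    gateH * gateS * gateH = ((1 + Complex.I) / 2) • 1 + ((1 - Complex.I) / 2) • gateX := by
  rw [gateS_eq, mul_add, add_mul, mul_smul_comm, mul_smul_comm, smul_mul_assoc, smul_mul_assoc,
    mul_one, gateH_mul_self, gateH_mul_gateZ, mul_assoc, gateH_mul_self, mul_one]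

theorem phase_unitary {m : Type} [Fintype m] [DecidableEq m] {P : Matrix m m ℂ} (hP : P * P = 1)
    (hP' : Pᴴ = P) :
    (((1 + Complex.I) / 2) • 1 + ((1 - Complex.I) / 2) • P)ᴴ *
      (((1 + Complex.I) / 2) • 1 + ((1 - Complex.I) / 2) • P) = 1 := by
  rw [Matrix.conjTranspose_add, Matrix.conjTranspose_smul, Matrix.conjTranspose_smul, hP',
    Matrix.conjTranspose_one, add_mul, mul_add, mul_add]
  simp only [smul_mul_smul_comm, one_mul, mul_one, hP]
  have h1 : star ((1 + Complex.I) / 2) * ((1 + Complex.I) / 2) = 1 / 2 := by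
    simp only [Complex.star_def, map_div₀, map_add, map_one, Complex.conj_I, map_ofNat]
    linear_combination (-1 / 4 : ℂ) * Complex.I_mul_I
  have h2 : star ((1 - Complex.I) / 2) * ((1 - Complex.I) / 2) = 1 / 2 := by
    simp only [Complex.star_def, map_div₀, map_sub, map_one, Complex.conj_I, map_ofNat]
    linear_combination (-1 / 4 : ℂ) * Complex.I_mul_I
  have h3 : star ((1 + Complex.I) / 2) * ((1 - Complex.I) / 2) = -Complex.I / 2 := by
    simp only [Complex.star_def, map_div₀, map_add, map_one, Complex.conj_I, map_ofNat]
    linear_combination (1 / 4 : ℂ) * Complex.I_mul_I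
  have h4 : star ((1 - Complex.I) / 2) * ((1 + Complex.I) / 2) = Complex.I / 2 := by
    simp only [Complex.star_def, map_div₀, map_sub, map_one, Complex.conj_I, map_ofNat]
    linear_combination (1 / 4 : ℂ) * Complex.I_mul_I
  rw [h1, h2, h3, h4]
  module

theorem cz_unitary {m : Type} [Fintype m] [DecidableEq m] {P P' : Matrix m m ℂ} (hP : P * P = 1)
    (hP' : P' * P' = 1) (hPh : Pᴴ = P) (hPh' : P'ᴴ = P') (hc : Commute P P') :
    ((1 / 2 : ℂ) • (1 + P + P' - P * P'))ᴴ * ((1 / 2 : ℂ) • (1 + P + P' - P * P')) = 1 := by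
  have h1 : (1 + P + P' - P * P')ᴴ = 1 + P + P' - P * P' := by
    simp [Matrix.conjTranspose_mul, hPh, hPh', hc.eq]
  have h2 : (1 + P + P' - P * P') * (1 + P + P' - P * P') = (4 : ℂ) • 1 := by
    have e1 : P * P' * P = P' := by rw [hc.eq, mul_assoc, hP, mul_one]
    have e2 : P * P' * P' = P := by rw [mul_assoc, hP', mul_one]
    have e3 : P * (P * P') = P' := by rw [← mul_assoc, hP, one_mul]
    have e4 : P' * (P * P') = P := by rw [← mul_assoc, ← hc.eq, e2]
    have e5 : P * P' * (P * P') = 1 := by rw [← mul_assoc, e1, hP']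
    simp only [mul_add, add_mul, mul_sub, sub_mul, one_mul, mul_one, hP, hP', e1, e2, e3, e4, e5,
      ← hc.eq]
    module
  rw [Matrix.conjTranspose_smul, h1, smul_mul_smul_comm, h2, smul_smul]
  norm_num

/-- The same polynomial as the one realized by the gadget, so intertwining each `Z̄` with its `Z`
transfers to the gate. -/
theorem ctrl_gateZ_eq {Q : Type} [Fintype Q] [DecidableEq Q] (c q : Q) :
    ctrl c (onQubit q gateZ) = (1 / 2 : ℂ) •
      (1 + onQubit c gateZ + onQubit q gateZ - onQubit c gateZ * onQubit q gateZ) := by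
  have h0 : (Matrix.diagonal fun b => if b then 0 else 1 : Matrix Bool Bool ℂ) =
      (1 / 2 : ℂ) • (1 + gateZ) := by
    apply bool_matrix_ext <;> simp [gateZ]; norm_num
  have h1 : (Matrix.diagonal fun b => if b then 1 else 0 : Matrix Bool Bool ℂ) =
      (1 / 2 : ℂ) • (1 + (-1 : ℂ) • gateZ) := by
    apply bool_matrix_ext <;> simp [gateZ]; norm_num
  rw [ctrl_eq, h0, h1, onQubit_smul, onQubit_smul, onQubit_add, onQubit_add, onQubit_smul,
    onQubit_one, smul_mul_assoc, add_mul, one_mul, smul_mul_assoc]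
  module

/-- The operator is a tensor product over nodes, although configurations are written by block and
node; the sum over configurations factors node by node. -/
theorem transversalMat_unitary {n : ℕ} {V : Fin n → Matrix (β → Bool) (β → Bool) ℂ}
    (hV : ∀ j, V j ∈ Matrix.unitaryGroup (β → Bool) ℂ) :
    (Impl.transversalMat V)ᴴ * Impl.transversalMat V = 1 := by
  ext x y
  have hV' : ∀ j, (V j)ᴴ * V j = 1 := fun j => Matrix.mem_unitaryGroup_iff'.1 (hV j)
  simp only [Matrix.mul_apply, Matrix.conjTranspose_apply, Impl.transversalMat, Matrix.of_apply,
    star_prod, ← Finset.prod_mul_distrib]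
  let E : (Fin n → β → Bool) ≃ (β × Fin n → Bool) :=
    (Equiv.curry _ _ _).symm.trans (Equiv.arrowCongr (Equiv.prodComm _ _) (Equiv.refl _))
  rw [← E.sum_comp]
  have h1 : ∀ (z : Fin n → β → Bool) (j : Fin n), (fun b => E z (b, j)) = z j := fun z j => rfl
  simp only [h1]
  have h2 : ∀ j, ∑ d, star (V j d fun b => x (b, j)) * V j d (fun b => y (b, j)) =
      if (fun b => x (b, j)) = (fun b => y (b, j)) then 1 else 0 := fun j => by
    have := congrFun (congrFun (hV' j) fun b => x (b, j)) fun b => y (b, j)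
    simpa only [Matrix.mul_apply, Matrix.conjTranspose_apply, Matrix.one_apply] using this
  rw [← Fintype.piFinset_univ, ← Finset.prod_univ_sum
    (fun _ => Finset.univ) fun j d => star (V j d fun b => x (b, j)) * V j d (fun b => y (b, j))]
  simp only [h2, Matrix.one_apply]
  by_cases h : x = y
  · subst h; simp
  · rw [if_neg h]
    obtain ⟨⟨b, j⟩, hbj⟩ := Function.ne_iff.1 h
    exact Finset.prod_eq_zero (Finset.mem_univ j) (if_neg fun h => hbj (congrFun h b))

/-- An implementation of a logical gate acts on the blocks as a unitary that is intertwined with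
the gate by the encoding. -/
theorem Impl.exists_realizes {t : ℕ} (π : Placement (r + k) t) {blk : β → Bool}
    (hblk : Function.Injective blk) (p : Impl β (r + k) k) {W : Op (β × Fin k)}
    (h : p.For code W) :
    ∃ L : Op (β × Fin (r + k)), Lᴴ * L = 1 ∧
      (∃ c : ℂ, ‖c‖ = 1 ∧ L * code.encBlocks β = c • (code.encBlocks β * W)) ∧
      Realizes (helperQubits (r + k) t) (p.exec code π blk) (onQubits (blockQubit π blk) L) := by
  induction p generalizing W with
  | transversal V => exact ⟨_, transversalMat_unitary h.1, h.2, Realizes.conjBy _ _⟩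
  | phase b a isX =>
    set P := if isX then code.xbar a else code.zbar a with hP
    have hinj := StabilizerCode.block_injective (n := r + k) b
    refine ⟨onQubits (fun j => (b, j)) (((1 + Complex.I) / 2) • 1 + ((1 - Complex.I) / 2) • P.mat),
      ?_, ⟨1, by simp, ?_⟩, ?_⟩
    · rw [← onQubits_conjTranspose, ← onQubits_mul hinj,
        phase_unitary P.mat_mul_self P.mat_conjTranspose, onQubits_one]
    · rw [onQubits_add, onQubits_smul, onQubits_smul, onQubits_one, Matrix.add_mul, Matrix.smul_mul,
        Matrix.smul_mul, Matrix.one_mul, one_smul]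
      change W = _ at h
      rw [h, hP]
      cases isX
      · simp only [Bool.false_eq_true, if_false]
        rw [zbar_mul_encBlocks, gateS_eq, onQubit_add, onQubit_smul, onQubit_smul, onQubit_one,
          Matrix.mul_add, Matrix.mul_smul, Matrix.mul_smul, Matrix.mul_one]
      · simp only [if_true]
        rw [xbar_mul_encBlocks, gateH_gateS_gateH, onQubit_add, onQubit_smul, onQubit_smul,
          onQubit_one, Matrix.mul_add, Matrix.mul_smul, Matrix.mul_smul, Matrix.mul_one]
    · rw [onQubits_blockQubit π hblk]
      exact realizes_phase π (Fin.natAdd r a) (blk b) P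
  | cz b a b' a' =>
    obtain ⟨hne, rfl⟩ := h
    have hinj := fun b : β => StabilizerCode.block_injective (n := r + k) b
    have hemb := blockQubit_injective (t := t) (n := r + k) π hblk
    have hcomm : Commute (onQubits (fun j => (b, j)) (code.zbar a).mat)
        (onQubits (fun j => (b', j)) (code.zbar a').mat) := by
      by_cases hb : b = b'
      · subst hb
        have := (PauliString.mat_commute (code.zbar_comm a a')).eq
        rw [Commute, SemiconjBy, ← onQubits_mul (hinj b), this, onQubits_mul (hinj b)]
      · exact onQubits_commute (hinj b) (hinj b') (fun i j h => hb (Prod.ext_iff.1 h).1) _ _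
    have hsq : ∀ b a, onQubits (fun j => ((b : β), j)) (code.zbar a).mat *
        onQubits (fun j => (b, j)) (code.zbar a).mat = 1 := fun b a => by
      rw [← onQubits_mul (hinj b), PauliString.mat_mul_self, onQubits_one]
    have hh : ∀ b a, (onQubits (fun j => ((b : β), j)) (code.zbar a).mat)ᴴ =
        onQubits (fun j => (b, j)) (code.zbar a).mat := fun b a => by
      rw [← onQubits_conjTranspose, PauliString.mat_conjTranspose]
    refine ⟨_, cz_unitary (hsq b a) (hsq b' a') (hh b a) (hh b' a') hcomm, ⟨1, by simp, ?_⟩, ?_⟩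
    · rw [ctrl_gateZ_eq, one_smul, Matrix.smul_mul, Matrix.mul_smul, Matrix.sub_mul,
        Matrix.add_mul, Matrix.add_mul, Matrix.mul_sub, Matrix.mul_add, Matrix.mul_add,
        Matrix.mul_assoc (onQubits _ _), zbar_mul_encBlocks, zbar_mul_encBlocks,
        ← Matrix.mul_assoc (onQubits _ _), zbar_mul_encBlocks, Matrix.one_mul, Matrix.mul_one,
        Matrix.mul_assoc]
    · rw [onQubits_smul, onQubits_sub, onQubits_add, onQubits_add, onQubits_one,
        onQubits_mul hemb, onQubits_blockQubit π hblk, onQubits_blockQubit π hblk]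
      refine realizes_cz π (Fin.natAdd r a) (blk b) (blk b') (code.zbar a) (code.zbar a') ?_
      rw [← onQubits_blockQubit π hblk, ← onQubits_blockQubit π hblk, Commute, SemiconjBy,
        ← onQubits_mul hemb, hcomm.eq, onQubits_mul hemb]
  | seq p q ihp ihq =>
    obtain ⟨W₁, W₂, h1, h2, c, hc, rfl⟩ := h
    obtain ⟨L₁, hL₁, ⟨c₁, hc₁, e₁⟩, r₁⟩ := ihp h1
    obtain ⟨L₂, hL₂, ⟨c₂, hc₂, e₂⟩, r₂⟩ := ihq h2
    have hc0 : c ≠ 0 := fun h => by simp [h] at hc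
    -- The inverse of `c` appears because `W` carries the phase `c` relative to `W₂ * W₁`.
    refine ⟨L₂ * L₁, ?_, ⟨c₁ * c₂ * c⁻¹, by simp [hc, hc₁, hc₂], ?_⟩, ?_⟩
    · rw [Matrix.conjTranspose_mul, mul_assoc, ← mul_assoc _ L₂, hL₂, one_mul, hL₁]
    · rw [Matrix.mul_assoc, e₁, Matrix.mul_smul, ← Matrix.mul_assoc, e₂, Matrix.mul_smul,
        Matrix.smul_mul, smul_smul, smul_smul, Matrix.mul_assoc]
      congr 1
      field_simp
    · rw [onQubits_mul (blockQubit_injective π hblk)]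
      have hoff : onQubits (blockQubit (t := t) π blk) L₂ ∈ Off (helperQubits (r + k) t) :=
        onQubits_mem_Off (blockQubit_injective π hblk) (fun j => code_notMem_helperQubits _ _) _
      exact r₁.comp r₂ hoff

end Impl

end Implementations

/-! ### Gate implementations valid for every code -/

section Library

set_option linter.unusedSectionVars false
set_option linter.unusedDecidableInType false
set_option linter.unusedFintypeInType false

variable {β : Type} [Fintype β] [DecidableEq β] {r k : ℕ} (code : StabilizerCode r k)

/-- A Hadamard gate composed of phase gadgets. -/
def hadamardImpl (n : ℕ) (b : β) (a : Fin k) : Impl β n k :=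
  .seq (.phase b a false) (.seq (.phase b a true) (.phase b a false))

theorem norm_eighth_root : ‖(1 - Complex.I) * (Real.sqrt 2 : ℂ)⁻¹‖ = 1 := by
  have h : ‖(1 - Complex.I) * (Real.sqrt 2 : ℂ)⁻¹‖ ^ 2 = 1 := by
    rw [← Complex.normSq_eq_norm_sq, Complex.normSq_mul, Complex.normSq_inv, Complex.normSq_ofReal,
      Real.mul_self_sqrt (by norm_num)]
    norm_num [Complex.normSq_apply]
  nlinarith [norm_nonneg ((1 - Complex.I) * (Real.sqrt 2 : ℂ)⁻¹)]

/-- The Euler decomposition of the Hadamard gate into quarter turns about `Z`, `X`, `Z`, with phase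
`e^{-iπ/4} = (1 - i)/√2`. -/
theorem gateH_eq : gateH = ((1 - Complex.I) * (Real.sqrt 2 : ℂ)⁻¹) •
    (gateS * (gateH * gateS * gateH) * gateS) := by
  rw [gateH_gateS_gateH]
  have hI := Complex.I_mul_I
  apply bool_matrix_ext <;>
    simp [gateH, gateS, gateX, Matrix.mul_apply, div_eq_mul_inv]
  · linear_combination (1 / 2 : ℂ) * (Real.sqrt 2 : ℂ)⁻¹ * hI
  · linear_combination (1 / 2 : ℂ) * (2 - Complex.I) * (Real.sqrt 2 : ℂ)⁻¹ * hI
  · linear_combination (1 / 2 : ℂ) * (2 - Complex.I) * (Real.sqrt 2 : ℂ)⁻¹ * hI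
  · linear_combination ((1 / 2) * (1 - Complex.I * Complex.I) + (Complex.I * Complex.I - 3 / 2)) * (Real.sqrt 2 : ℂ)⁻¹ * hI

theorem hadamardImpl_for (b : β) (a : Fin k) :
    (hadamardImpl (r + k) b a).For code (onQubit (b, a) gateH) := by
  refine ⟨onQubit (b, a) gateS, onQubit (b, a) (gateS * (gateH * gateS * gateH)), rfl, ?_,
    _, norm_eighth_root, ?_⟩
  · exact ⟨onQubit (b, a) (gateH * gateS * gateH), onQubit (b, a) gateS, rfl, rfl, 1, by simp,
      by rw [one_smul, onQubit_mul]⟩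
  · rw [← onQubit_mul, ← onQubit_smul, ← gateH_eq]

theorem hadamard_cz_hadamard {Q : Type} [Fintype Q] [DecidableEq Q] {c q : Q} (h : c ≠ q) :
    onQubit q gateH * ctrl c (onQubit q gateZ) * onQubit q gateH = ctrl c (onQubit q gateX) := by
  rw [ctrl_eq, ctrl_eq, mul_add, add_mul, ← mul_assoc, onQubit_commute h.symm,
    onQubit_commute h.symm, mul_assoc, ← onQubit_mul, gateH_mul_self, onQubit_one, mul_one,
    mul_assoc (onQubit c _), ← onQubit_mul, gateH_mul_gateZ, mul_assoc, ← onQubit_mul, mul_assoc,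
    gateH_mul_self, mul_one]

theorem cnotImpl_for {b b' : β} {a a' : Fin k} (h : (b, a) ≠ (b', a')) :
    (Impl.seq (hadamardImpl (r + k) b' a') (.seq (.cz b a b' a') (hadamardImpl (r + k) b' a'))).For
      code (ctrl (b, a) (onQubit (b', a') gateX)) := by
  refine ⟨onQubit (b', a') gateH,
    onQubit (b', a') gateH * ctrl (b, a) (onQubit (b', a') gateZ), hadamardImpl_for code _ _,
    ⟨ctrl (b, a) (onQubit (b', a') gateZ), onQubit (b', a') gateH, ⟨h, rfl⟩,
      hadamardImpl_for code _ _, 1, by simp, by rw [one_smul]⟩, 1, by simp, ?_⟩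
  rw [one_smul, hadamard_cz_hadamard h]

/-- Phase and controlled-`Z` gadgets exist for any stabilizer code and generate all required gates,
so no transversal gate is needed. -/
theorem exists_gateLibrary : ∃ lib : GateLibrary r k, lib.Valid code :=
  ⟨{ h := fun a => hadamardImpl _ () a
     s := fun a => .phase () a false
     cnot := fun a a' => .seq (hadamardImpl _ () a') (.seq (.cz () a () a') (hadamardImpl _ () a'))
     inject := fun a =>
      .seq (hadamardImpl _ true a) (.seq (.cz false a true a) (hadamardImpl _ true a)) },
    { h := fun a => hadamardImpl_for code _ a
      s := fun _ => rfl
      cnot := fun a a' h => cnotImpl_for code (by simpa using h)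
      inject := fun a => cnotImpl_for code (by simp) }⟩

end Library

section States

set_option linter.unusedSectionVars false
set_option linter.unusedDecidableInType false
set_option linter.unusedFintypeInType false

/-! ### Action of implementations on encoded states -/

theorem pureState_smul {m : Type} (c : ℂ) (hc : ‖c‖ = 1) (v : m → ℂ) :
    pureState (c • v) = pureState v := by
  have h : c * star c = 1 := by
    rw [Complex.star_def, Complex.mul_conj, Complex.normSq_eq_norm_sq, hc]; simp
  ext i j
  simp only [pureState, Matrix.vecMulVec_apply, Pi.smul_apply, Pi.star_apply, smul_eq_mul,
    star_mul']
  linear_combination (v i * star (v j)) * h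

theorem onQubits_mulVec_apply {Q ι : Type} [Fintype Q] [DecidableEq Q] [Fintype ι] [DecidableEq ι]
    {e : ι → Q} (he : Function.Injective e) (A : Op ι) (f : (Q → Bool) → ℂ) (x : Q → Bool) :
    (onQubits e A *ᵥ f) x = ∑ d : ι → Bool, A (fun i => x (e i)) d * f (Function.extend e d x) := by
  have := onQubits_mul_apply he A (Matrix.replicateCol Unit f) x ()
  rwa [← Matrix.replicateCol_mulVec] at this

variable {r k t : ℕ} (code : StabilizerCode r k) (π : Placement (r + k) t)

/-- The unitary of the implementation carries the encoded vector to the encoding of the image up to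
a phase, invisible in the projector; the residue on the helper qubits preserves the identity. -/
theorem Impl.exec_mul {β : Type} [Fintype β] [DecidableEq β] {blk : β → Bool}
    (hblk : Function.Injective blk) {p : Impl β (r + k) k} {W : Op (β × Fin k)} (h : p.For code W)
    {φ : (β × Fin k → Bool) → ℂ} {ρ : Op (Qubit (r + k) t)}
    (hρ : onQubits (blockQubit π blk) (pureState (code.encBlocks β *ᵥ φ)) * ρ = ρ) :
    onQubits (blockQubit π blk) (pureState (code.encBlocks β *ᵥ (W *ᵥ φ))) *
      p.exec code π blk ρ = p.exec code π blk ρ := by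
  obtain ⟨L, hL, ⟨c, hc, hLW⟩, hr⟩ := p.exists_realizes code π hblk h
  have hinj := blockQubit_injective (t := t) π hblk
  refine hr.mul_eq (onQubits_mem_Off hinj (fun j => code_notMem_helperQubits _ _) _) ?_ hρ
  rw [← onQubits_mul hinj, ← onQubits_mul hinj]
  congr 1
  have h1 : L *ᵥ (code.encBlocks β *ᵥ φ) = c • (code.encBlocks β *ᵥ (W *ᵥ φ)) := by
    rw [Matrix.mulVec_mulVec, hLW, Matrix.smul_mulVec, Matrix.mulVec_mulVec]
  rw [← pureState_smul c hc, ← h1, ← mul_pureState, mul_assoc, hL, mul_one]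

/-- A vector on one block, seen as a vector on the family of blocks indexed by `Unit`. -/
def unitVec {κ : Type} (v : (κ → Bool) → ℂ) : (Unit × κ → Bool) → ℂ := fun x => v fun a => x ((), a)

/-- The equivalence underlying `unitVec`. -/
def unitEquiv (κ : Type) : (κ → Bool) ≃ (Unit × κ → Bool) :=
  Equiv.arrowCongr (Equiv.punitProd κ).symm (Equiv.refl Bool)

theorem unit_pureState {κ : Type} [Fintype κ] [DecidableEq κ] (v : (κ → Bool) → ℂ) :
    pureState (unitVec v) = onQubits (fun j : κ => ((), j)) (pureState v) := by
  ext x y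
  simp only [onQubits, Matrix.of_apply]
  rw [if_pos]
  · rfl
  · rintro ⟨_, j⟩ h; exact absurd rfl (h j)

theorem encBlocks_mulVec_unitVec (φ : (Fin k → Bool) → ℂ) :
    code.encBlocks Unit *ᵥ unitVec φ = unitVec (code.enc *ᵥ φ) := by
  funext x
  simp only [Matrix.mulVec, dotProduct, unitVec]
  rw [← (unitEquiv (Fin k)).sum_comp]
  refine Finset.sum_congr rfl fun y _ => ?_
  simp [StabilizerCode.encBlocks, unitEquiv]

theorem onQubits_mulVec_unitVec {κ : Type} [Fintype κ] [DecidableEq κ] (A : Op κ)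
    (φ : (κ → Bool) → ℂ) :
    onQubits (fun a : κ => ((), a)) A *ᵥ unitVec φ = unitVec (A *ᵥ φ) := by
  have hinj : Function.Injective fun a : κ => ((), a) := fun _ _ h => (Prod.ext_iff.1 h).2
  funext x
  rw [onQubits_mulVec_apply hinj]
  simp only [unitVec, extend_comp_self hinj]
  rfl

/-- The computation block is in the encoding of the state `φ`. -/
def Encodes (φ : (Fin k → Bool) → ℂ) (ρ : Op (Qubit (r + k) t)) : Prop :=
  onQubits (codeQubit π false) (pureState (code.enc *ᵥ φ)) * ρ = ρ

theorem encodes_iff (φ : (Fin k → Bool) → ℂ) (ρ : Op (Qubit (r + k) t)) :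
    Encodes code π φ ρ ↔ onQubits (blockQubit π fun _ : Unit => false)
      (pureState (code.encBlocks Unit *ᵥ unitVec φ)) * ρ = ρ := by
  rw [encBlocks_mulVec_unitVec, unit_pureState,
    onQubits_blockQubit π (blk := fun _ : Unit => false) (fun _ _ _ => rfl)]
  rfl

variable {code π} in
theorem Encodes.exec {φ : (Fin k → Bool) → ℂ} {ρ : Op (Qubit (r + k) t)}
    (hρ : Encodes code π φ ρ) {p : Impl Unit (r + k) k} {W : Op (Fin k)}
    (h : p.For code (onQubits (fun a => ((), a)) W)) :
    Encodes code π (W *ᵥ φ) (p.exec code π (fun _ => false) ρ) := by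
  rw [encodes_iff] at hρ ⊢
  have := Impl.exec_mul code π (blk := fun _ : Unit => false) (fun _ _ _ => rfl) h hρ
  rwa [onQubits_mulVec_unitVec] at this

variable {code π} in
theorem Encodes.kraus {φ : (Fin k → Bool) → ℂ} {ρ : Op (Qubit (r + k) t)}
    (hρ : Encodes code π φ ρ) {S : Set (Qubit (r + k) t)} (hS : ∀ j, codeQubit π false j ∉ S)
    {c : Chan (Qubit (r + k) t)} (hc : KrausBy (Loc S) c) : Encodes code π φ (c ρ) :=
  hc.mul_eq (onQubits_mem_Off (codeQubit_injective π false) hS _) hρ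

theorem onQubits_unit_ctrl {Q ι : Type} [Fintype Q] [DecidableEq Q] [Fintype ι] [DecidableEq ι]
    {e : ι → Q} (he : Function.Injective e) (c : ι) (A : Op ι) :
    onQubits e (ctrl c A) = ctrl (e c) (onQubits e A) := by
  rw [ctrl_eq, ctrl_eq, onQubits_add, onQubits_mul he, onQubits_onQubit he, onQubits_onQubit he]

/-! ### Two blocks -/

/-- The product of a vector of the computation block and a vector of the magic-state block. -/
def tensorVec {κ : Type} (v w : (κ → Bool) → ℂ) : (Bool × κ → Bool) → ℂ := fun x =>
  v (fun a => x (false, a)) * w (fun a => x (true, a))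

/-- The configurations of two blocks. -/
def pairEquiv (κ : Type) : (κ → Bool) × (κ → Bool) ≃ (Bool × κ → Bool) where
  toFun p x := if x.1 then p.2 x.2 else p.1 x.2
  invFun x := (fun a => x (false, a), fun a => x (true, a))
  left_inv p := by simp
  right_inv x := by
    funext ⟨b, a⟩
    cases b <;> simp

theorem encBlocks_mulVec_tensorVec (φ μ : (Fin k → Bool) → ℂ) :
    code.encBlocks Bool *ᵥ tensorVec φ μ = tensorVec (code.enc *ᵥ φ) (code.enc *ᵥ μ) := by
  funext x
  simp only [Matrix.mulVec, dotProduct, tensorVec]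
  rw [← (pairEquiv (Fin k)).sum_comp, Fintype.sum_prod_type, Finset.sum_mul_sum]
  refine Finset.sum_congr rfl fun y _ => Finset.sum_congr rfl fun z _ => ?_
  simp only [StabilizerCode.encBlocks, Matrix.of_apply, Fintype.prod_bool, pairEquiv, Equiv.coe_fn_mk,
    Bool.false_eq_true, if_false, if_true]
  ring

theorem extend_pair_block {κ : Type} (b b' : Bool) (d : κ → Bool) (x : Bool × κ → Bool) :
    (fun j => Function.extend (fun j => (b, j)) d x (b', j)) =
      if b' = b then d else fun j => x (b', j) := by
  have hinj : Function.Injective (fun j : κ => (b, j)) := fun i j h => (Prod.ext_iff.1 h).2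
  funext j
  by_cases h : b' = b
  · subst h
    rw [if_pos rfl]
    exact hinj.extend_apply d x j
  · rw [if_neg h, Function.extend_apply' _ _ _ (by rintro ⟨i, hi⟩; exact h (Prod.ext_iff.1 hi).1.symm)]

theorem onQubits_false_mulVec_tensorVec {n : ℕ} (A : Op (Fin n)) (v w : (Fin n → Bool) → ℂ) :
    onQubits (fun j => (false, j)) A *ᵥ tensorVec v w = tensorVec (A *ᵥ v) w := by
  funext x
  rw [onQubits_mulVec_apply (StabilizerCode.block_injective false)]
  simp only [tensorVec, extend_pair_block, if_true, Bool.true_eq_false, if_false, Matrix.mulVec,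
    dotProduct, Finset.sum_mul, mul_assoc]

theorem onQubits_true_mulVec_tensorVec {n : ℕ} (A : Op (Fin n)) (v w : (Fin n → Bool) → ℂ) :
    onQubits (fun j => (true, j)) A *ᵥ tensorVec v w = tensorVec v (A *ᵥ w) := by
  funext x
  rw [onQubits_mulVec_apply (StabilizerCode.block_injective true)]
  simp only [tensorVec, extend_pair_block, if_true, Bool.false_eq_true, if_false, Matrix.mulVec,
    dotProduct, Finset.mul_sum]
  exact Finset.sum_congr rfl fun d _ => by ring

theorem pureState_tensorVec {n : ℕ} (v w : (Fin n → Bool) → ℂ) :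
    pureState (tensorVec v w) =
      onQubits (fun j => (false, j)) (pureState v) * onQubits (fun j => (true, j)) (pureState w) := by
  ext x y
  rw [onQubits_mul_apply (StabilizerCode.block_injective false),
    Finset.sum_eq_single (fun j => y (false, j))]
  · simp only [onQubits, Matrix.of_apply, extend_pair_block, Bool.true_eq_false, if_false]
    rw [if_pos]
    · simp only [pureState, Matrix.vecMulVec_apply, Pi.star_apply, tensorVec, star_mul']
      ring
    · rintro ⟨b, j⟩ h
      cases b
      · exact congrFun (by rw [extend_pair_block, if_pos rfl] :
          (fun j => Function.extend (fun j => (false, j)) (fun j => y (false, j)) x (false, j)) =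
          fun j => y (false, j)) j
      · exact absurd rfl (h j)
  · intro d _ hd
    simp only [onQubits, Matrix.of_apply]
    rw [if_neg, mul_zero]
    intro h
    apply hd
    funext j
    have h1 := h (false, j) (by simp)
    have h2 := congrFun (extend_pair_block false false d x) j
    rw [if_pos rfl] at h2
    rw [← h1, ← h2]
  · simp

/-- The source of the invariants: a fresh preparation is fixed by whatever fixes the prepared state.
-/
theorem mul_prepare_eq {Q ι : Type} [Fintype Q] [DecidableEq Q] [Fintype ι] [DecidableEq ι]
    {e : ι → Q} (he : Function.Injective e) {A τ : Op ι} (h : A * τ = τ) (ρ : Op Q) :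
    onQubits e A * prepare e τ ρ = prepare e τ ρ := by
  ext x y
  have h1 : ∀ b d : ι → Bool, Function.extend e b (Function.extend e d x) =
      Function.extend e b x := fun b d => by
    rw [extend_eq_iff he]
    refine ⟨fun i => (he.extend_apply _ _ _).symm, fun q hq => ?_⟩
    rw [Function.extend_apply' _ _ _ (by simpa using hq),
      Function.extend_apply' _ _ _ (by simpa using hq)]
  rw [onQubits_mul_apply he]
  simp only [prepare, Matrix.of_apply, extend_comp_self he, h1, ← mul_assoc, ← Finset.sum_mul]
  congr 1
  exact congrFun (congrFun h fun i => x (e i)) fun i => y (e i)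

end States

section Injection

set_option linter.unusedSectionVars false
set_option linter.unusedDecidableInType false
set_option linter.unusedFintypeInType false

/-! ### Magic-state injection -/

theorem onQubit_mulVec_apply {Q : Type} [Fintype Q] [DecidableEq Q] (q : Q)
    (A : Matrix Bool Bool ℂ) (f : (Q → Bool) → ℂ) (x : Q → Bool) :
    (onQubit q A *ᵥ f) x = ∑ b, A (x q) b * f (Function.update x q b) := by
  have := onQubit_mul_apply q A (Matrix.replicateCol Unit f) x ()
  rwa [← Matrix.replicateCol_mulVec] at this

theorem ctrl_mulVec_apply {Q : Type} [Fintype Q] [DecidableEq Q] (c : Q) (A : Op Q)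
    (f : (Q → Bool) → ℂ) (x : Q → Bool) :
    (ctrl c A *ᵥ f) x = if x c then (A *ᵥ f) x else f x := by
  have := ctrl_mul_apply c A (Matrix.replicateCol Unit f) x ()
  rwa [← Matrix.replicateCol_mulVec, ← Matrix.replicateCol_mulVec] at this

/-- The data gate effected by injection when the magic qubit is found in `|m⟩`. -/
def injected (m : Bool) : Matrix Bool Bool ℂ :=
  Matrix.diagonal fun b => gateT (m ^^ b) (m ^^ b)

theorem injected_mulVec_apply {k : ℕ} (a : Fin k) (m : Bool) (φ : (Fin k → Bool) → ℂ)
    (x : Fin k → Bool) :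
    (onQubit a (injected m) *ᵥ φ) x = gateT (m ^^ x a) (m ^^ x a) * φ x := by
  rw [onQubit_mulVec_apply, Finset.sum_eq_single (x a)]
  · simp [injected]
  · intro b _ hb
    rw [injected, Matrix.diagonal_apply_ne _ (Ne.symm hb), zero_mul]
  · simp

/-- If the target is found in `m` after the CNOT, it was in `m ⊕ x_a` before, so the branch carries
the `T`-amplitude of `m ⊕ x_a`: a diagonal gate on the data. -/
theorem injection_eq {k : ℕ} (a : Fin k) (φ : (Fin k → Bool) → ℂ) :
    ctrl (false, a) (onQubit (true, a) gateX) *ᵥ tensorVec φ (StabilizerCode.magicKet a) =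
      ∑ m, tensorVec ((Real.sqrt 2 : ℂ)⁻¹ • (onQubit a (injected m) *ᵥ φ))
        (ket (Function.update (fun _ => false) a m)) := by
  funext x
  have hu : ∀ b a', Function.update x (true, a) b (false, a') = x (false, a') := fun b a' =>
    Function.update_of_ne (by simp) _ _
  have ht : ∀ b, (fun a' => Function.update x (true, a) b (true, a')) =
      Function.update (fun a' => x (true, a')) a b := fun b => by
    funext a'
    by_cases h : a' = a
    · subst h; simp
    · rw [Function.update_of_ne h, Function.update_of_ne (by simpa using h)]
  have hm : ∀ b, StabilizerCode.magicKet a (Function.update (fun a' => x (true, a')) a b) =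
      if ∀ a', a' ≠ a → x (true, a') = false then gateT b b / (Real.sqrt 2 : ℂ) else 0 := fun b => by
    simp only [StabilizerCode.magicKet, Function.update_self]
    refine if_congr (forall_congr' fun a' => forall_congr' fun h => ?_) rfl rfl
    rw [Function.update_of_ne h]
  have hL : (ctrl (false, a) (onQubit (true, a) gateX) *ᵥ
      tensorVec φ (StabilizerCode.magicKet a)) x = φ (fun a' => x (false, a')) *
        StabilizerCode.magicKet a (Function.update (fun a' => x (true, a')) a
          (x (true, a) ^^ x (false, a))) := by
    rw [ctrl_mulVec_apply]
    split_ifs with hx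
    · rw [onQubit_mulVec_apply, Finset.sum_eq_single (!x (true, a))]
      · simp only [tensorVec, hu, ht, hx, gateX, Matrix.of_apply, Bool.xor_true]
        simp
      · intro b _ hb
        have : x (true, a) = b := by cases h : x (true, a) <;> cases b <;> simp_all
        simp [gateX, this]
      · simp
    · have hx' : x (false, a) = false := by simpa using hx
      have : Function.update (fun a' => x (true, a')) a (x (true, a)) = fun a' => x (true, a') :=
        Function.update_eq_self a _
      rw [hx', Bool.xor_false, this]
      rfl
  rw [hL, hm, Finset.sum_apply]
  have hk : ∀ m, ket (Function.update (fun _ => false) a m) (fun a' => x (true, a')) =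
      if (∀ a', a' ≠ a → x (true, a') = false) ∧ x (true, a) = m then (1 : ℂ) else 0 := fun m => by
    rw [ket, Pi.single_apply]
    refine if_congr ?_ rfl rfl
    rw [funext_iff]
    constructor
    · intro h
      exact ⟨fun a' ha' => by rw [h, Function.update_of_ne ha'], by rw [h, Function.update_self]⟩
    · rintro ⟨h1, h2⟩ a'
      by_cases ha : a' = a
      · subst ha; rw [Function.update_self, h2]
      · rw [Function.update_of_ne ha, h1 a' ha]
  simp only [tensorVec, hk, Pi.smul_apply, injected_mulVec_apply, smul_eq_mul]
  rw [Finset.sum_eq_single (x (true, a))]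
  · by_cases h : ∀ a', a' ≠ a → x (true, a') = false
    · rw [if_pos h, if_pos ⟨h, rfl⟩]; ring
    · rw [if_neg h, if_neg (fun h' => h h'.1)]; ring
  · intro m _ hm
    rw [if_neg (fun h => hm h.2.symm), mul_zero]
  · simp

theorem exp_pi_div_four_sq : Complex.exp (Real.pi / 4 * Complex.I) *
    Complex.exp (Real.pi / 4 * Complex.I) = Complex.I := by
  rw [← Complex.exp_add, ← add_mul,
    show (Real.pi / 4 + Real.pi / 4 : ℂ) = Real.pi / 2 by ring, Complex.exp_pi_div_two_mul_I]

theorem norm_exp_pi_div_four : ‖Complex.exp (Real.pi / 4 * Complex.I)‖ = 1 := by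
  have := Complex.norm_exp_ofReal_mul_I (Real.pi / 4)
  push_cast at this
  exact this

theorem injected_false : injected false = gateT := by
  ext b c
  cases b <;> cases c <;> simp [injected, gateT]

/-- With `ω = e^{iπ/4}` the outcome `1` applies `diag(ω, 1)`; since `ω² = i`, the correction `S`
gives `diag(ω, ω²) = ω T`. -/
theorem gateS_mul_injected_true :
    gateS * injected true = Complex.exp (Real.pi / 4 * Complex.I) • gateT := by
  have h := exp_pi_div_four_sq
  ext b c
  cases b <;> cases c <;> simp [injected, gateT, gateS, h]

theorem injected_unitary (m : Bool) : (injected m)ᴴ * injected m = 1 := by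
  have h : (starRingEnd ℂ) (Complex.exp (Real.pi / 4 * Complex.I)) *
      Complex.exp (Real.pi / 4 * Complex.I) = 1 := by
    rw [Complex.conj_mul', norm_exp_pi_div_four]; simp
  ext b c
  cases m <;> cases b <;> cases c <;> simp [injected, gateT, h]

theorem sum_norm_sq_mulVec {m : Type} [Fintype m] [DecidableEq m] {A : Matrix m m ℂ}
    (hA : Aᴴ * A = 1) (v : m → ℂ) : ∑ x, ‖(A *ᵥ v) x‖ ^ 2 = ∑ x, ‖v x‖ ^ 2 := by
  have h : star (A *ᵥ v) ⬝ᵥ (A *ᵥ v) = star v ⬝ᵥ v := by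
    rw [Matrix.star_mulVec, Matrix.dotProduct_mulVec, Matrix.vecMul_vecMul, hA, Matrix.vecMul_one]
  rw [star_dotProduct_self, star_dotProduct_self] at h
  exact_mod_cast h

variable {r k t : ℕ} {code : StabilizerCode r k} {π : Placement (r + k) t}

/-- The Kraus operator of the logical `Z` measurement with results `s` on the leaves. -/
def zKraus (P : PauliString (r + k)) (s : Fin (r + k) → Bool) : Op (Fin (r + k)) :=
  pureState (ket s) * tens P.toZBasis

/-- The logical outcome computed from the results `s`. -/
def zOutcome (P : PauliString (r + k)) (s : Fin (r + k) → Bool) : Bool :=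
  P.neg ^^ decide (Odd ((P.support.filter fun j => s j = true).card))

/-- The encoded state has `Z̄_a`-eigenvalue `(-1)^m`, while the Kraus operator absorbs `Z̄_a` with
the sign of the computed outcome. If these differ, the vector equals its negative. -/
theorem zKraus_mulVec_eq_zero (a : Fin k) (s : Fin (r + k) → Bool) {m : Bool}
    (hm : m ≠ zOutcome (code.zbar a) s) :
    zKraus (code.zbar a) s *ᵥ (code.enc *ᵥ ket (Function.update (fun _ => false) a m)) = 0 := by
  set w := code.enc *ᵥ ket (Function.update (fun _ => false) a m) with hw
  have h1 : (code.zbar a).mat *ᵥ w = (if m then -1 else 1 : ℂ) • w := by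
    have h0 : onQubit a gateZ *ᵥ ket (Function.update (fun _ => false) a m) =
        (if m then -1 else 1 : ℂ) • ket (Function.update (fun _ => false) a m) := by
      funext x
      rw [onQubit_mulVec_apply, Finset.sum_eq_single (x a)]
      · simp only [gateZ, Matrix.diagonal_apply_eq, Function.update_eq_self, Pi.smul_apply,
          smul_eq_mul]
        by_cases hx : x = Function.update (fun _ => false) a m
        · rw [hx, Function.update_self]
        · rw [ket, Pi.single_eq_of_ne hx, mul_zero, mul_zero]
      · intro b _ hb
        rw [gateZ, Matrix.diagonal_apply_ne _ (Ne.symm hb), zero_mul]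
      · simp
    rw [hw, Matrix.mulVec_mulVec, code.zbar_mul_enc, ← Matrix.mulVec_mulVec, h0,
      Matrix.mulVec_smul]
  have h2 : zKraus (code.zbar a) s * (code.zbar a).mat =
      (if zOutcome (code.zbar a) s then -1 else 1 : ℂ) • zKraus (code.zbar a) s := by
    rw [zKraus, mul_assoc]
    exact (code.zbar a).proj_mul_toZBasis_mul s
  have h3 : (if m then -1 else 1 : ℂ) • (zKraus (code.zbar a) s *ᵥ w) =
      (if zOutcome (code.zbar a) s then -1 else 1 : ℂ) • (zKraus (code.zbar a) s *ᵥ w) := by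
    rw [← Matrix.mulVec_smul, ← h1, Matrix.mulVec_mulVec, h2, Matrix.smul_mulVec]
  have h4 : ∀ v : (Fin (r + k) → Bool) → ℂ, v = -v → v = 0 := fun v hv => by
    funext x
    have := congrFun hv x
    simp only [Pi.neg_apply] at this
    simpa using self_eq_neg.1 this
  cases m <;> cases ho : zOutcome (code.zbar a) s
  · exact absurd ho.symm hm
  · simp only [ho, if_true, Bool.false_eq_true, if_false, one_smul, neg_smul] at h3
    exact h4 _ h3
  · simp only [ho, if_true, Bool.false_eq_true, if_false, one_smul, neg_smul] at h3
    exact h4 _ h3.symm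
  · exact absurd ho.symm hm

theorem mul_pureState_eq {m m' : Type} [Fintype m] [Fintype m'] (A : Matrix m' m ℂ) (v : m → ℂ) :
    A * pureState v = Matrix.vecMulVec (A *ᵥ v) (star v) := by
  rw [pureState, Matrix.mul_vecMulVec]

/-- The condition is required only on the range of `R`: a measurement need not map every state to
the desired one. -/
theorem conjBy_encodes {B P R ρ : Op (Qubit (r + k) t)} (h : P * (B * R) = B * R)
    (hρ : R * ρ = ρ) : P * conjBy B ρ = conjBy B ρ := by
  have : conjBy B ρ = B * R * ρ * Bᴴ := by rw [mul_assoc B R ρ, hρ]; rfl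
  rw [this, ← mul_assoc, ← mul_assoc, h]

/-- Of the two terms of the injected state, only the one agreeing with the computed outcome
survives. It is a product vector, so the data block is left in a definite encoded state whatever
remains of the magic block. -/
theorem encodes_of_zKraus (a : Fin k) {φ : (Fin k → Bool) → ℂ} (hφ : ∑ x, ‖φ x‖ ^ 2 = 1)
    (s : Fin (r + k) → Bool) {ρ : Op (Qubit (r + k) t)}
    (hρ : onQubits (blockQubit π id) (pureState (code.encBlocks Bool *ᵥ
      (ctrl (false, a) (onQubit (true, a) gateX) *ᵥ tensorVec φ (StabilizerCode.magicKet a)))) * ρ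
        = ρ) :
    Encodes code π (onQubit a (injected (zOutcome (code.zbar a) s)) *ᵥ φ)
      (conjBy (onQubits (codeQubit π true) (zKraus (code.zbar a) s)) ρ) := by
  refine conjBy_encodes ?_ hρ
  have hid : Function.Injective (id : Bool → Bool) := Function.injective_id
  have hinj := blockQubit_injective (t := t) π hid
  have hb : ∀ (b : Bool) (A : Op (Fin (r + k))), onQubits (codeQubit π b) A =
      onQubits (blockQubit (t := t) π id) (onQubits (fun j => (b, j)) A) := fun b A =>
    (onQubits_blockQubit π hid b A).symm
  rw [hb, hb, ← onQubits_mul hinj, ← onQubits_mul hinj]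
  congr 1
  rw [mul_pureState_eq, Matrix.mul_vecMulVec]
  congr 1
  rw [injection_eq, Matrix.mulVec_sum, Matrix.mulVec_sum]
  simp only [encBlocks_mulVec_tensorVec, onQubits_true_mulVec_tensorVec]
  set m := zOutcome (code.zbar a) s with hm
  rw [Finset.sum_eq_single m]
  · rw [onQubits_false_mulVec_tensorVec, Matrix.mulVec_smul, Matrix.mulVec_smul, pureState_mulVec,
      star_dotProduct_self, code.sum_norm_sq_enc, Complex.ofReal_one, one_smul]
    rw [sum_norm_sq_mulVec _ φ, hφ]
    rw [← onQubit_conjTranspose, ← onQubit_mul, injected_unitary, onQubit_one]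
  · intro b _ hbm
    rw [zKraus_mulVec_eq_zero a s (hm ▸ hbm)]
    funext x
    simp [tensorVec]
  · simp

end Injection

/-! ### Correctness of magic-state injection -/

section Runs
set_option linter.unusedSectionVars false
set_option linter.unusedDecidableInType false
set_option linter.unusedFintypeInType false

variable {r k t : ℕ}

/-- Exhibits the magic state as a unitary image of a basis vector, which gives its norm. -/
theorem magicKet_eq (a : Fin k) : StabilizerCode.magicKet a =
    onQubit a (gateT * gateH) *ᵥ ket fun _ => false := by
  funext y
  rw [onQubit_mulVec_apply, Finset.sum_eq_single false]
  · have h : (gateT * gateH) (y a) false = gateT (y a) (y a) / (Real.sqrt 2 : ℂ) := by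
      cases y a <;> simp [gateT, gateH, Matrix.diagonal_mul, div_eq_mul_inv]
    have h2 : (ket fun _ => false) (Function.update y a false) =
        if ∀ a', a' ≠ a → y a' = false then (1 : ℂ) else 0 := by
      rw [ket, Pi.single_apply]
      refine if_congr ?_ rfl rfl
      rw [funext_iff]
      constructor
      · intro h a' ha'
        have := h a'
        rwa [Function.update_of_ne ha'] at this
      · intro h a'
        by_cases ha : a' = a
        · subst ha; rw [Function.update_self]
        · rw [Function.update_of_ne ha, h a' ha]
    rw [h, h2, StabilizerCode.magicKet, mul_ite, mul_one, mul_zero]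
  · intro b _ hb
    have hb' : b = true := by simpa using hb
    subst hb'
    rw [ket, Pi.single_eq_of_ne, mul_zero]
    intro h
    simpa using congrFun h a
  · simp

theorem sum_norm_sq_ket {m : Type} [Fintype m] [DecidableEq m] (s : m) :
    ∑ x, ‖(ket s : m → ℂ) x‖ ^ 2 = 1 := by
  have := (isDensity_ket s).2
  rw [trace_pureState] at this
  exact_mod_cast this

theorem gateT_unitary : gateTᴴ * gateT = 1 := by
  rw [← injected_false]; exact injected_unitary false

theorem sum_norm_sq_magicKet (a : Fin k) : ∑ x, ‖StabilizerCode.magicKet a x‖ ^ 2 = 1 := by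
  rw [magicKet_eq, sum_norm_sq_mulVec, sum_norm_sq_ket]
  rw [← onQubit_conjTranspose, ← onQubit_mul, Matrix.conjTranspose_mul, mul_assoc,
    ← mul_assoc gateTᴴ, gateT_unitary, one_mul, gateH_conjTranspose, gateH_mul_self, onQubit_one]

theorem isDensity_magicState (code : StabilizerCode r k) (a : Fin k) :
    IsDensity (code.magicState a) :=
  isDensity_pureState (code.sum_norm_sq_enc (sum_norm_sq_magicKet a))

section Encodes

variable {code : StabilizerCode r k} {π : Placement (r + k) t}

theorem Encodes.sum {κ : Type*} {s : Finset κ} {φ : (Fin k → Bool) → ℂ}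
    {ρ : κ → Op (Qubit (r + k) t)} (h : ∀ i ∈ s, Encodes code π φ (ρ i)) :
    Encodes code π φ (∑ i ∈ s, ρ i) := by
  rw [Encodes, Finset.mul_sum]
  exact Finset.sum_congr rfl h

theorem Encodes.of_smul {c : ℂ} (hc : ‖c‖ = 1) {φ : (Fin k → Bool) → ℂ}
    {ρ : Op (Qubit (r + k) t)} (h : Encodes code π (c • φ) ρ) : Encodes code π φ ρ := by
  rwa [Encodes, Matrix.mulVec_smul, pureState_smul c hc] at h

/-- The preparation acts off the computation block, so the encoding there survives, and the new
block is fixed by its own projector; the projectors multiply to that of the product vector. -/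
theorem Encodes.prepare_magicState {φ : (Fin k → Bool) → ℂ} {ρ : Op (Qubit (r + k) t)}
    (hρ : Encodes code π φ ρ) (a : Fin k) :
    onQubits (blockQubit π id) (pureState (code.encBlocks Bool *ᵥ
      tensorVec φ (StabilizerCode.magicKet a))) *
        prepare (codeQubit π true) (code.magicState a) ρ =
      prepare (codeQubit π true) (code.magicState a) ρ := by
  have hb : ∀ (b : Bool) (A : Op (Fin (r + k))), onQubits (codeQubit π b) A =
      onQubits (blockQubit (t := t) π id) (onQubits (fun j => (b, j)) A) := fun b A =>
    (onQubits_blockQubit π Function.injective_id b A).symm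
  have h1 : Encodes code π φ (prepare (codeQubit π true) (code.magicState a) ρ) :=
    hρ.kraus (S := Set.range (codeQubit π true)) (by
      rintro j ⟨i, hi⟩
      simp [codeQubit] at hi)
      (KrausBy.prepare (codeQubit_injective π true)
        (fun A => onQubits_mem_Loc (codeQubit_injective π true) (fun i => Set.mem_range_self i) A)
        (isDensity_magicState code a))
  rw [encBlocks_mulVec_tensorVec, pureState_tensorVec,
    onQubits_mul (blockQubit_injective π Function.injective_id), ← hb, ← hb, mul_assoc,
    mul_prepare_eq (codeQubit_injective π true), h1]
  exact pureState_mul_self (code.sum_norm_sq_enc (sum_norm_sq_magicKet a))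

end Encodes

namespace Protocol

variable {p : Protocol r k t}

/-- Every combination of leaf results yields `T` on the data, directly for outcome `0` and after
`S`, up to the phase `e^{iπ/4}`, for outcome `1`. -/
theorem encodes_injectT (hlib : p.lib.Valid p.code) {i : ℕ} {a : Fin k}
    (hfac : p.factory i a = p.code.magicState a) {φ : (Fin k → Bool) → ℂ}
    (hφ : ∑ x, ‖φ x‖ ^ 2 = 1) {ρ : Op (Qubit (r + k) t)} (hρ : Encodes p.code p.place φ ρ) :
    Encodes p.code p.place (onQubit a gateT *ᵥ φ) (p.injectT i a ρ) := by
  have h1 := Impl.exec_mul p.code p.place Function.injective_id (hlib.inject a)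
    (hρ.prepare_magicState a)
  rw [← hfac] at h1
  set σ := (p.lib.inject a).exec p.code p.place id
    (prepare (codeQubit p.place true) (p.factory i a) ρ) with hσ
  have h2 : p.injectT i a ρ = ∑ s, applyIf (zOutcome (p.code.zbar a) s)
      ((p.lib.s a).exec p.code p.place fun _ => false)
      (conjBy (onQubits (codeQubit p.place true) (zKraus (p.code.zbar a) s)) σ) := by
    simp only [injectT, runAll, id, measureAll, conjBy_conjBy, zKraus,
      onQubits_mul (codeQubit_injective p.place true)]
    rfl
  rw [h2]
  refine Encodes.sum fun s _ => ?_
  have h3 := encodes_of_zKraus a hφ s h1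
  cases hm : zOutcome (p.code.zbar a) s
  · rw [hm, injected_false] at h3
    exact h3
  · rw [hm] at h3
    have h4 := h3.exec (p := p.lib.s a) (W := onQubit a gateS) (by
      rw [onQubit_block]; exact hlib.s a)
    rw [Matrix.mulVec_mulVec, ← onQubit_mul, gateS_mul_injected_true, onQubit_smul,
      Matrix.smul_mulVec] at h4
    exact h4.of_smul norm_exp_pi_div_four

end Protocol

end Runs

section Encoding
set_option linter.unusedSectionVars false
set_option linter.unusedDecidableInType false
set_option linter.unusedFintypeInType false

/-! ### Distributed encoding -/

theorem conjBy_mul_eq {Q : Type} [Fintype Q] [DecidableEq Q] {P B R ρ : Op Q}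
    (h : P * B = B * R) (hρ : R * ρ = ρ) : P * conjBy B ρ = conjBy B ρ := by
  have h1 : P * (B * ρ) = B * ρ := by rw [← mul_assoc, h, mul_assoc, hρ]
  rw [conjBy, ← mul_assoc, h1]

theorem commute_onQubits_pair {Q ι ι' : Type} [Fintype Q] [DecidableEq Q] [Fintype ι]
    [DecidableEq ι] [Fintype ι'] [DecidableEq ι'] {e : ι → Q} {f : ι' → Q}
    (he : Function.Injective e) (hf : Function.Injective f) (hef : ∀ i j, e i ≠ f j) (A : Op ι)
    (B : Op ι') : Commute (onQubits e A) (onQubits f B) := onQubits_commute he hf hef A B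

theorem onQubits_stabProj {Q ι κ : Type} [Fintype Q] [DecidableEq Q] [Fintype ι] [DecidableEq ι]
    {e : ι → Q} (he : Function.Injective e) (P : κ → Op ι) (l : List κ) :
    onQubits e (stabProj P l) = stabProj (fun i => onQubits e (P i)) l := by
  induction l with
  | nil => exact onQubits_one e
  | cons i l ih =>
    simp only [stabProj, List.map_cons, List.prod_cons] at ih ⊢
    rw [onQubits_mul he, ih, onQubits_smul, onQubits_add, onQubits_one]

theorem onQubit_mul_tens {ι : Type} [Fintype ι] [DecidableEq ι] (i : ι)
    {A B C : Matrix Bool Bool ℂ} (h : A * C = C * B) :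
    onQubit i A * (tens fun _ => C) = (tens fun _ => C) * onQubit i B := by
  rw [onQubit_eq_tens, onQubit_eq_tens, tens_mul, tens_mul]
  congr 1
  funext j
  by_cases hj : j = i
  · subst hj; simpa using h
  · simp [Function.update_of_ne hj]

theorem onQubit_mul_tens_eq {ι : Type} [Fintype ι] [DecidableEq ι] (i : ι)
    {A C : Matrix Bool Bool ℂ} (h : A * C = C) :
    onQubit i A * (tens fun _ => C) = tens fun _ => C := by
  rw [onQubit_mul_tens i (B := 1) (by rw [h, mul_one]), onQubit_one, mul_one]

theorem onQubit_gateZ_mul_pureState_ket {ι : Type} [Fintype ι] [DecidableEq ι] (i : ι)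
    (m : ι → Bool) : pureState (ket m) * onQubit i gateZ =
      (if m i then -1 else 1 : ℂ) • pureState (ket m) := by
  ext x y
  rw [mul_onQubit_apply, Finset.sum_eq_single (y i)]
  · rw [Function.update_eq_self, gateZ, Matrix.diagonal_apply_eq, Matrix.smul_apply, smul_eq_mul,
      mul_comm, pureState_ket_apply]
    by_cases h : x = m ∧ y = m
    · rw [if_pos h, h.2]
    · rw [if_neg h, mul_zero, mul_zero]
  · intro b _ hb
    rw [gateZ, Matrix.diagonal_apply_ne _ hb, mul_zero]
  · simp

/-- Heisenberg picture: controlled `P` conjugates `X` on the control to `X` times `P`. -/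
theorem gateX_mul_ctrl {Q : Type} [Fintype Q] [DecidableEq Q] {c : Q} {P : Op Q}
    (hP : ∀ C, Commute (onQubit c C) P) (hsq : P * P = 1) :
    onQubit c gateX * P * ctrl c P = ctrl c P * onQubit c gateX := by
  have h0 : gateX * Matrix.diagonal (fun b => if b then (0 : ℂ) else 1) =
      Matrix.diagonal (fun b => if b then (1 : ℂ) else 0) * gateX := by
    apply bool_matrix_ext <;> simp [gateX, Matrix.mul_apply]
  have h1 : gateX * Matrix.diagonal (fun b => if b then (1 : ℂ) else 0) =
      Matrix.diagonal (fun b => if b then (0 : ℂ) else 1) * gateX := by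
    apply bool_matrix_ext <;> simp [gateX, Matrix.mul_apply]
  rw [ctrl_eq, mul_add, add_mul]
  have e1 : onQubit c gateX * P * onQubit c (Matrix.diagonal fun b => if b then (0 : ℂ) else 1) =
      onQubit c (Matrix.diagonal fun b => if b then (1 : ℂ) else 0) * P * onQubit c gateX := by
    rw [mul_assoc, ← (hP _).eq, ← mul_assoc, ← onQubit_mul, h0, onQubit_mul, mul_assoc, (hP _).eq,
      ← mul_assoc]
  have e2 : onQubit c gateX * P * (onQubit c (Matrix.diagonal fun b => if b then (1 : ℂ) else 0) *
      P) = onQubit c (Matrix.diagonal fun b => if b then (0 : ℂ) else 1) * onQubit c gateX := by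
    rw [(hP (Matrix.diagonal fun b => if b then (1 : ℂ) else 0)).eq, mul_assoc, ← mul_assoc P P, hsq, one_mul, ← onQubit_mul, h1, onQubit_mul]
  rw [e1, e2, add_comm]

variable {r k t : ℕ} (code : StabilizerCode r k) (π : Placement (r + k) t)

theorem syn_injective {n t : ℕ} : Function.Injective (Qubit.syn : Fin n → Qubit n t) :=
  fun _ _ h => by injection h

/-- The enforced operators on the computation block. -/
def blockOp (i : Fin (r + k)) : Op (Qubit (r + k) t) :=
  onQubits (codeQubit π false) (code.ops i).mat

theorem commute_blockOp (i j : Fin (r + k)) : Commute (blockOp code π i) (blockOp code π j) := by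
  have h := (code.ops_commute i j).eq
  rw [Commute, SemiconjBy, blockOp, blockOp, ← onQubits_mul (codeQubit_injective π false), h,
    onQubits_mul (codeQubit_injective π false)]

theorem blockOp_mul_self (i : Fin (r + k)) : blockOp code π i * blockOp code π i = 1 := by
  rw [blockOp, ← onQubits_mul (codeQubit_injective π false), PauliString.mat_mul_self,
    onQubits_one]

theorem commute_syn_blockOp (A : Op (Fin (r + k))) (j : Fin (r + k)) :
    Commute (onQubits Qubit.syn A) (blockOp code π j) :=
  commute_onQubits_pair syn_injective (codeQubit_injective π false) (by simp [codeQubit]) _ _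

theorem commute_onQubit_syn_blockOp (i j : Fin (r + k)) (A : Matrix Bool Bool ℂ) :
    Commute (onQubit (.syn i) A) (blockOp code π j) := by
  rw [← onQubits_onQubit syn_injective]
  exact commute_syn_blockOp code π _ j

/-- The step of the encoding that couples the `i`-th syndrome qubit to the computation block. -/
def syndromeStep (i : Fin (r + k)) : Chan (Qubit (r + k) t) :=
  ctrlPauli (code.ops i) (.syn i) fun j A =>
    runAll
      [ bellPair (.hub false) (.comm (π (.inl j))),
        scst (.syn i) (.hub false) (.comm (π (.inl j))) (codeQubit π false j) A ]

theorem syn_notMem_linkQubits (i : Fin (r + k)) :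
    (.syn i : Qubit (r + k) t) ∉ linkQubits (r + k) t := by simp [linkQubits]

theorem realizes_syndromeStep (i : Fin (r + k)) :
    Realizes (linkQubits (r + k) t) (syndromeStep code π i) (ctrl (.syn i) (blockOp code π i)) := by
  refine realizes_ctrlPauli (codeQubit_injective π false) (syn_notMem_linkQubits i)
    (fun j => code_notMem_linkQubits _ _) (by simp [codeQubit]) _ fun j A => ?_
  refine Realizes.mono ?_ (realizes_scst (by simp) (by simp) (by simp [codeQubit]) (by simp)
    (by simp [codeQubit]) (by simp [codeQubit]) A)
  rintro q (rfl | rfl)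
  · exact Or.inl ⟨_, rfl⟩
  · exact Or.inr ⟨_, rfl⟩

theorem blockOp_mem_Off (i : Fin (r + k)) :
    blockOp code π i ∈ Off (linkQubits (r + k) t) :=
  onQubits_mem_Off (codeQubit_injective π false) (fun _ => code_notMem_linkQubits _ _) _

/-- Once created, the stabilizer of syndrome qubit `i` commutes with all later steps, because they
use other controls and commuting operators. -/
theorem runAll_syndromeSteps_of_notMem {i : Fin (r + k)} {A : Matrix Bool Bool ℂ}
    (l : List (Fin (r + k))) (hi : i ∉ l) {ρ : Op (Qubit (r + k) t)}
    (hρ : onQubit (.syn i) A * blockOp code π i * ρ = ρ) :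
    onQubit (.syn i) A * blockOp code π i * runAll (l.map (syndromeStep code π)) ρ =
      runAll (l.map (syndromeStep code π)) ρ := by
  induction l generalizing ρ with
  | nil => exact hρ
  | cons j l ih =>
    refine ih (fun h => hi (List.mem_cons_of_mem _ h))
      ((realizes_syndromeStep code π j).mul_eq (mul_mem (onQubit_mem_Off
        (syn_notMem_linkQubits i) _) (blockOp_mem_Off code π i)) ?_ hρ)
    have hij : i ≠ j := fun h => hi (h ▸ List.mem_cons_self)
    have hc : Commute (onQubit (.syn i) A * blockOp code π i)
        (ctrl (.syn j) (blockOp code π j)) := by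
      rw [ctrl_eq]
      have h1 : ∀ B, Commute (onQubit (.syn i) A * blockOp code π i) (onQubit (.syn j) B) :=
        fun B => Commute.mul_left (onQubit_commute (by simpa using hij) A B)
          (commute_onQubit_syn_blockOp code π j i B).symm
      have h2 : Commute (onQubit (.syn i) A * blockOp code π i) (blockOp code π j) :=
        (commute_onQubit_syn_blockOp code π i j A).mul_left (commute_blockOp code π i j)
      exact (h1 _).add_right ((h1 _).mul_right h2)
    exact hc.eq

/-- Steps before the `i`-th leave `X` on syndrome qubit `i` alone; the `i`-th attaches the enforced
operator; the later ones preserve the product. -/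
theorem runAll_syndromeSteps {i : Fin (r + k)} (l : List (Fin (r + k))) (hl : l.Nodup)
    (hi : i ∈ l) {ρ : Op (Qubit (r + k) t)} (hρ : onQubit (.syn i) gateX * ρ = ρ) :
    onQubit (.syn i) gateX * blockOp code π i * runAll (l.map (syndromeStep code π)) ρ =
      runAll (l.map (syndromeStep code π)) ρ := by
  induction l generalizing ρ with
  | nil => simp at hi
  | cons j l ih =>
    by_cases hij : i = j
    · subst hij
      refine runAll_syndromeSteps_of_notMem code π l (List.nodup_cons.1 hl).1
        ((realizes_syndromeStep code π i).mul_eq (mul_mem (onQubit_mem_Off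
        (syn_notMem_linkQubits i) _) (blockOp_mem_Off code π i)) ?_ hρ)
      exact gateX_mul_ctrl (commute_onQubit_syn_blockOp code π i i) (blockOp_mul_self code π i)
    · refine ih (List.nodup_cons.1 hl).2 ((List.mem_cons.1 hi).resolve_left hij)
        ((realizes_syndromeStep code π j).mul_eq (onQubit_mem_Off
        (syn_notMem_linkQubits i) _) ?_ hρ)
      have hc : Commute (onQubit (.syn i) gateX) (ctrl (.syn j) (blockOp code π j)) := by
        rw [ctrl_eq]
        have h1 : ∀ B, Commute (onQubit (.syn i : Qubit (r + k) t) gateX) (onQubit (.syn j) B) :=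
          fun B => onQubit_commute (by simpa using hij) gateX B
        exact (h1 _).add_right ((h1 _).mul_right (commute_onQubit_syn_blockOp code π i j gateX))
      exact hc.eq

/-- The product of the states `|+⟩⟨+|` is the pure state of `H` on all qubits applied to `|0…0⟩`. -/
theorem isDensity_plus {n : ℕ} :
    IsDensity (tens fun _ : Fin n => gateH * pureState (ket false) * gateHᴴ) := by
  have h : (tens fun _ : Fin n => gateH * pureState (ket false) * gateHᴴ) =
      pureState ((tens fun _ => gateH) *ᵥ ket fun _ => false) := by
    rw [← mul_pureState, tens_conjTranspose]
    have : pureState (ket fun _ : Fin n => false) = tens fun _ => pureState (ket false) := by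
      ext x y
      rw [pureState_ket_apply]
      simp only [tens, Matrix.of_apply, pureState_ket_apply, Finset.prod_ite_zero,
        Finset.prod_const_one]
      refine if_congr ?_ rfl rfl
      rw [funext_iff, funext_iff]
      simp [forall_and]
    rw [this, tens_mul, tens_mul]
  rw [h]
  refine isDensity_pureState ?_
  rw [sum_norm_sq_mulVec, sum_norm_sq_ket]
  rw [tens_conjTranspose, tens_mul]
  simp only [gateH_conjTranspose, gateH_mul_self]
  exact tens_one

theorem krausBy_prepare_syn {M : Subalgebra ℂ (Op (Qubit (r + k) t))}
    (hM : ∀ A, onQubits Qubit.syn A ∈ M) : KrausBy M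
      (prepare Qubit.syn (tens fun _ => gateH * pureState (ket false) * gateHᴴ)) :=
  KrausBy.prepare syn_injective hM isDensity_plus

variable {code} in
-- Stabilizer tracking: `X_i` becomes `X_i P_i`, then `Z_i P_i` after the Hadamards, then `(-1)^{m
-- i} P_i` once the outcome is known, and `P_i` after the correction. A state fixed by all `P_i` is
-- fixed by the rank-one projection onto the logical zero.
theorem encodes_distributedEncoding {C : (Fin (r + k) → Bool) → PauliString (r + k)}
    (hC : code.IsCorrectionTable C) (ρ : Op (Qubit (r + k) t)) :
    Encodes code π (ket fun _ => false) (distributedEncoding π code.ops C ρ) := by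
  set τ := prepare (codeQubit π false) (pureState (ket fun _ => false))
    (prepare Qubit.syn (tens fun _ => gateH * pureState (ket false) * gateHᴴ) ρ) with hτ
  set σ := runAll ((List.finRange (r + k)).map (syndromeStep code π)) τ with hσ
  have hrun : distributedEncoding π code.ops C ρ =
      ∑ m, conjBy (onQubits (codeQubit π false) (C m).mat)
        (conjBy (onQubits Qubit.syn (pureState (ket m)))
          (conjBy (onQubits Qubit.syn (tens fun _ => gateH)) σ)) := by
    rw [distributedEncoding, runAll_append, runAll_append]
    rfl
  have h1 : ∀ i, onQubit (.syn i) gateX * τ = τ := fun i => by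
    rw [hτ]
    refine KrausBy.mul_eq (S := Set.range (codeQubit π false))
      (KrausBy.prepare (codeQubit_injective π false)
        (fun A => onQubits_mem_Loc (codeQubit_injective π false) (fun i => Set.mem_range_self i) A)
        (isDensity_ket _)) (onQubit_mem_Off (by simp [codeQubit]) _) ?_
    rw [← onQubits_onQubit syn_injective]
    refine mul_prepare_eq syn_injective (onQubit_mul_tens_eq i ?_) ρ
    have hZ : gateZ * pureState (ket false) = pureState (ket false) := by
      apply bool_matrix_ext <;> simp [gateZ, Matrix.diagonal_mul, pureState_ket_apply]
    -- `X H |0⟩ = H Z |0⟩ = H |0⟩`.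
    rw [← mul_assoc, ← mul_assoc, ← gateH_mul_gateZ, mul_assoc gateH, hZ]
  have h2 : ∀ i, onQubit (.syn i) gateX * blockOp code π i * σ = σ := fun i =>
    runAll_syndromeSteps code π _ (List.nodup_finRange _) (List.mem_finRange i) (h1 i)
  have h3 : ∀ i, onQubit (.syn i) gateZ * blockOp code π i *
      conjBy (onQubits Qubit.syn (tens fun _ => gateH)) σ =
      conjBy (onQubits Qubit.syn (tens fun _ => gateH)) σ := fun i => by
    refine conjBy_mul_eq ?_ (h2 i)
    rw [mul_assoc, ← (commute_syn_blockOp code π _ i).eq, ← mul_assoc, ← mul_assoc]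
    congr 1
    rw [← onQubits_onQubit syn_injective, ← onQubits_onQubit syn_injective,
      ← onQubits_mul syn_injective, ← onQubits_mul syn_injective,
      onQubit_mul_tens i gateH_mul_gateX.symm]
  rw [hrun]
  refine Encodes.sum fun m _ => ?_
  have h4 : ∀ i, (if m i then -1 else 1 : ℂ) • blockOp code π i *
      conjBy (onQubits Qubit.syn (pureState (ket m)))
        (conjBy (onQubits Qubit.syn (tens fun _ => gateH)) σ) =
      conjBy (onQubits Qubit.syn (pureState (ket m)))
        (conjBy (onQubits Qubit.syn (tens fun _ => gateH)) σ) := fun i => by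
    refine conjBy_mul_eq ?_ (h3 i)
    rw [← mul_assoc, ← onQubits_onQubit syn_injective, ← onQubits_mul syn_injective,
      onQubit_gateZ_mul_pureState_ket, onQubits_smul, smul_mul_assoc, smul_mul_assoc,
      (commute_syn_blockOp code π _ i).eq]
  have h5 : ∀ i, blockOp code π i * conjBy (onQubits (codeQubit π false) (C m).mat)
      (conjBy (onQubits Qubit.syn (pureState (ket m)))
        (conjBy (onQubits Qubit.syn (tens fun _ => gateH)) σ)) =
      conjBy (onQubits (codeQubit π false) (C m).mat)
      (conjBy (onQubits Qubit.syn (pureState (ket m)))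
        (conjBy (onQubits Qubit.syn (tens fun _ => gateH)) σ)) := fun i => by
    refine conjBy_mul_eq ?_ (h4 i)
    rw [blockOp, ← onQubits_smul, ← onQubits_mul (codeQubit_injective π false),
      ← onQubits_mul (codeQubit_injective π false), PauliString.mat_comm,
      PauliString.symp_comm, hC m i, mul_smul_comm]
    congr 2
    split_ifs
    · exact sgn_one
    · exact sgn_zero
  rw [Encodes, code.enc_mulVec_ket_zero, ← code.zeroProj_eq, StabilizerCode.zeroProj,
    onQubits_stabProj (codeQubit_injective π false)]
  exact stabProj_mul (fun i _ => h5 i)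

end Encoding

section Execution
set_option linter.unusedSectionVars false
set_option linter.unusedDecidableInType false
set_option linter.unusedFintypeInType false

/-! ### Execution of the whole protocol -/

variable {r k t : ℕ}

/-- Operators that act trivially on the trap qubits. -/
def offTraps (π : Placement (r + k) t) : Subalgebra ℂ (Op (Qubit (r + k) t)) :=
  Loc (Set.range (trapQubit π))ᶜ

theorem onQubits_mem_offTraps {π : Placement (r + k) t} {ι : Type} [Fintype ι] [DecidableEq ι]
    {e : ι → Qubit (r + k) t} (he : Function.Injective e) (h : ∀ i j, trapQubit π j ≠ e i)
    (A : Op ι) : onQubits e A ∈ offTraps π :=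
  onQubits_mem_Loc he (fun i => by rintro ⟨j, hj⟩; exact h i j hj) A

theorem codeQubit_mem_offTraps (π : Placement (r + k) t) (b : Bool) (A : Op (Fin (r + k))) :
    onQubits (codeQubit π b) A ∈ offTraps π :=
  onQubits_mem_offTraps (codeQubit_injective π b)
    (fun i j => (codeQubit_ne_trapQubit π b i j).symm) A

theorem syn_mem_offTraps (π : Placement (r + k) t) (A : Op (Fin (r + k))) :
    onQubits Qubit.syn A ∈ offTraps π :=
  onQubits_mem_offTraps syn_injective (by simp [trapQubit]) A

theorem Loc_helperQubits_le (π : Placement (r + k) t) :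
    Loc (helperQubits (r + k) t) ≤ offTraps π :=
  Loc_mono (by
    rintro q hq ⟨j, rfl⟩
    exact code_notMem_helperQubits _ _ hq)

/-- Implementations act on code and helper qubits only, neither of which are trap qubits. -/
theorem Impl.krausBy {code : StabilizerCode r k} (π : Placement (r + k) t) {β : Type} [Fintype β]
    [DecidableEq β] {blk : β → Bool} (hblk : Function.Injective blk) {p : Impl β (r + k) k}
    {W : Op (β × Fin k)} (h : p.For code W) : KrausBy (offTraps π) (p.exec code π blk) := by
  obtain ⟨L, hL, -, hr⟩ := p.exists_realizes code π hblk h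
  have hinj := blockQubit_injective (t := t) π hblk
  refine hr.krausBy (Loc_helperQubits_le π) (onQubits_mem_offTraps hinj
    (fun i j => (codeQubit_ne_trapQubit π _ _ j).symm) _) ?_
  rw [← onQubits_conjTranspose, ← onQubits_mul hinj, hL, onQubits_one]

theorem LogicalGate.mat_unitary (g : LogicalGate k) : g.matᴴ * g.mat = 1 := by
  cases g with
  | H a =>
    rw [LogicalGate.mat, ← onQubit_conjTranspose, ← onQubit_mul, gateH_conjTranspose,
      gateH_mul_self, onQubit_one]
  | S a =>
    rw [LogicalGate.mat, ← onQubit_conjTranspose, ← onQubit_mul, gateS_unitary, onQubit_one]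
  | T a =>
    rw [LogicalGate.mat, ← onQubit_conjTranspose, ← onQubit_mul, gateT_unitary, onQubit_one]
  | CNOT a a' h =>
    refine ctrl_unitary (fun C => onQubit_commute h C gateX) ?_
    rw [← onQubit_conjTranspose, ← onQubit_mul, gateX_conjTranspose, gateX_mul_self, onQubit_one]

theorem circuitMat_unitary (G : List (LogicalGate k)) : (circuitMat G)ᴴ * circuitMat G = 1 := by
  induction G with
  | nil => simp [circuitMat]
  | cons g G ih =>
    rw [circuitMat, Matrix.conjTranspose_mul, mul_assoc, ← mul_assoc (circuitMat G)ᴴ, ih, one_mul,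
      g.mat_unitary]

theorem toZBasis_unitary {n : ℕ} (P : PauliString n) : (tens P.toZBasis)ᴴ * tens P.toZBasis = 1 := by
  rw [tens_conjTranspose, tens_mul, ← tens_one]
  congr 1
  funext j
  unfold PauliString.toZBasis
  split_ifs
  · simp
  · rw [gateH_conjTranspose, gateH_mul_self]
  · rw [Matrix.conjTranspose_mul, Matrix.conjTranspose_conjTranspose, gateH_conjTranspose, mul_assoc,
      ← mul_assoc gateH, gateH_mul_self, one_mul, gateS_unitary']

namespace Protocol

variable {p : Protocol r k t}

/-- The steps of magic-state injection after the supply of the magic state. -/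
def injectRest (p : Protocol r k t) (a : Fin k) : Chan (Qubit (r + k) t) :=
  runAll
    [ (p.lib.inject a).exec p.code p.place id,
      conjBy (onQubits (codeQubit p.place true) (tens (p.code.zbar a).toZBasis)),
      measureAll (codeQubit p.place true) fun s =>
        applyIf (zOutcome (p.code.zbar a) s) ((p.lib.s a).exec p.code p.place fun _ => false) ]

theorem unit_injective {α : Type} (b : α) : Function.Injective fun _ : Unit => b :=
  fun _ _ _ => rfl

theorem krausBy_injectRest (hlib : p.lib.Valid p.code) (a : Fin k) :
    KrausBy (offTraps p.place) (p.injectRest a) := by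
  refine KrausBy.runAll fun c hc => ?_
  simp only [List.mem_cons, List.not_mem_nil, or_false] at hc
  rcases hc with rfl | rfl | rfl
  · exact Impl.krausBy p.place Function.injective_id (hlib.inject a)
  · refine KrausBy.conjBy (codeQubit_mem_offTraps p.place true _) ?_
    rw [← onQubits_conjTranspose, ← onQubits_mul (codeQubit_injective p.place true),
      toZBasis_unitary, onQubits_one]
  · exact KrausBy.measureAll (codeQubit_injective p.place true)
      (codeQubit_mem_offTraps p.place true)
      fun s => (Impl.krausBy p.place (unit_injective false) (hlib.s a)).applyIf _

/-- The factory supplies density operators. -/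
def FactoryDensity (p : Protocol r k t) : Prop := ∀ i a, IsDensity (p.factory i a)

theorem krausBy_execGate (hlib : p.lib.Valid p.code) (hfac : p.FactoryDensity) (i : ℕ)
    (g : LogicalGate k) : KrausBy (offTraps p.place) (p.execGate i g) := by
  cases g with
  | H a => exact Impl.krausBy p.place (unit_injective false) (hlib.h a)
  | S a => exact Impl.krausBy p.place (unit_injective false) (hlib.s a)
  | CNOT a a' h => exact Impl.krausBy p.place (unit_injective false) (hlib.cnot a a' h)
  | T a =>
    exact (KrausBy.prepare (codeQubit_injective p.place true)
      (codeQubit_mem_offTraps p.place true) (hfac i a)).comp (krausBy_injectRest hlib a)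

theorem execGates_cons (i : ℕ) (g : LogicalGate k) (G : List (LogicalGate k))
    (ρ : Op (Qubit (r + k) t)) :
    p.execGates i (g :: G) ρ = p.execGates (i + 1) G (p.execGate i g ρ) := by
  have h : conjBy (onQubits (trapQubit p.place) 1) (p.execGate i g ρ) = p.execGate i g ρ := by
    rw [onQubits_one, conjBy, one_mul, Matrix.conjTranspose_one, mul_one]
  simp only [execGates, runAll, id, h]

theorem krausBy_execGates (hlib : p.lib.Valid p.code) (hfac : p.FactoryDensity) (i : ℕ)
    (G : List (LogicalGate k)) : KrausBy (offTraps p.place) (p.execGates i G) := by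
  induction G generalizing i with
  | nil => exact KrausBy.id
  | cons g G ih =>
    have h := (krausBy_execGate hlib hfac i g).comp (ih (i + 1))
    have e : p.execGates i (g :: G) = fun ρ => p.execGates (i + 1) G (p.execGate i g ρ) :=
      funext fun ρ => execGates_cons i g G ρ
    rwa [e]

theorem encodes_execGate (hlib : p.lib.Valid p.code) {i : ℕ} {g : LogicalGate k}
    (hfac : ∀ a, p.factory i a = p.code.magicState a) {φ : (Fin k → Bool) → ℂ}
    (hφ : ∑ x, ‖φ x‖ ^ 2 = 1) {ρ : Op (Qubit (r + k) t)} (hρ : Encodes p.code p.place φ ρ) :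
    Encodes p.code p.place (g.mat *ᵥ φ) (p.execGate i g ρ) := by
  cases g with
  | H a => exact hρ.exec (by rw [LogicalGate.mat, onQubit_block]; exact hlib.h a)
  | S a => exact hρ.exec (by rw [LogicalGate.mat, onQubit_block]; exact hlib.s a)
  | CNOT a a' h =>
    refine hρ.exec ?_
    rw [LogicalGate.mat, onQubits_unit_ctrl (StabilizerCode.block_injective ()), onQubit_block]
    exact hlib.cnot a a' h
  | T a => exact encodes_injectT hlib (hfac a) hφ hρ

theorem encodes_execGates (hlib : p.lib.Valid p.code)
    (hfac : ∀ i a, p.factory i a = p.code.magicState a) (i : ℕ) (G : List (LogicalGate k))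
    {φ : (Fin k → Bool) → ℂ} (hφ : ∑ x, ‖φ x‖ ^ 2 = 1) {ρ : Op (Qubit (r + k) t)}
    (hρ : Encodes p.code p.place φ ρ) :
    Encodes p.code p.place (circuitMat G *ᵥ φ) (p.execGates i G ρ) := by
  induction G generalizing i φ ρ with
  | nil => rw [circuitMat, Matrix.one_mulVec]; exact hρ
  | cons g G ih =>
    rw [execGates_cons, circuitMat, ← Matrix.mulVec_mulVec]
    exact ih (i + 1) (by rw [sum_norm_sq_mulVec g.mat_unitary, hφ])
      (encodes_execGate hlib (hfac i) hφ hρ)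

theorem krausBy_syndromeStep (code : StabilizerCode r k) (π : Placement (r + k) t)
    (i : Fin (r + k)) : KrausBy (offTraps π) (syndromeStep code π i) := by
  have hcomm := commute_onQubit_syn_blockOp code π i i
  refine (realizes_syndromeStep code π i).krausBy
    (le_trans (Loc_mono linkQubits_subset) (Loc_helperQubits_le π)) (ctrl_mem ?_ ?_)
    (ctrl_unitary hcomm ?_)
  · intro B
    rw [← onQubits_onQubit syn_injective]
    exact syn_mem_offTraps π _
  · exact codeQubit_mem_offTraps π false _
  · rw [blockOp, ← onQubits_conjTranspose, PauliString.mat_conjTranspose]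
    exact blockOp_mul_self code π i

theorem krausBy_distributedEncoding (code : StabilizerCode r k) (π : Placement (r + k) t)
    (C : (Fin (r + k) → Bool) → PauliString (r + k)) :
    KrausBy (offTraps π) (distributedEncoding π code.ops C) := by
  refine KrausBy.runAll fun c hc => ?_
  simp only [List.mem_append, List.mem_cons, List.not_mem_nil, or_false, List.mem_map] at hc
  rcases hc with ((rfl | rfl) | ⟨i, -, rfl⟩) | rfl | rfl
  · exact krausBy_prepare_syn (syn_mem_offTraps π)
  · exact KrausBy.prepare (codeQubit_injective π false) (codeQubit_mem_offTraps π false)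
      (isDensity_ket _)
  · exact krausBy_syndromeStep code π i
  · refine KrausBy.conjBy (syn_mem_offTraps π _) ?_
    rw [← onQubits_conjTranspose, ← onQubits_mul syn_injective, tens_conjTranspose, tens_mul]
    simp only [gateH_conjTranspose, gateH_mul_self]
    rw [tens_one, onQubits_one]
  · refine KrausBy.measureAll syn_injective (syn_mem_offTraps π) fun m =>
      KrausBy.conjBy (codeQubit_mem_offTraps π false _) ?_
    rw [← onQubits_conjTranspose, ← onQubits_mul (codeQubit_injective π false),
      PauliString.mat_conjTranspose, PauliString.mat_mul_self, onQubits_one]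

theorem trapBasis_conjTranspose : (p.trapBasis)ᴴ = p.trapBasis := by
  rw [trapBasis, tens_conjTranspose]
  congr 1
  funext i
  split_ifs
  · exact gateH_conjTranspose
  · exact Matrix.conjTranspose_one

theorem trapBasis_mul_self : p.trapBasis * p.trapBasis = 1 := by
  rw [trapBasis, tens_mul, ← tens_one]
  congr 1
  funext i
  split_ifs
  · exact gateH_mul_self
  · exact one_mul 1

/-- The state of the traps. -/
def trapState (p : Protocol r k t) : Op (Fin t) := pureState (p.trapBasis *ᵥ ket p.trapValue)

theorem sum_norm_sq_trap : ∑ x, ‖(p.trapBasis *ᵥ ket p.trapValue) x‖ ^ 2 = 1 := by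
  rw [sum_norm_sq_mulVec, sum_norm_sq_ket]
  rw [trapBasis_conjTranspose, trapBasis_mul_self]

/-- The network after preparation of the traps and encoding. -/
def initialState (p : Protocol r k t) : Op (Qubit (r + k) t) :=
  distributedEncoding p.place p.code.ops p.table
    (prepare (trapQubit p.place) p.trapState (pureState (ket fun _ => false)))

theorem isDensity_initialState : IsDensity p.initialState := by
  refine (krausBy_distributedEncoding p.code p.place p.table).isDensity ?_
  exact (KrausBy.prepare (M := ⊤) (trapQubit_injective p.place) (fun _ => Algebra.mem_top)
    (isDensity_pureState sum_norm_sq_trap)).isDensity (isDensity_ket _)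

/-- The traps are prepared first and everything afterwards acts off them, so the projector onto
their state still fixes the network state, whatever the quality of the magic states. -/
theorem trapState_mul_mainState (hlib : p.lib.Valid p.code) (hfac : p.FactoryDensity) :
    onQubits (trapQubit p.place) p.trapState * p.mainState = p.mainState := by
  have hoff : onQubits (trapQubit p.place) p.trapState ∈ Off (Set.range (trapQubit p.place))ᶜ :=
    onQubits_mem_Off (trapQubit_injective p.place) (fun i => Set.notMem_compl_iff.2 (Set.mem_range_self i)) _
  exact (krausBy_execGates hlib hfac 0 p.gates).mul_eq hoff
    ((krausBy_distributedEncoding p.code p.place p.table).mul_eq hoff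
      (mul_prepare_eq (trapQubit_injective p.place) (pureState_mul_self sum_norm_sq_trap) _))

theorem encodes_mainState (hp : p.Valid) (hfac : ∀ i a, p.factory i a = p.code.magicState a) :
    Encodes p.code p.place (circuitMat p.gates *ᵥ ket fun _ => false) p.mainState :=
  encodes_execGates hp.2 hfac 0 p.gates (sum_norm_sq_ket _) (encodes_distributedEncoding _ hp.1 _)

theorem FactoryWithin.density {δ : ℝ} (h : p.FactoryWithin δ) : p.FactoryDensity :=
  fun i a => (h i a).1

theorem factoryDensity_perfect : p.withPerfectFactory.FactoryDensity :=
  fun _ a => isDensity_magicState p.code a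

theorem FactoryWithin.close {δ : ℝ} (h : p.FactoryWithin δ) (i : ℕ) (a : Fin k) :
    Close (p.factory i a) (p.code.magicState a) δ :=
  Close.of_traceDist_le ((h i a).1.1.isHermitian.sub (isDensity_magicState p.code a).1.isHermitian)
    (h i a).2

/-- The two runs differ only in the state supplied for a `T` gate; the rest of the injection is one
and the same channel and cannot increase the distance. -/
theorem close_execGate {δ : ℝ} (hlib : p.lib.Valid p.code) (h : p.FactoryWithin δ) (i : ℕ)
    (g : LogicalGate k) {ρ : Op (Qubit (r + k) t)} (hρ : IsDensity ρ) :
    Close (p.execGate i g ρ) (p.withPerfectFactory.execGate i g ρ)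
      (if g.isT then δ else 0) := by
  cases g with
  | H a => exact Close.refl _
  | S a => exact Close.refl _
  | CNOT a a' _ => exact Close.refl _
  | T a =>
    exact (krausBy_injectRest hlib a).close
      (Close.prepare (codeQubit_injective p.place true) (h.close i a) hρ)

/-- Hybrid argument: the first gate is replaced by its perfect version and the error is carried
through the remaining imperfect gates; induction then treats those from the perfect intermediate
state. -/
theorem close_execGates {δ : ℝ} (hlib : p.lib.Valid p.code) (h : p.FactoryWithin δ) (i : ℕ)
    (G : List (LogicalGate k)) {ρ : Op (Qubit (r + k) t)} (hρ : IsDensity ρ) :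
    Close (p.execGates i G ρ) (p.withPerfectFactory.execGates i G ρ)
      (G.countP LogicalGate.isT * δ) := by
  induction G generalizing i ρ with
  | nil =>
    have h0 : Close (p.execGates i [] ρ) (p.withPerfectFactory.execGates i [] ρ) 0 := Close.refl ρ
    simpa using h0
  | cons g G ih =>
    rw [execGates_cons, execGates_cons]
    refine (((krausBy_execGates hlib h.density (i + 1) G).close
      (close_execGate hlib h i g hρ)).trans (ih (i + 1) ((krausBy_execGate (p := p.withPerfectFactory)
        hlib factoryDensity_perfect i g).isDensity hρ))).mono (le_of_eq ?_)
    rw [List.countP_cons]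
    split_ifs <;> push_cast <;> ring

theorem close_mainState {δ : ℝ} (hlib : p.lib.Valid p.code) (h : p.FactoryWithin δ) :
    Close p.mainState p.withPerfectFactory.mainState (p.gates.countP LogicalGate.isT * δ) :=
  close_execGates hlib h 0 p.gates isDensity_initialState

theorem isDensity_mainState (hlib : p.lib.Valid p.code) (hfac : p.FactoryDensity) :
    IsDensity p.mainState :=
  (krausBy_execGates hlib hfac 0 p.gates).isDensity isDensity_initialState

end Protocol

end Execution

section HandOver
set_option linter.unusedSectionVars false
set_option linter.unusedDecidableInType false
set_option linter.unusedFintypeInType false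

/-! ### Handing over qubits to the client -/

variable {Q : Type} [Fintype Q] [DecidableEq Q] {ι : Type} [Fintype ι] [DecidableEq ι]
  {κ : Type} [Fintype κ] [DecidableEq κ]

/-- The Kraus operator of `handOver e K`. -/
def handMat (e : ι → Q) (K : Matrix κ (ι → Bool) ℂ) : Matrix (κ × (Q → Bool)) (Q → Bool) ℂ :=
  Matrix.of fun p x => if (∀ i, p.2 (e i) = false) ∧ ∀ q, (∀ i, e i ≠ q) → p.2 q = x q then
    K p.1 fun i => x (e i) else 0

theorem handMat_mul_apply {m : Type} {e : ι → Q} (he : Function.Injective e)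
    (K : Matrix κ (ι → Bool) ℂ) (M : Matrix (Q → Bool) m ℂ) (p : κ × (Q → Bool)) (y : m) :
    (handMat e K * M) p y = if ∀ i, p.2 (e i) = false then
      ∑ d : ι → Bool, K p.1 d * M (Function.extend e d p.2) y else 0 := by
  rw [Matrix.mul_apply]
  by_cases h : ∀ i, p.2 (e i) = false
  · rw [if_pos h]
    have := sum_agree_off he p.2 fun z => K p.1 (fun i => z (e i)) * M z y
    simp only [extend_comp_self he] at this
    rw [← this]
    refine Finset.sum_congr rfl fun z _ => ?_
    simp only [handMat, Matrix.of_apply, h, implies_true, true_and, ite_mul, zero_mul]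
  · rw [if_neg h]
    refine Finset.sum_eq_zero fun z _ => ?_
    simp only [handMat, Matrix.of_apply]
    rw [if_neg (fun h' => h h'.1), zero_mul]

theorem mul_handMat_conjTranspose_apply {m : Type} {e : ι → Q} (he : Function.Injective e)
    (K : Matrix κ (ι → Bool) ℂ) (M : Matrix m (Q → Bool) ℂ) (p : κ × (Q → Bool)) (x : m) :
    (M * (handMat e K)ᴴ) x p = if ∀ i, p.2 (e i) = false then
      ∑ d : ι → Bool, M x (Function.extend e d p.2) * star (K p.1 d) else 0 := by
  have h := handMat_mul_apply he K Mᴴ p x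
  have h2 : (M * (handMat e K)ᴴ) x p = star ((handMat e K * Mᴴ) p x) := by
    rw [← Matrix.conjTranspose_apply, Matrix.conjTranspose_mul, Matrix.conjTranspose_conjTranspose]
  rw [h2, h]
  split_ifs
  · rw [star_sum]
    refine Finset.sum_congr rfl fun d _ => ?_
    rw [star_mul', Matrix.conjTranspose_apply, star_star, mul_comm]
  · exact star_zero _

theorem handOver_eq {e : ι → Q} (he : Function.Injective e) (K : Matrix κ (ι → Bool) ℂ)
    (ρ : Op Q) : handOver e K ρ = handMat e K * ρ * (handMat e K)ᴴ := by
  ext p q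
  rw [mul_handMat_conjTranspose_apply he]
  simp only [handMat_mul_apply he, handOver, Matrix.of_apply]
  by_cases h : ∀ i, p.2 (e i) = false <;> by_cases h' : ∀ i, q.2 (e i) = false
  · rw [if_pos ⟨h, h'⟩, if_pos h']
    simp only [if_pos h, Finset.sum_mul]
    rw [Finset.sum_comm]
  · rw [if_neg (fun hh => h' hh.2), if_neg h']
  · rw [if_neg (fun hh => h hh.1), if_pos h']
    simp [h]
  · rw [if_neg (fun hh => h' hh.2), if_neg h']

theorem handMat_mul_onQubits {e : ι → Q} (he : Function.Injective e) (K : Matrix κ (ι → Bool) ℂ)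
    (A : Op ι) : handMat e K * onQubits e A = handMat e (K * A) := by
  ext p y
  rw [handMat_mul_apply he]
  simp only [handMat, Matrix.of_apply, Matrix.mul_apply]
  by_cases h : ∀ i, p.2 (e i) = false
  · rw [if_pos h]
    by_cases h' : ∀ q, (∀ i, e i ≠ q) → p.2 q = y q
    · rw [if_pos ⟨h, h'⟩]
      refine Finset.sum_congr rfl fun d _ => ?_
      simp only [onQubits, Matrix.of_apply, extend_comp_self he]
      rw [if_pos]
      intro q hq
      rw [Function.extend_apply' _ _ _ (by simpa using hq), h' q hq]
    · rw [if_neg (fun hh => h' hh.2)]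
      refine Finset.sum_eq_zero fun d _ => ?_
      simp only [onQubits, Matrix.of_apply]
      rw [if_neg, mul_zero]
      intro hh
      refine h' fun q hq => ?_
      rw [← hh q hq, Function.extend_apply' _ _ _ (by simpa using hq)]
  · rw [if_neg h, if_neg (fun hh => h hh.1)]

/-- Emptied qubits are reset to `|0⟩` and the others copied, so exactly one final configuration
contributes for each output label; completeness of the hand-over reduces to that of the operators
`K`. -/
theorem handMat_conjTranspose_mul {e : ι → Q} (he : Function.Injective e)
    (K : Matrix κ (ι → Bool) ℂ) : (handMat e K)ᴴ * handMat e K = onQubits e (Kᴴ * K) := by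
  ext x y
  simp only [Matrix.mul_apply, Fintype.sum_prod_type, onQubits, Matrix.of_apply,
    Matrix.conjTranspose_apply]
  set z : Q → Bool := Function.extend e (fun _ => false) x with hz
  have hze : ∀ i, z (e i) = false := fun i => he.extend_apply _ _ _
  have hzx : ∀ q, (∀ i, e i ≠ q) → z q = x q := fun q hq =>
    Function.extend_apply' _ _ _ (by simpa using hq)
  have key : ∀ o, ∑ w, star (handMat e K (o, w) x) * handMat e K (o, w) y =
      if ∀ q, (∀ i, e i ≠ q) → x q = y q then
        star (K o fun i => x (e i)) * K o (fun i => y (e i)) else 0 := fun o => by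
    rw [Finset.sum_eq_single z]
    · simp only [handMat, Matrix.of_apply]
      rw [if_pos ⟨hze, hzx⟩]
      by_cases h : ∀ q, (∀ i, e i ≠ q) → x q = y q
      · rw [if_pos h, if_pos ⟨hze, fun q hq => (hzx q hq).trans (h q hq)⟩]
      · rw [if_neg h, if_neg, mul_zero]
        rintro ⟨-, h'⟩
        exact h fun q hq => (hzx q hq).symm.trans (h' q hq)
    · intro w _ hw
      simp only [handMat, Matrix.of_apply]
      rw [if_neg, star_zero, zero_mul]
      rintro ⟨h1, h2⟩
      apply hw
      rw [hz, eq_comm, extend_eq_iff he]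
      exact ⟨fun i => (h1 i).symm, fun q hq => (h2 q hq).symm⟩
    · simp
  simp only [key]
  split_ifs
  · rfl
  · simp

theorem trace_handOver {e : ι → Q} (he : Function.Injective e) (K : Matrix κ (ι → Bool) ℂ)
    (ρ : Op Q) : (handOver e K ρ).trace = (onQubits e (Kᴴ * K) * ρ).trace := by
  rw [handOver_eq he, Matrix.trace_mul_comm, ← Matrix.mul_assoc, handMat_conjTranspose_mul he]

theorem handOver_posSemidef {e : ι → Q} (he : Function.Injective e) (K : Matrix κ (ι → Bool) ℂ)
    {ρ : Op Q} (hρ : ρ.PosSemidef) : (handOver e K ρ).PosSemidef := by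
  rw [handOver_eq he]
  exact hρ.mul_mul_conjTranspose_same _

theorem handOver_sub {e : ι → Q} (he : Function.Injective e) (K : Matrix κ (ι → Bool) ℂ)
    (ρ σ : Op Q) : handOver e K (ρ - σ) = handOver e K ρ - handOver e K σ := by
  rw [handOver_eq he, handOver_eq he, handOver_eq he, Matrix.mul_sub, Matrix.sub_mul]

theorem handOver_zero {e : ι → Q} (he : Function.Injective e) (K : Matrix κ (ι → Bool) ℂ) :
    handOver e K (0 : Op Q) = 0 := by
  rw [handOver_eq he, Matrix.mul_zero, Matrix.zero_mul]

/-- Kraus operators may be multiplied by an operation that fixes the state. -/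
theorem handOver_fixed {e : ι → Q} (he : Function.Injective e) (K : Matrix κ (ι → Bool) ℂ)
    {A : Op ι} {ρ : Op Q} (hρ : ρ.IsHermitian) (h : onQubits e A * ρ = ρ) :
    handOver e K ρ = handOver e (K * A) ρ := by
  -- Taking adjoints of `A ρ = ρ` lets a Hermitian `ρ` absorb the operator on both sides.
  have h2 : ρ = onQubits e A * ρ * (onQubits e A)ᴴ := by
    have := congrArg Matrix.conjTranspose h
    rw [Matrix.conjTranspose_mul, hρ.eq] at this
    rw [h, this]
  rw [handOver_eq he, handOver_eq he, ← handMat_mul_onQubits he, Matrix.conjTranspose_mul]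
  conv_lhs => rw [h2]
  simp only [Matrix.mul_assoc]

theorem handOver_zero_left {e : ι → Q} (he : Function.Injective e) (ρ : Op Q) :
    handOver e (0 : Matrix κ (ι → Bool) ℂ) ρ = 0 := by
  have : handMat e (0 : Matrix κ (ι → Bool) ℂ) = 0 := by
    ext p x
    simp [handMat]
  rw [handOver_eq he, this, Matrix.zero_mul, Matrix.zero_mul]

/-- The state left behind when the qubits listed by `e` are projected to `w` and taken away. -/
def leftBehind (e : ι → Q) (w : (ι → Bool) → ℂ) (ρ : Op Q) : Op Q :=
  Matrix.of fun x y => if (∀ i, x (e i) = false) ∧ (∀ i, y (e i) = false) then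
    ∑ d : ι → Bool, ∑ d' : ι → Bool,
      star (w d) * ρ (Function.extend e d x) (Function.extend e d' y) * w d' else 0

/-- A rank-one Kraus operator always outputs the same vector `v`, so nothing correlates the output
with what stays behind. -/
theorem handOver_vecMulVec (e : ι → Q) (v : κ → ℂ) (w : (ι → Bool) → ℂ) (ρ : Op Q) :
    handOver e (Matrix.vecMulVec v (star w)) ρ =
      Matrix.kroneckerMap (· * ·) (pureState v) (leftBehind e w ρ) := by
  ext p q
  simp only [handOver, leftBehind, Matrix.of_apply, Matrix.kroneckerMap_apply, pureState,
    Matrix.vecMulVec_apply, Pi.star_apply]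
  split_ifs
  · rw [Finset.mul_sum]
    refine Finset.sum_congr rfl fun d _ => ?_
    rw [Finset.mul_sum]
    refine Finset.sum_congr rfl fun d' _ => ?_
    rw [star_mul', star_star]
    ring
  · rw [mul_zero]

end HandOver

/-! ### Partial traces and products -/

section PartialTrace
set_option linter.unusedSectionVars false
set_option linter.unusedDecidableInType false
set_option linter.unusedFintypeInType false

variable {κ m : Type} [Fintype κ] [DecidableEq κ] [Fintype m] [DecidableEq m]

/-- The partial trace over the second factor. -/
def traceRight (ρ : Matrix (κ × m) (κ × m) ℂ) : Matrix κ κ ℂ :=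
  Matrix.of fun o o' => ∑ x, ρ (o, x) (o', x)

/-- The partial trace over the first factor. -/
def traceLeft (ρ : Matrix (κ × m) (κ × m) ℂ) : Matrix m m ℂ :=
  Matrix.of fun x y => ∑ o, ρ (o, x) (o, y)

theorem traceRight_eq (ρ : Matrix (κ × m) (κ × m) ℂ) :
    traceRight ρ = ∑ x, ρ.submatrix (fun o => (o, x)) fun o => (o, x) := by
  ext o o'
  simp [traceRight, Matrix.sum_apply]

theorem traceLeft_eq (ρ : Matrix (κ × m) (κ × m) ℂ) :
    traceLeft ρ = ∑ o, ρ.submatrix (fun x => (o, x)) fun x => (o, x) := by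
  ext o o'
  simp [traceLeft, Matrix.sum_apply]

theorem traceRight_posSemidef {ρ : Matrix (κ × m) (κ × m) ℂ} (hρ : ρ.PosSemidef) :
    (traceRight ρ).PosSemidef := by
  rw [traceRight_eq]
  exact Matrix.posSemidef_sum _ fun _ _ => hρ.submatrix _

theorem traceLeft_posSemidef {ρ : Matrix (κ × m) (κ × m) ℂ} (hρ : ρ.PosSemidef) :
    (traceLeft ρ).PosSemidef := by
  rw [traceLeft_eq]
  exact Matrix.posSemidef_sum _ fun _ _ => hρ.submatrix _

theorem trace_traceRight (ρ : Matrix (κ × m) (κ × m) ℂ) : (traceRight ρ).trace = ρ.trace := by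
  simp [traceRight, Matrix.trace, Fintype.sum_prod_type]

theorem trace_traceLeft (ρ : Matrix (κ × m) (κ × m) ℂ) : (traceLeft ρ).trace = ρ.trace := by
  simp only [traceLeft, Matrix.trace, Fintype.sum_prod_type, Matrix.diag_apply, Matrix.of_apply]
  exact Finset.sum_comm

theorem traceRight_kronecker (A : Matrix κ κ ℂ) (B : Matrix m m ℂ) :
    traceRight (Matrix.kroneckerMap (· * ·) A B) = B.trace • A := by
  ext o o'
  simp [traceRight, Matrix.trace, mul_comm, Finset.mul_sum]

theorem traceLeft_kronecker (A : Matrix κ κ ℂ) (B : Matrix m m ℂ) :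
    traceLeft (Matrix.kroneckerMap (· * ·) A B) = A.trace • B := by
  ext o o'
  simp [traceLeft, Matrix.trace, Finset.sum_mul]

theorem Close.traceRight {ρ σ : Matrix (κ × m) (κ × m) ℂ} {d : ℝ} (h : Close ρ σ d) :
    Close (DQC.traceRight ρ) (DQC.traceRight σ) d :=
  h.map DQC.traceRight (fun A B => by ext; simp [DQC.traceRight])
    (fun _ => traceRight_posSemidef) trace_traceRight

theorem Close.kronecker {ρ σ : Matrix κ κ ℂ} {d : ℝ} (h : Close ρ σ d) {τ : Matrix m m ℂ}
    (hτ : IsDensity τ) :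
    Close (Matrix.kroneckerMap (· * ·) ρ τ) (Matrix.kroneckerMap (· * ·) σ τ) d :=
  h.map (fun ρ => Matrix.kroneckerMap (· * ·) ρ τ)
    (fun A B => by ext; simp [sub_mul])
    (fun A hA => hA.kronecker hτ.1)
    fun A => by
      rw [Matrix.trace_kronecker, hτ.2, mul_one]

end PartialTrace

section Completeness
set_option linter.unusedSectionVars false
set_option linter.unusedDecidableInType false
set_option linter.unusedFintypeInType false

/-! ### Verification, output and completeness -/

variable {r k t : ℕ}

namespace Protocol

variable (p : Protocol r k t)

/-- The Kraus operator of the trap outcomes `s`. -/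
def trapKraus (s : Fin t → Bool) : Op (Qubit (r + k) t) :=
  onQubits (trapQubit p.place) (pureState (ket s) * p.trapBasis)

theorem checkedState_eq (s : Fin t → Bool) :
    p.checkedState s = conjBy (p.trapKraus s) p.mainState := by
  rw [checkedState, conjBy_conjBy, trapKraus, onQubits_mul (trapQubit_injective p.place)]

theorem trapKraus_conjTranspose_mul (s : Fin t → Bool) : (p.trapKraus s)ᴴ * p.trapKraus s =
    onQubits (trapQubit p.place) (pureState (p.trapBasis *ᵥ ket s)) := by
  rw [trapKraus, ← onQubits_conjTranspose, ← onQubits_mul (trapQubit_injective p.place),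
    ← mul_pureState, Matrix.conjTranspose_mul, pureState_conjTranspose, mul_assoc,
    ← mul_assoc (pureState _), pureState_ket_mul_self, trapBasis_conjTranspose, mul_assoc]

theorem sum_trapKraus : ∑ s, (p.trapKraus s)ᴴ * p.trapKraus s = 1 := by
  simp only [trapKraus_conjTranspose_mul, ← mul_pureState]
  rw [← onQubits_sum, ← Finset.sum_mul, ← Finset.mul_sum, sum_pureState_ket, mul_one,
    trapBasis_conjTranspose, trapBasis_mul_self, onQubits_one]

theorem trace_checkedState (s : Fin t → Bool) : (p.checkedState s).trace =
    (onQubits (trapQubit p.place) (pureState (p.trapBasis *ᵥ ket s)) * p.mainState).trace := by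
  rw [checkedState_eq, conjBy, Matrix.trace_mul_comm, ← mul_assoc, trapKraus_conjTranspose_mul]

/-- The verification and output stage, applied to a state `ρ` of the network. -/
def finish (ρ : Op (Qubit (r + k) t)) :
    Matrix (Option (Fin k → Bool) × (Qubit (r + k) t → Bool))
      (Option (Fin k → Bool) × (Qubit (r + k) t → Bool)) ℂ :=
  handOver (codeQubit p.place false) p.keepOp (conjBy (p.trapKraus p.trapValue) ρ) +
  ∑ d, handOver (codeQubit p.place false) (errOp (1 - p.code.enc * p.code.encᴴ) d)
    (conjBy (p.trapKraus p.trapValue) ρ) +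
  ∑ s ∈ Finset.univ.erase p.trapValue, ∑ d,
    handOver (codeQubit p.place false) (errOp 1 d) (conjBy (p.trapKraus s) ρ)

theorem jointState_eq : p.jointState = p.finish p.mainState := by
  simp only [jointState, finish, checkedState_eq]

theorem conjBy_sub {Q : Type} [Fintype Q] [DecidableEq Q] (A ρ σ : Op Q) :
    conjBy A (ρ - σ) = conjBy A ρ - conjBy A σ := by
  rw [conjBy, conjBy, conjBy, mul_sub, sub_mul]

theorem finish_sub (ρ σ : Op (Qubit (r + k) t)) :
    p.finish (ρ - σ) = p.finish ρ - p.finish σ := by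
  simp only [finish, conjBy_sub, handOver_sub (codeQubit_injective p.place false),
    Finset.sum_sub_distrib]
  abel

theorem finish_posSemidef {ρ : Op (Qubit (r + k) t)} (hρ : ρ.PosSemidef) :
    (p.finish ρ).PosSemidef := by
  have h : ∀ s, (conjBy (p.trapKraus s) ρ).PosSemidef := fun s => hρ.mul_mul_conjTranspose_same _
  have hi := codeQubit_injective p.place false
  exact ((handOver_posSemidef hi _ (h _)).add
    (Matrix.posSemidef_sum _ fun d _ => handOver_posSemidef hi _ (h _))).add
    (Matrix.posSemidef_sum _ fun s _ => Matrix.posSemidef_sum _ fun d _ =>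
      handOver_posSemidef hi _ (h s))

theorem keepOp_conjTranspose_mul : p.keepOpᴴ * p.keepOp = p.code.enc * p.code.encᴴ := by
  ext x y
  simp [Matrix.mul_apply, Fintype.sum_option, keepOp]

theorem sum_errOp_conjTranspose_mul (A : Op (Fin (r + k))) :
    ∑ d, (errOp (k := k) A d)ᴴ * errOp (k := k) A d = Aᴴ * A := by
  ext x y
  simp [Matrix.sum_apply, Matrix.mul_apply, Fintype.sum_option, errOp]

theorem encProj_mul_self : (1 - p.code.enc * p.code.encᴴ)ᴴ * (1 - p.code.enc * p.code.encᴴ) =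
    1 - p.code.enc * p.code.encᴴ := by
  have h : p.code.enc * p.code.encᴴ * (p.code.enc * p.code.encᴴ) = p.code.enc * p.code.encᴴ := by
    rw [Matrix.mul_assoc, ← Matrix.mul_assoc p.code.encᴴ, p.code.enc_conjTranspose_mul_enc,
      Matrix.one_mul]
  rw [Matrix.conjTranspose_sub, Matrix.conjTranspose_one, Matrix.conjTranspose_mul,
    Matrix.conjTranspose_conjTranspose, mul_sub, sub_mul, sub_mul, h, mul_one, mul_one, one_mul]
  abel

/-- Decoding and rejection outside the codespace are complementary, the error operators for a failed
trap are complete, and so are the trap measurements over all outcomes. -/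
theorem trace_finish (ρ : Op (Qubit (r + k) t)) : (p.finish ρ).trace = ρ.trace := by
  have hi := codeQubit_injective p.place false
  have h1 : ∀ σ : Op (Qubit (r + k) t),
      ∑ d, (handOver (codeQubit p.place false) (errOp (k := k) 1 d) σ).trace = σ.trace := fun σ => by
    simp only [trace_handOver hi]
    rw [← Matrix.trace_sum, ← Finset.sum_mul, ← onQubits_sum, sum_errOp_conjTranspose_mul,
      Matrix.conjTranspose_one, mul_one, onQubits_one, one_mul]
  have h2 : ∀ σ : Op (Qubit (r + k) t),
      (handOver (codeQubit p.place false) p.keepOp σ).trace +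
      ∑ d, (handOver (codeQubit p.place false)
        (errOp (k := k) (1 - p.code.enc * p.code.encᴴ) d) σ).trace = σ.trace := fun σ => by
    simp only [trace_handOver hi]
    rw [← Matrix.trace_sum, ← Finset.sum_mul, ← onQubits_sum, sum_errOp_conjTranspose_mul,
      keepOp_conjTranspose_mul, encProj_mul_self, ← Matrix.trace_add, ← add_mul, ← onQubits_add,
      add_sub_cancel, onQubits_one, one_mul]
  rw [finish, Matrix.trace_add, Matrix.trace_add, Matrix.trace_sum, Matrix.trace_sum, h2]
  simp only [Matrix.trace_sum, h1]
  rw [Finset.add_sum_erase _ (fun s => (conjBy (p.trapKraus s) ρ).trace) (Finset.mem_univ _)]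
  have h3 : ∀ s, (conjBy (p.trapKraus s) ρ).trace =
      ((p.trapKraus s)ᴴ * p.trapKraus s * ρ).trace := fun s => by
    rw [conjBy, Matrix.trace_mul_comm, ← mul_assoc]
  simp only [h3]
  rw [← Matrix.trace_sum, ← Finset.sum_mul, sum_trapKraus, one_mul]

variable {p}

/-- The acceptance projector is the one that fixes the main state, so accepting loses no trace. -/
theorem acceptProb_eq_one (hlib : p.lib.Valid p.code) (hfac : p.FactoryDensity) :
    p.acceptProb = 1 := by
  rw [acceptProb, trace_checkedState]
  exact (congrArg Matrix.trace (trapState_mul_mainState hlib hfac)).trans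
    (isDensity_mainState hlib hfac).2

/-- A wrong outcome projects onto a basis state orthogonal to the prepared one. -/
theorem checkedState_eq_zero (hlib : p.lib.Valid p.code) (hfac : p.FactoryDensity)
    {s : Fin t → Bool} (hs : s ≠ p.trapValue) : p.checkedState s = 0 := by
  have h : p.trapKraus s * p.mainState = 0 := by
    rw [← trapState_mul_mainState hlib hfac, ← mul_assoc, trapKraus,
      ← onQubits_mul (trapQubit_injective p.place), trapState, ← mul_pureState, ← mul_assoc,
      ← mul_assoc, mul_assoc (pureState (ket s)), trapBasis_mul_self, mul_one]
    have : pureState (ket s) * pureState (ket p.trapValue) = 0 := by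
      ext x y
      rw [Matrix.mul_apply]
      refine Finset.sum_eq_zero fun z _ => ?_
      rw [pureState_ket_apply, pureState_ket_apply]
      split_ifs with h1 h2
      · exact absurd (h1.2.symm.trans h2.1) hs
      all_goals simp
    rw [this, zero_mul, onQubits_zero, zero_mul]
  rw [checkedState_eq, conjBy, h, zero_mul]

theorem isDensity_jointState (hlib : p.lib.Valid p.code) (hfac : p.FactoryDensity) :
    IsDensity p.jointState := by
  rw [jointState_eq]
  exact ⟨p.finish_posSemidef (isDensity_mainState hlib hfac).1,
    (p.trace_finish _).trans (isDensity_mainState hlib hfac).2⟩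

theorem isDensity_restState (hlib : p.lib.Valid p.code) (hfac : p.FactoryDensity) :
    IsDensity p.restState :=
  ⟨traceLeft_posSemidef (isDensity_jointState hlib hfac).1,
    (trace_traceLeft _).trans (isDensity_jointState hlib hfac).2⟩

theorem sum_norm_sq_elim (φ : (Fin k → Bool) → ℂ) :
    ∑ o : Option (Fin k → Bool), ‖(o.elim 0 φ : ℂ)‖ ^ 2 = ∑ x, ‖φ x‖ ^ 2 := by
  simp [Fintype.sum_option]

/-- With perfect magic states the output is uncorrelated with the rest of the network. -/
theorem jointState_of_encodes (hlib : p.lib.Valid p.code) (hfac : p.FactoryDensity)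
    {φ : (Fin k → Bool) → ℂ} (hφ : ∑ x, ‖φ x‖ ^ 2 = 1)
    (h : Encodes p.code p.place φ p.mainState) :
    p.jointState = Matrix.kroneckerMap (· * ·) (okOutput φ) p.restState := by
  have hi := codeQubit_injective p.place false
  set c := p.checkedState p.trapValue with hc
  have hfix : onQubits (codeQubit p.place false) (pureState (p.code.enc *ᵥ φ)) * c = c := by
    rw [hc, checkedState_eq]
    exact conjBy_mul_eq (onQubits_commute hi (trapQubit_injective p.place)
      (codeQubit_ne_trapQubit p.place false) _ _) h
  have hherm : c.IsHermitian := by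
    rw [hc, checkedState_eq]
    exact ((isDensity_mainState hlib hfac).1.mul_mul_conjTranspose_same _).isHermitian
  have hproj : (1 - p.code.enc * p.code.encᴴ) *ᵥ (p.code.enc *ᵥ φ) = 0 := by
    rw [Matrix.sub_mulVec, Matrix.one_mulVec, Matrix.mulVec_mulVec, Matrix.mul_assoc,
      p.code.enc_conjTranspose_mul_enc, Matrix.mul_one, sub_self]
  have hkeep : p.keepOp *ᵥ (p.code.enc *ᵥ φ) = fun o => o.elim 0 φ := by
    funext o
    cases o with
    | none => simp [keepOp, Matrix.mulVec, dotProduct]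
    | some u =>
      have h1 : (p.code.encᴴ *ᵥ (p.code.enc *ᵥ φ)) u = φ u := by
        rw [Matrix.mulVec_mulVec, p.code.enc_conjTranspose_mul_enc, Matrix.one_mulVec]
      exact h1
  -- An encoded state has no component outside the codespace, so the corresponding Kraus operators
  -- vanish on it.
  have herr : ∀ d, handOver (codeQubit p.place false)
      (errOp (k := k) (1 - p.code.enc * p.code.encᴴ) d) c = 0 := fun d => by
    have h0 : errOp (k := k) (1 - p.code.enc * p.code.encᴴ) d *
        pureState (p.code.enc *ᵥ φ) = 0 := by
      have h1 : errOp (k := k) (1 - p.code.enc * p.code.encᴴ) d *ᵥ (p.code.enc *ᵥ φ) = 0 := by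
        funext o
        cases o with
        | none => exact congrFun hproj d
        | some u => simp [errOp, Matrix.mulVec, dotProduct]
      rw [mul_pureState_eq, h1, Matrix.zero_vecMulVec]
    rw [handOver_fixed hi _ hherm hfix, h0, handOver_zero_left hi]
  have hjoint : p.jointState = Matrix.kroneckerMap (· * ·) (okOutput φ)
      (leftBehind (codeQubit p.place false) (p.code.enc *ᵥ φ) c) := by
    have hzero : ∀ s ∈ Finset.univ.erase p.trapValue, ∑ d,
        handOver (codeQubit p.place false) (errOp (k := k) 1 d) (p.checkedState s) = 0 :=
      fun s hs => Finset.sum_eq_zero fun d _ => by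
        rw [checkedState_eq_zero hlib hfac (Finset.ne_of_mem_erase hs), handOver_zero hi]
    rw [jointState, Finset.sum_eq_zero hzero, add_zero, ← hc,
      Finset.sum_eq_zero (fun d _ => herr d), add_zero, handOver_fixed hi _ hherm hfix,
      mul_pureState_eq, hkeep, handOver_vecMulVec]
    rfl
  -- The output factor has trace one, so tracing it out identifies the other factor with the
  -- remaining network state.
  have hrest : p.restState = leftBehind (codeQubit p.place false) (p.code.enc *ᵥ φ) c := by
    have h1 : p.restState = traceLeft p.jointState := rfl
    rw [h1, hjoint, traceLeft_kronecker, okOutput, trace_pureState, sum_norm_sq_elim, hφ,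
      Complex.ofReal_one, one_smul]
  rw [hrest, ← hjoint]

theorem okOutput_smul {c : ℂ} (hc : ‖c‖ = 1) (φ : (Fin k → Bool) → ℂ) :
    okOutput (c • φ) = okOutput φ := by
  have : (fun o : Option (Fin k → Bool) => o.elim 0 (c • φ)) = c • fun o => o.elim 0 φ := by
    funext o; cases o <;> simp
  rw [okOutput, this, pureState_smul c hc, okOutput]

theorem sum_norm_sq_mulVec_le {m : Type} [Fintype m] [DecidableEq m] (A : Matrix m m ℂ)
    (v : m → ℂ) : ∑ x, ‖(A *ᵥ v) x‖ ^ 2 ≤ ‖A‖ ^ 2 * ∑ x, ‖v x‖ ^ 2 := by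
  have h := Matrix.l2_opNorm_mulVec A (WithLp.toLp 2 v)
  have h2 := mul_self_le_mul_self (norm_nonneg _) h
  rw [← sq, EuclideanSpace.norm_sq_eq, ← sq, mul_pow, EuclideanSpace.norm_sq_eq] at h2
  exact h2

/-- The compilation phase is absorbed into the vector; the operator norm then bounds the distance of
the two output vectors, and through it that of the states. -/
theorem close_okOutput {G : List (LogicalGate k)} {V : Op (Fin k)}
    (hV : V ∈ Matrix.unitaryGroup (Fin k → Bool) ℂ) {ε : ℝ} (h : Compiles G V ε) :
    Close (okOutput (circuitMat G *ᵥ ket fun _ => false))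
      (okOutput (V *ᵥ ket fun _ => false)) ε := by
  obtain ⟨c, hc, hle⟩ := h
  rw [← okOutput_smul hc]
  have hV' : Vᴴ * V = 1 := Matrix.mem_unitaryGroup_iff'.1 hV
  refine Close.of_norm_sub_le ?_ ?_ ((norm_nonneg _).trans hle) ?_
  · rw [sum_norm_sq_elim]
    have : ∀ x, ‖(c • (circuitMat G *ᵥ ket fun _ => false)) x‖ ^ 2 =
        ‖(circuitMat G *ᵥ ket fun _ => false) x‖ ^ 2 := fun x => by
      rw [Pi.smul_apply, norm_smul, hc, one_mul]
    simp only [this]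
    rw [sum_norm_sq_mulVec (circuitMat_unitary G), sum_norm_sq_ket]
  · rw [sum_norm_sq_elim, sum_norm_sq_mulVec hV', sum_norm_sq_ket]
  · have h1 : ∀ o : Option (Fin k → Bool),
        (o.elim 0 (c • (circuitMat G *ᵥ ket fun _ => false)) : ℂ) -
          o.elim 0 (V *ᵥ ket fun _ => false) =
        o.elim 0 ((c • circuitMat G - V) *ᵥ ket fun _ => false) := fun o => by
      cases o with
      | none => exact sub_zero _
      | some u => rw [Matrix.sub_mulVec, Matrix.smul_mulVec]; rfl
    simp only [h1]
    rw [sum_norm_sq_elim]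
    refine (sum_norm_sq_mulVec_le _ _).trans ?_
    rw [sum_norm_sq_ket, mul_one]
    exact pow_le_pow_left₀ (norm_nonneg _) hle 2

/-- The perfect run is compared with the actual one (cost `N_T δ`), then its product output with the
ideal one (cost `ε`). The bound on the output alone follows by partial trace, since the rest of the
ideal state is normalized. -/
theorem completeWithin (hp : p.Valid) {δ ε : ℝ} (hδ : p.FactoryWithin δ) {V : Op (Fin k)}
    (hV : V ∈ Matrix.unitaryGroup (Fin k → Bool) ℂ) (hG : Compiles p.gates V ε) :
    p.CompleteWithin (V *ᵥ ket fun _ => false)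
      (ε + p.gates.countP LogicalGate.isT * δ) := by
  have hperf : p.withPerfectFactory.Valid := hp
  have hφ : ∑ x, ‖(circuitMat p.gates *ᵥ ket fun _ => false) x‖ ^ 2 = 1 := by
    rw [sum_norm_sq_mulVec (circuitMat_unitary _), sum_norm_sq_ket]
  have hjoint := jointState_of_encodes (p := p.withPerfectFactory) hperf.2 factoryDensity_perfect hφ
    (encodes_mainState hperf fun _ _ => rfl)
  have h1 : Close p.jointState p.withPerfectFactory.jointState
      (p.gates.countP LogicalGate.isT * δ) := by
    rw [jointState_eq, jointState_eq]
    exact (close_mainState hp.2 hδ).map p.finish p.finish_sub (fun _ => p.finish_posSemidef)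
      p.trace_finish
  have hrest := isDensity_restState (p := p.withPerfectFactory) hperf.2 factoryDensity_perfect
  have hok := close_okOutput hV hG
  have h2 : Close p.jointState (p.idealState (V *ᵥ ket fun _ => false))
      (ε + p.gates.countP LogicalGate.isT * δ) := by
    rw [hjoint] at h1
    exact (h1.trans (hok.kronecker hrest)).mono (le_of_eq (add_comm _ _))
  refine ⟨acceptProb_eq_one hp.2 hδ.density, ?_, h2.traceDist_le⟩
  have h3 := h2.traceRight
  rw [idealState, traceRight_kronecker, hrest.2, one_smul] at h3
  exact h3.traceDist_le

end Protocol

end Completeness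

section Generators

/-! ### Generators of closed semigroups of unitaries -/

open selfAdjoint Filter Topology

variable {A : Type} [CStarAlgebra A]

theorem exp_mul_of_mul_eq {a q : A} {z : ℂ} (h : a * q = z • q) :
    NormedSpace.exp a * q = Complex.exp z • q := by
  have h1 := (NormedSpace.exp_series_hasSum_exp' (𝕂 := ℂ) a).mul_right q
  have h2 := (NormedSpace.exp_series_hasSum_exp' (𝕂 := ℂ) z).smul_const q
  rw [← Complex.exp_eq_exp_ℂ] at h2
  have h3 : ∀ n : ℕ, a ^ n * q = z ^ n • q := fun n => by
    induction n with
    | zero => simp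
    | succ n ih => rw [pow_succ, mul_assoc, h, mul_smul_comm, ih, smul_smul, pow_succ, mul_comm]
  refine h1.unique ?_
  simpa only [smul_mul_assoc, h3, smul_assoc] using h2

/-- Euler's formula: multiplication by `1 + N` or `1 - N` reduces the exponential to a scalar, and
the two multiples add up to it. -/
theorem expUnitary_of_mul_self {N : selfAdjoint A} (hN : (N : A) * N = 1) (s : ℝ) :
    (expUnitary (s • N) : A) =
      (Real.cos s : ℂ) • (1 : A) + (Complex.I * Real.sin s) • (N : A) := by
  have e1 : (Complex.I • ((s • N : selfAdjoint A) : A)) * (1 + N) =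
      (Complex.I * s) • (1 + (N : A)) := by
    rw [smul_mul_assoc, mul_smul, selfAdjoint.val_smul, smul_mul_assoc, mul_add, hN, mul_one,
      add_comm (N : A) 1, Complex.coe_smul]
  have e2 : (Complex.I • ((s • N : selfAdjoint A) : A)) * (1 - N) =
      (-(Complex.I * s)) • (1 - (N : A)) := by
    rw [smul_mul_assoc, neg_smul, mul_smul, selfAdjoint.val_smul, smul_mul_assoc, mul_sub, hN,
      mul_one, ← neg_sub 1 (N : A), smul_neg, smul_neg, Complex.coe_smul]
  have h1 := exp_mul_of_mul_eq e1
  have h2 := exp_mul_of_mul_eq e2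
  rw [expUnitary_coe]
  set E := NormedSpace.exp (Complex.I • ((s • N : selfAdjoint A) : A))
  have h3 : E = (1 / 2 : ℂ) • (E * (1 + (N : A)) + E * (1 - (N : A))) := by
    rw [← mul_add, show (1 + (N : A)) + (1 - N) = (2 : ℂ) • 1 by
      rw [two_smul]; abel, mul_smul_comm, mul_one, smul_smul]
    norm_num
  rw [h3, h1, h2, show -(Complex.I * s) = ((-s : ℝ) : ℂ) * Complex.I by push_cast; ring,
    mul_comm Complex.I (s : ℂ), Complex.exp_mul_I, Complex.exp_mul_I, ← Complex.ofReal_cos,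
    ← Complex.ofReal_sin, ← Complex.ofReal_cos, ← Complex.ofReal_sin, Real.cos_neg, Real.sin_neg]
  push_cast
  module

/-- Telescoping: replacing one factor at a time costs at most `‖x - y‖` for contractions. -/
theorem norm_pow_sub_pow_le {x y : A} (hx : ‖x‖ ≤ 1) (hy : ‖y‖ ≤ 1) (n : ℕ) :
    ‖x ^ n - y ^ n‖ ≤ n * ‖x - y‖ := by
  rcases subsingleton_or_nontrivial A with hA | hA
  · rw [Subsingleton.elim (x ^ n - y ^ n) 0, norm_zero]; positivity
  induction n with
  | zero => simp
  | succ n ih =>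
    have h : x ^ (n + 1) - y ^ (n + 1) = x ^ n * (x - y) + (x ^ n - y ^ n) * y := by
      rw [pow_succ, pow_succ]; noncomm_ring
    have hxn : ‖x ^ n‖ ≤ 1 := (norm_pow_le x n).trans (pow_le_one₀ (norm_nonneg _) hx)
    rw [h]
    calc _ ≤ ‖x ^ n * (x - y)‖ + ‖(x ^ n - y ^ n) * y‖ := norm_add_le _ _
      _ ≤ ‖x ^ n‖ * ‖x - y‖ + ‖x ^ n - y ^ n‖ * ‖y‖ := add_le_add (norm_mul_le _ _) (norm_mul_le _ _)
      _ ≤ 1 * ‖x - y‖ + (n * ‖x - y‖) * 1 := by gcongr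
      _ = _ := by push_cast; ring

theorem norm_coe_unitary_le (u : unitary A) : ‖(u : A)‖ ≤ 1 := by
  rcases subsingleton_or_nontrivial A with hA | hA
  · rw [Subsingleton.elim (u : A) 0, norm_zero]; exact zero_le_one
  · exact (CStarRing.norm_coe_unitary u).le

theorem hasDerivAt_expUnitary_smul (a : selfAdjoint A) :
    HasDerivAt (fun s : ℝ => (expUnitary (s • a) : A)) (Complex.I • (a : A)) 0 := by
  have h := hasDerivAt_exp_smul_const (𝕂 := ℝ) (Complex.I • (a : A)) 0
  rw [zero_smul, NormedSpace.exp_zero, one_mul] at h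
  refine h.congr_of_eventuallyEq (Eventually.of_forall fun s => ?_)
  simp only [expUnitary_coe, selfAdjoint.val_smul]
  rw [smul_comm]

theorem expUnitary_nsmul (a : selfAdjoint A) (n : ℕ) :
    (expUnitary (n • a) : A) = (expUnitary a : A) ^ n := by
  induction n with
  | zero => simp
  | succ n ih =>
    rw [succ_nsmul, Commute.expUnitary_add, Submonoid.coe_mul, ih, pow_succ]
    exact (Commute.refl (a : A)).smul_left n

/-- The Lie product formula. -/
theorem tendsto_lie_product (a b : selfAdjoint A) :
    Tendsto (fun n : ℕ => ((expUnitary ((n : ℝ)⁻¹ • a) : A) * expUnitary ((n : ℝ)⁻¹ • b)) ^ n) atTop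
      (𝓝 (expUnitary (a + b) : A)) := by
  -- The two curves agree to first order at `0`, so `D (1/n) = o(1/n)`, and the telescoping bound
  -- multiplies this by `n` only.
  set D : ℝ → A := fun s => (expUnitary (s • a) : A) * expUnitary (s • b) -
    expUnitary (s • (a + b)) with hD
  have hd : HasDerivAt D 0 0 := by
    have := ((hasDerivAt_expUnitary_smul a).mul (hasDerivAt_expUnitary_smul b)).sub
      (hasDerivAt_expUnitary_smul (a + b))
    convert! this using 1
    simp [smul_add]
  have ho := hasDerivAt_iff_isLittleO_nhds_zero.1 hd
  have h0 : D 0 = 0 := by simp [hD]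
  simp only [zero_add, h0, sub_zero, smul_zero] at ho
  have ht : Tendsto (fun n : ℕ => (n : ℝ)⁻¹) atTop (𝓝 0) := tendsto_inv_atTop_nhds_zero_nat
  have ho' := (ho.comp_tendsto ht).norm_left.tendsto_div_nhds_zero
  rw [tendsto_iff_norm_sub_tendsto_zero]
  refine squeeze_zero' (Eventually.of_forall fun n => norm_nonneg _) ?_ ho'
  filter_upwards [eventually_gt_atTop 0] with n hn
  have hn' : (n : ℝ) ≠ 0 := by exact_mod_cast hn.ne'
  have e : (expUnitary (a + b) : A) = (expUnitary ((n : ℝ)⁻¹ • (a + b)) : A) ^ n := by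
    rw [← expUnitary_nsmul, ← Nat.cast_smul_eq_nsmul ℝ n, smul_smul, mul_inv_cancel₀ hn', one_smul]
  rw [e]
  refine (norm_pow_sub_pow_le (norm_coe_unitary_le (expUnitary ((n : ℝ)⁻¹ • a) *
    expUnitary ((n : ℝ)⁻¹ • b))) (norm_coe_unitary_le _) n).trans (le_of_eq ?_)
  simp only [Function.comp, hD, div_inv_eq_mul]
  rw [mul_comm]
  rfl

/-- `a` generates a one-parameter group inside `Γ`. -/
def Generates (Γ : Submonoid A) (a : selfAdjoint A) : Prop :=
  ∀ s : ℝ, (expUnitary (s • a) : A) ∈ Γ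

variable {Γ : Submonoid A}

/-- Products of short rotations stay in `Γ`, and the Lie product formula gives their limit, which is
in `Γ` by closedness. -/
theorem Generates.add (hΓ : IsClosed (Γ : Set A)) {a b : selfAdjoint A} (ha : Generates Γ a)
    (hb : Generates Γ b) : Generates Γ (a + b) := fun s => by
  rw [smul_add]
  refine hΓ.mem_of_tendsto (tendsto_lie_product (s • a) (s • b)) (Eventually.of_forall fun n => ?_)
  refine Γ.pow_mem (Γ.mul_mem ?_ ?_) n
  · rw [smul_smul]; exact ha _
  · rw [smul_smul]; exact hb _

theorem Generates.smul {a : selfAdjoint A} (ha : Generates Γ a) (c : ℝ) : Generates Γ (c • a) :=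
  fun s => by rw [smul_smul]; exact ha _

theorem generates_zero : Generates Γ (0 : selfAdjoint A) := fun s => by simp

/-- Conjugation by a unitary commutes with the exponential. -/
theorem Generates.conj {a b : selfAdjoint A} (ha : Generates Γ a) {u : A} (hu : u ∈ Γ)
    (hu' : star u ∈ Γ) (h1 : star u * u = 1) (h2 : u * star u = 1)
    (hb : (b : A) = u * a * star u) : Generates Γ b := fun s => by
  let U : Aˣ := ⟨u, star u, h2, h1⟩
  have h : (expUnitary (s • b) : A) = u * expUnitary (s • a) * star u := by
    let +nondep : NormedAlgebra ℚ A := .restrictScalars ℚ ℂ A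
    rw [expUnitary_coe, expUnitary_coe]
    have := NormedSpace.exp_units_conj U (Complex.I • ((s • a : selfAdjoint A) : A))
    rw [show (U : A) = u from rfl, show ((U⁻¹ : Aˣ) : A) = star u from rfl] at this
    rw [← this, selfAdjoint.val_smul, selfAdjoint.val_smul, hb]
    simp only [mul_smul_comm, smul_mul_assoc]
  rw [h]
  exact Γ.mul_mem (Γ.mul_mem hu (ha s)) hu'

/-- An involution generates a one-parameter group inside `Γ` as soon as the rotation by one angle
incommensurable with `2π` is in `Γ`. -/
theorem generates_of_irrational (hΓ : IsClosed (Γ : Set A)) (hstar : ∀ u ∈ Γ, star u ∈ Γ)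
    {N : selfAdjoint A} (hN : (N : A) * N = 1) {θ : ℝ} (hθ : Irrational (θ / (2 * Real.pi)))
    (h : (expUnitary (θ • N) : A) ∈ Γ) : Generates Γ N := by
  have hcont : Continuous fun s : ℝ => (expUnitary (s • N) : A) := by
    simp only [expUnitary_of_mul_self hN]
    fun_prop
  have hcl : IsClosed {s : ℝ | (expUnitary (s • N) : A) ∈ Γ} := hΓ.preimage hcont
  -- The parameters whose rotation lies in `Γ` are closed and contain the subgroup generated by `θ`
  -- and the period `2π`, which is dense by irrationality.
  have hd := dense_addSubgroupClosure_pair_iff.2 hθ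
  have hsub : ((AddSubgroup.closure {θ, 2 * Real.pi} : AddSubgroup ℝ) : Set ℝ) ⊆
      {s : ℝ | (expUnitary (s • N) : A) ∈ Γ} := by
    intro s hs
    induction hs using AddSubgroup.closure_induction with
    | mem x hx =>
      rcases hx with rfl | rfl
      · exact h
      · change ((expUnitary ((2 * Real.pi) • N) : unitary A) : A) ∈ Γ
        rw [expUnitary_of_mul_self hN]
        simp [Γ.one_mem]
    | zero => simp
    | add x y _ _ hx hy =>
      have hc : Commute ((x • N : selfAdjoint A) : A) ((y • N : selfAdjoint A) : A) :=
        ((Commute.refl (N : A)).smul_left x).smul_right y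
      change ((expUnitary ((x + y) • N) : unitary A) : A) ∈ Γ
      rw [add_smul, hc.expUnitary_add]
      exact Γ.mul_mem hx hy
    | neg x _ hx =>
      change ((expUnitary ((-x) • N) : unitary A) : A) ∈ Γ
      have e : (expUnitary ((-x) • N) : A) = star (expUnitary (x • N) : A) := by
        rw [expUnitary_of_mul_self hN, expUnitary_of_mul_self hN, star_add, star_smul, star_smul,
          star_one, N.2.star_eq]
        simp [-Complex.ofReal_cos, -Complex.ofReal_sin]
      rw [e]
      exact hstar _ hx
  intro s
  have := (hcl.closure_subset_iff.2 hsub) (hd s)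
  exact this

end Generators

section Universality
set_option linter.unusedSectionVars false
set_option linter.unusedDecidableInType false
set_option linter.unusedFintypeInType false

/-! ### Universality of the gate set -/

open selfAdjoint Filter Topology

variable {k : ℕ}

theorem circuitMat_append (G G' : List (LogicalGate k)) :
    circuitMat (G ++ G') = circuitMat G' * circuitMat G := by
  induction G with
  | nil => simp [circuitMat]
  | cons g G ih => rw [List.cons_append, circuitMat, ih, circuitMat, mul_assoc]

/-- The unitaries of gate sequences, up to phases. -/
def circuits (k : ℕ) : Submonoid (Op (Fin k)) where
  carrier := {M | ∃ (c : ℂ) (G : List (LogicalGate k)), ‖c‖ = 1 ∧ M = c • circuitMat G}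
  one_mem' := ⟨1, [], by simp, by simp [circuitMat]⟩
  mul_mem' := by
    rintro _ _ ⟨c, G, hc, rfl⟩ ⟨d, G', hd, rfl⟩
    refine ⟨c * d, G' ++ G, by rw [norm_mul, hc, hd, one_mul], ?_⟩
    rw [circuitMat_append, smul_mul_smul_comm]

theorem circuitMat_replicate (g : LogicalGate k) (m : ℕ) :
    circuitMat (List.replicate m g) = g.mat ^ m := by
  induction m with
  | zero => rfl
  | succ m ih => rw [List.replicate_succ, circuitMat, ih, pow_succ]

theorem onQubit_pow {Q : Type} [Fintype Q] [DecidableEq Q] (q : Q) (A : Matrix Bool Bool ℂ)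
    (m : ℕ) : onQubit q A ^ m = onQubit q (A ^ m) := by
  induction m with
  | zero => rw [pow_zero, pow_zero, onQubit_one]
  | succ m ih => rw [pow_succ, ih, pow_succ, onQubit_mul]

theorem pow_eight_of_mul_self {M : Type*} [Monoid M] {x : M} (h : x * x = 1) : x ^ 8 = 1 := by
  rw [show 8 = 2 * 4 from rfl, pow_mul, sq, h, one_pow]

theorem gateT_pow_eight : gateT ^ 8 = 1 := by
  have h : Complex.exp (Real.pi / 4 * Complex.I) ^ 8 = 1 := by
    rw [show 8 = 2 * 4 from rfl, pow_mul, sq, exp_pi_div_four_sq, Complex.I_pow_four]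
  rw [gateT, Matrix.diagonal_pow, ← Matrix.diagonal_one]
  congr 1
  funext b
  cases b
  · simp
  · simpa using h

theorem gateS_pow_eight : gateS ^ 8 = 1 := by
  have h : Complex.I ^ 8 = 1 := by
    rw [show 8 = 4 * 2 from rfl, pow_mul, Complex.I_pow_four, one_pow]
  rw [gateS, Matrix.diagonal_pow, ← Matrix.diagonal_one]
  congr 1
  funext b
  cases b
  · simp
  · simp [h]

/-- Eight is a common exponent of all elementary gates, `T` needing all of it. Inverses are then
seventh powers, so circuits are closed under adjoints although no inverse gates are available. -/
theorem LogicalGate.mat_pow_eight (g : LogicalGate k) : g.mat ^ 8 = 1 := by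
  cases g with
  | H a => rw [LogicalGate.mat, onQubit_pow, pow_eight_of_mul_self gateH_mul_self, onQubit_one]
  | S a => rw [LogicalGate.mat, onQubit_pow, gateS_pow_eight, onQubit_one]
  | T a => rw [LogicalGate.mat, onQubit_pow, gateT_pow_eight, onQubit_one]
  | CNOT a a' h =>
    refine pow_eight_of_mul_self ?_
    rw [LogicalGate.mat, ← ctrl_mul (fun C => onQubit_commute h C gateX), ← onQubit_mul,
      gateX_mul_self, onQubit_one, ctrl_one]

theorem LogicalGate.conjTranspose_mat (g : LogicalGate k) :
    g.matᴴ = circuitMat (List.replicate 7 g) := by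
  rw [circuitMat_replicate]
  calc g.matᴴ = g.matᴴ * g.mat ^ 8 := by rw [g.mat_pow_eight, mul_one]
    _ = g.matᴴ * g.mat * g.mat ^ 7 := by rw [pow_succ', mul_assoc]
    _ = _ := by rw [g.mat_unitary, one_mul]

theorem mat_mem_circuits (g : LogicalGate k) : g.mat ∈ circuits k :=
  ⟨1, [g], by simp, by simp [circuitMat]⟩

theorem smul_mem_circuits {c : ℂ} (hc : ‖c‖ = 1) {M : Op (Fin k)} (hM : M ∈ circuits k) :
    c • M ∈ circuits k := by
  obtain ⟨d, G, hd, rfl⟩ := hM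
  exact ⟨c * d, G, by rw [norm_mul, hc, hd, one_mul], by rw [smul_smul]⟩

theorem star_mem_circuits {M : Op (Fin k)} (hM : M ∈ circuits k) : star M ∈ circuits k := by
  obtain ⟨c, G, hc, rfl⟩ := hM
  rw [star_smul]
  refine smul_mem_circuits (by rw [norm_star, hc]) ?_
  induction G with
  | nil => simp [circuitMat]
  | cons g G ih =>
    rw [circuitMat, star_mul, Matrix.star_eq_conjTranspose g.mat, g.conjTranspose_mat]
    exact Submonoid.mul_mem _ ⟨1, _, by simp, (one_smul ℂ _).symm⟩ ih

/-- The unitaries that gate sequences approximate. -/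
def reach (k : ℕ) : Submonoid (Op (Fin k)) := (circuits k).topologicalClosure

theorem isClosed_reach : IsClosed (reach k : Set (Op (Fin k))) :=
  (circuits k).isClosed_topologicalClosure

theorem circuits_le_reach : circuits k ≤ reach k := (circuits k).le_topologicalClosure

theorem star_mem_reach {M : Op (Fin k)} (hM : M ∈ reach k) : star M ∈ reach k :=
  map_mem_closure continuous_star hM fun _ h => star_mem_circuits h

theorem smul_mem_reach {c : ℂ} (hc : ‖c‖ = 1) {M : Op (Fin k)} (hM : M ∈ reach k) :
    c • M ∈ reach k :=
  map_mem_closure (f := fun M : Op (Fin k) => c • M) (continuous_const_smul c) hM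
    fun _ h => smul_mem_circuits hc h

theorem exists_compiles {V : Op (Fin k)} (hV : V ∈ reach k) {η : ℝ} (hη : 0 < η) :
    ∃ G, Compiles G V η := by
  obtain ⟨M, ⟨c, G, hc, rfl⟩, h⟩ := Metric.mem_closure_iff.1 hV η hη
  refine ⟨G, c, hc, ?_⟩
  rw [dist_comm, dist_eq_norm] at h
  exact h.le

theorem onQubit_gateH_mem (a : Fin k) : onQubit a gateH ∈ reach k :=
  circuits_le_reach (mat_mem_circuits (.H a))

theorem onQubit_gateS_mem (a : Fin k) : onQubit a gateS ∈ reach k :=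
  circuits_le_reach (mat_mem_circuits (.S a))

theorem onQubit_gateT_mem (a : Fin k) : onQubit a gateT ∈ reach k :=
  circuits_le_reach (mat_mem_circuits (.T a))

theorem onQubit_gateZ_mem (a : Fin k) : onQubit a gateZ ∈ reach k := by
  have h : gateZ = gateS * gateS := by
    apply bool_matrix_ext <;> simp [gateZ, gateS, Matrix.mul_apply]
  rw [h, onQubit_mul]
  exact Submonoid.mul_mem _ (onQubit_gateS_mem a) (onQubit_gateS_mem a)

/-- `A` is Hermitian and generates a one-parameter group of approximable unitaries. -/
def Reachable (A : Op (Fin k)) : Prop :=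
  ∃ a : selfAdjoint (Op (Fin k)), (a : Op (Fin k)) = A ∧ Generates (reach k) a

theorem Reachable.add {A B : Op (Fin k)} (hA : Reachable A) (hB : Reachable B) :
    Reachable (A + B) := by
  obtain ⟨a, rfl, ha⟩ := hA
  obtain ⟨b, rfl, hb⟩ := hB
  exact ⟨a + b, AddSubgroup.coe_add _ a b, ha.add isClosed_reach hb⟩

theorem Reachable.smul {A : Op (Fin k)} (hA : Reachable A) (c : ℝ) : Reachable ((c : ℂ) • A) := by
  obtain ⟨a, rfl, ha⟩ := hA
  exact ⟨c • a, (selfAdjoint.val_smul c a).trans (Complex.coe_smul c _).symm, ha.smul c⟩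

theorem Reachable.zero : Reachable (0 : Op (Fin k)) := ⟨0, rfl, generates_zero⟩

theorem Reachable.sum {κ : Type*} (I : Finset κ) {A : κ → Op (Fin k)}
    (hA : ∀ i ∈ I, Reachable (A i)) : Reachable (∑ i ∈ I, A i) := by
  classical
  induction I using Finset.induction_on with
  | empty => exact Reachable.zero
  | insert i I hi ih =>
    rw [Finset.sum_insert hi]
    exact (hA i (Finset.mem_insert_self i I)).add
      (ih fun j hj => hA j (Finset.mem_insert_of_mem hj))

/-- Stating the relation as `u * A = B * u` spares inverses in applications; self-adjointness of `B`
comes for free. -/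
theorem Reachable.conj {A B u : Op (Fin k)} (hA : Reachable A) (hu : u ∈ reach k)
    (h1 : uᴴ * u = 1) (hB : u * A = B * u) : Reachable B := by
  have h2 : u * uᴴ = 1 := mul_eq_one_comm.1 h1
  have hB' : B = u * A * uᴴ := by rw [hB, mul_assoc, h2, mul_one]
  obtain ⟨a, rfl, ha⟩ := hA
  have hsa : IsSelfAdjoint B := by
    have h : (a : Op (Fin k))ᴴ = a := a.2.star_eq
    rw [isSelfAdjoint_iff, Matrix.star_eq_conjTranspose, hB', Matrix.conjTranspose_mul,
      Matrix.conjTranspose_mul, Matrix.conjTranspose_conjTranspose, h, mul_assoc]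
  exact ⟨⟨B, hsa⟩, rfl, ha.conj hu (star_mem_reach hu) h1 h2 hB'⟩

theorem norm_cos_add_sin (s : ℝ) : ‖(Real.cos s : ℂ) + Complex.I * Real.sin s‖ = 1 := by
  rw [mul_comm, Complex.ofReal_cos, Complex.ofReal_sin, ← Complex.exp_mul_I]
  exact Complex.norm_exp_ofReal_mul_I s

/-- The identity generates global phases, which the circuits contain by definition. -/
theorem reachable_one : Reachable (1 : Op (Fin k)) := by
  refine ⟨1, rfl, fun s => ?_⟩
  have h : ((1 : selfAdjoint (Op (Fin k))) : Op (Fin k)) = 1 := rfl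
  rw [expUnitary_of_mul_self (by rw [h, one_mul]), h, ← add_smul]
  exact smul_mem_reach (norm_cos_add_sin s) (Submonoid.one_mem _)

/-! ### An irrational rotation -/

/-- The cosine of the rotation angle of `T (H T H)`. -/
def rotCos : ℝ := (2 + Real.sqrt 2) / 4

theorem sqrt_two_sq : Real.sqrt 2 ^ 2 = 2 := Real.sq_sqrt (by norm_num)

theorem sqrt_two_lt : Real.sqrt 2 < 3 / 2 := by
  rw [Real.sqrt_lt' (by norm_num)]; norm_num

theorem rotCos_bounds : 0 < rotCos ∧ rotCos < 1 := by
  have h0 := Real.sqrt_nonneg 2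
  have h1 := sqrt_two_lt
  constructor <;> unfold rotCos <;> linarith

/-- The sine of the rotation angle. -/
def rotSin : ℝ := Real.sqrt (1 - rotCos ^ 2)

theorem rotSin_sq : rotSin ^ 2 = (10 - 4 * Real.sqrt 2) / 16 := by
  have h := rotCos_bounds
  rw [rotSin, Real.sq_sqrt (by nlinarith), rotCos]
  linear_combination (-1 / 16 : ℝ) * sqrt_two_sq

theorem rotSin_ne_zero : rotSin ≠ 0 := by
  intro h
  have h1 := rotSin_sq
  have h2 := sqrt_two_lt
  rw [h] at h1
  linarith

/-- Twice the cosine of a rational multiple of `π` is an algebraic integer. Here `2 cos θ - 1 =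
√2/2`, whose square `1/2` is rational but not an integer. -/
theorem irrational_rotation : Irrational (Real.arccos rotCos / (2 * Real.pi)) := by
  rintro ⟨q, hq⟩
  have hpi := Real.pi_pos.ne'
  have hθ : Real.arccos rotCos = ((2 * q : ℚ) : ℝ) * Real.pi := by
    push_cast
    rw [hq]
    field_simp
  have h1 := Real.isIntegral_two_mul_cos_rat_mul_pi (2 * q)
  rw [← hθ, Real.cos_arccos (by linarith [rotCos_bounds.1]) rotCos_bounds.2.le] at h1
  have h2 : IsIntegral ℤ ((2 * rotCos - 1) * (2 * rotCos - 1)) :=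
    (h1.sub isIntegral_one).mul (h1.sub isIntegral_one)
  have h3 : (2 * rotCos - 1) * (2 * rotCos - 1) = ((1 / 2 : ℚ) : ℝ) := by
    rw [rotCos]; push_cast
    linear_combination (1 / 4 : ℝ) * sqrt_two_sq
  rw [h3] at h2
  obtain ⟨m, hm⟩ := h2.exists_int_iff_exists_rat.1 ⟨_, rfl⟩
  have h4 : (1 : ℝ) = ((2 * m : ℤ) : ℝ) := by
    push_cast at hm ⊢
    linarith
  have h5 : (1 : ℤ) = 2 * m := by exact_mod_cast h4
  omega

/-- The axis of the rotation `T (H T H)`. -/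
def rotAxis : Matrix Bool Bool ℂ :=
  ((-(Real.sqrt 2 / 4) / rotSin : ℝ) : ℂ) • (gateX + gateZ) +
    ((-((2 - Real.sqrt 2) / 4) / rotSin : ℝ) : ℂ) • gateY

theorem rotAxis_conjTranspose : rotAxisᴴ = rotAxis := by
  simp only [rotAxis, Matrix.conjTranspose_add, Matrix.conjTranspose_smul, gateX_conjTranspose,
    gateY_conjTranspose, gateZ_conjTranspose, Complex.star_def, Complex.conj_ofReal]

/-- Distinct Pauli matrices anticommute, so only the squares of the components survive. -/
theorem axis_mul_self (a b : ℂ) : (a • (gateX + gateZ) + b • gateY) *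
    (a • (gateX + gateZ) + b • gateY) = (2 * a ^ 2 + b ^ 2) • 1 := by
  have hI := Complex.I_mul_I
  apply bool_matrix_ext <;> simp [gateX, gateY, gateZ, Matrix.mul_apply] <;> grind

theorem rotAxis_mul_self : rotAxis * rotAxis = 1 := by
  rw [rotAxis, axis_mul_self]
  have h : 2 * (-(Real.sqrt 2 / 4) / rotSin) ^ 2 + (-((2 - Real.sqrt 2) / 4) / rotSin) ^ 2 = 1 := by
    have h0 := rotSin_ne_zero
    field_simp
    rw [rotSin_sq]
    linear_combination (3 : ℝ) * sqrt_two_sq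
  have h' : 2 * ((-(Real.sqrt 2 / 4) / rotSin : ℝ) : ℂ) ^ 2 +
      ((-((2 - Real.sqrt 2) / 4) / rotSin : ℝ) : ℂ) ^ 2 = 1 := by exact_mod_cast h
  rw [h', one_smul]

theorem exp_pi_div_four : Complex.exp (Real.pi / 4 * Complex.I) =
    (Real.sqrt 2 : ℂ) / 2 * (1 + Complex.I) := by
  rw [Complex.exp_mul_I, show (Real.pi / 4 : ℂ) = ((Real.pi / 4 : ℝ) : ℂ) by push_cast; rfl,
    ← Complex.ofReal_cos, ← Complex.ofReal_sin, Real.cos_pi_div_four, Real.sin_pi_div_four]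
  push_cast
  ring

/-- Extracting the phase `e^{iπ/4}` puts the product in the form `cos θ + i sin θ N` with an
involution `N`, as the irrational-rotation argument requires. -/
theorem rotation_eq : gateT * (gateH * gateT * gateH) =
    Complex.exp (Real.pi / 4 * Complex.I) •
      ((rotCos : ℂ) • 1 + (Complex.I * rotSin) • rotAxis) := by
  have hI := Complex.I_mul_I
  have hr : (Real.sqrt 2 : ℂ) * Real.sqrt 2 = 2 := by
    rw [← Complex.ofReal_mul, ← sq, sqrt_two_sq]; norm_num
  have hs : (rotSin : ℂ) ≠ 0 := by exact_mod_cast rotSin_ne_zero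
  have hax : (Complex.I * rotSin) • rotAxis = Complex.I • ((-((Real.sqrt 2 : ℂ) / 4)) •
      (gateX + gateZ) + (-((2 - (Real.sqrt 2 : ℂ)) / 4)) • gateY) := by
    rw [mul_smul]
    congr 1
    rw [rotAxis, smul_add, smul_smul, smul_smul]
    push_cast
    rw [mul_div_cancel₀ _ hs, mul_div_cancel₀ _ hs]
  have hk := gateH_mul_self
  have hinv : (Real.sqrt 2 : ℂ)⁻¹ * (Real.sqrt 2 : ℂ)⁻¹ = 1 / 2 := sqrt_two_inv_mul_self
  rw [hax, exp_pi_div_four, rotCos]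
  have hT : gateT = Matrix.diagonal fun b => if b then (Real.sqrt 2 : ℂ) / 2 * (1 + Complex.I) else 1 := by
    rw [gateT, exp_pi_div_four]
  rw [hT]
  apply bool_matrix_ext <;>
    simp [gateX, gateY, gateZ, gateH, Matrix.mul_apply, div_eq_mul_inv] <;> grind

end Universality

/-! ### Approximation of arbitrary unitaries -/

section Approximation
set_option linter.unusedSectionVars false
set_option linter.unusedDecidableInType false
set_option linter.unusedFintypeInType false

open selfAdjoint Filter Topology

variable {k : ℕ}

theorem reachable_rotAxis (a : Fin k) : Reachable (onQubit a rotAxis) := by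
  have hsa : IsSelfAdjoint (onQubit a rotAxis) := by
    rw [isSelfAdjoint_iff, Matrix.star_eq_conjTranspose, ← onQubit_conjTranspose,
      rotAxis_conjTranspose]
  set N : selfAdjoint (Op (Fin k)) := ⟨onQubit a rotAxis, hsa⟩ with hN
  have hNc : (N : Op (Fin k)) = onQubit a rotAxis := rfl
  have hsq : (N : Op (Fin k)) * N = 1 := by
    rw [hNc, ← onQubit_mul, rotAxis_mul_self, onQubit_one]
  refine ⟨N, rfl, generates_of_irrational isClosed_reach (fun u hu => star_mem_reach hu) hsq
    irrational_rotation ?_⟩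
  rw [expUnitary_of_mul_self hsq, hNc, Real.sin_arccos,
    Real.cos_arccos (by linarith [rotCos_bounds.1]) rotCos_bounds.2.le]
  have h1 : onQubit a (gateT * (gateH * gateT * gateH)) ∈ reach k := by
    rw [onQubit_mul, onQubit_mul, onQubit_mul]
    exact Submonoid.mul_mem _ (onQubit_gateT_mem a) (Submonoid.mul_mem _ (Submonoid.mul_mem _
      (onQubit_gateH_mem a) (onQubit_gateT_mem a)) (onQubit_gateH_mem a))
  rw [rotation_eq, onQubit_smul] at h1
  have h2 := smul_mem_reach (c := (Complex.exp (Real.pi / 4 * Complex.I))⁻¹)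
    (by rw [norm_inv, norm_exp_pi_div_four, inv_one]) h1
  rw [smul_smul, inv_mul_cancel₀ (Complex.exp_ne_zero _), one_smul, onQubit_add, onQubit_smul,
    onQubit_smul, onQubit_one] at h2
  exact h2

/-- Averaging the axis over conjugation by `Z` removes its `X` and `Y` components and leaves a
nonzero multiple of `Z`. -/
theorem reachable_gateZ (a : Fin k) : Reachable (onQubit a gateZ) := by
  have h1 := reachable_rotAxis a
  have h2 : Reachable (onQubit a (gateZ * rotAxis * gateZ)) := by
    refine h1.conj (onQubit_gateZ_mem a) ?_ ?_
    · rw [← onQubit_conjTranspose, ← onQubit_mul, gateZ_conjTranspose, gateZ_mul_self, onQubit_one]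
    · rw [← onQubit_mul, ← onQubit_mul, mul_assoc, gateZ_mul_self, mul_one]
  set c : ℝ := -(Real.sqrt 2 / 4) / rotSin with hc
  have hc0 : c ≠ 0 := by
    have : Real.sqrt 2 ≠ 0 := by positivity
    rw [hc]
    exact div_ne_zero (neg_ne_zero.2 (by positivity)) rotSin_ne_zero
  have h3 : rotAxis + gateZ * rotAxis * gateZ = ((2 * c : ℝ) : ℂ) • gateZ := by
    rw [rotAxis, ← hc]
    push_cast
    apply bool_matrix_ext <;> simp [gateX, gateY, gateZ, Matrix.mul_apply] <;> ring
  have h4 := (h1.add h2).smul (2 * c)⁻¹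
  rw [← onQubit_add, h3, onQubit_smul, smul_smul, ← Complex.ofReal_mul,
    inv_mul_cancel₀ (mul_ne_zero two_ne_zero hc0), Complex.ofReal_one, one_smul] at h4
  exact h4

theorem onQubit_mul_tens_eq_update {ι : Type} [Fintype ι] [DecidableEq ι] (i : ι)
    (A : Matrix Bool Bool ℂ) (f : ι → Matrix Bool Bool ℂ) :
    onQubit i A * tens f = tens (Function.update f i (A * f i)) := by
  rw [onQubit_eq_tens, tens_mul]
  congr 1
  funext j
  by_cases hj : j = i
  · subst hj; simp
  · simp [Function.update_of_ne hj]

theorem tens_mul_onQubit_eq_update {ι : Type} [Fintype ι] [DecidableEq ι] (i : ι)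
    (A : Matrix Bool Bool ℂ) (f : ι → Matrix Bool Bool ℂ) :
    tens f * onQubit i A = tens (Function.update f i (f i * A)) := by
  rw [onQubit_eq_tens, tens_mul]
  congr 1
  funext j
  by_cases hj : j = i
  · subst hj; simp
  · simp [Function.update_of_ne hj]

theorem commute_onQubit_tens {ι : Type} [Fintype ι] [DecidableEq ι] {i : ι}
    (A : Matrix Bool Bool ℂ) {f : ι → Matrix Bool Bool ℂ} (h : f i = 1) :
    Commute (onQubit i A) (tens f) := by
  rw [Commute, SemiconjBy, onQubit_mul_tens_eq_update, tens_mul_onQubit_eq_update, h, mul_one,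
    one_mul]

/-- A controlled `X` carries `Z` on the target to `Z` on both qubits. -/
theorem cnot_mul_tens {ι : Type} [Fintype ι] [DecidableEq ι] {c q : ι}
    {f : ι → Matrix Bool Bool ℂ} (hc : f c = 1) (hq : f q = gateZ) :
    ctrl c (onQubit q gateX) * tens f =
      tens (Function.update f c gateZ) * ctrl c (onQubit q gateX) := by
  have h1 : tens (Function.update f c gateZ) = tens f * onQubit c gateZ := by
    rw [tens_mul_onQubit_eq_update, hc, one_mul]
  have h2 : onQubit q gateX * tens f = -(tens f * onQubit q gateX) := by
    rw [onQubit_mul_tens_eq_update, hq, gateX_mul_gateZ, ← neg_one_smul ℂ (tens f * _),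
      tens_mul_onQubit_eq_update, hq]
    have : ∀ g : ι → Matrix Bool Bool ℂ, ∀ B, tens (Function.update g q (-B)) =
        (-1 : ℂ) • tens (Function.update g q B) := fun g B => by
      have e : Function.update g q (-B) = fun i => (if i = q then (-1 : ℂ) else 1) •
          Function.update g q B i := by
        funext i
        by_cases hi : i = q
        · subst hi; simp
        · simp [hi]
      rw [e, tens_smul]
      simp
    exact this f _
  have hz0 : gateZ * Matrix.diagonal (fun b => if b then (0 : ℂ) else 1) =
      Matrix.diagonal fun b => if b then (0 : ℂ) else 1 := by
    apply bool_matrix_ext <;> simp [gateZ, Matrix.mul_apply]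
  have hz1 : gateZ * Matrix.diagonal (fun b => if b then (1 : ℂ) else 0) =
      -Matrix.diagonal fun b => if b then (1 : ℂ) else 0 := by
    apply bool_matrix_ext <;> simp [gateZ, Matrix.mul_apply]
  have hneg : ∀ A : Matrix Bool Bool ℂ, onQubit c (-A) = -onQubit c A := fun A => by
    rw [← neg_one_smul ℂ A, onQubit_smul, neg_one_smul]
  rw [h1, ctrl_eq, add_mul, mul_add, (commute_onQubit_tens _ hc).eq, mul_assoc (onQubit c _), h2,
    mul_neg, ← mul_assoc, (commute_onQubit_tens _ hc).eq, mul_assoc (tens f) (onQubit c gateZ),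
    mul_assoc (tens f) (onQubit c gateZ), ← onQubit_mul, ← mul_assoc (onQubit c gateZ),
    ← onQubit_mul, hz0, hz1, hneg, neg_mul, mul_neg, mul_assoc]

/-- The product of the `Z` on the qubits of `S`. -/
def zString (S : Finset (Fin k)) : Op (Fin k) := tens fun i => if i ∈ S then gateZ else 1

/-- A CNOT whose control is a new qubit and whose target is already in the string extends the string
by one `Z`; a single `Z` is the starting point. -/
theorem reachable_zString (S : Finset (Fin k)) : Reachable (zString S) := by
  induction S using Finset.induction_on with
  | empty =>
    have h : zString (∅ : Finset (Fin k)) = 1 := by simp [zString, tens_one]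
    rw [h]
    exact reachable_one
  | insert c S hc ih =>
    have hins : (fun i => if i ∈ insert c S then gateZ else 1) =
        Function.update (fun i => if i ∈ S then gateZ else 1) c gateZ := by
      funext i
      by_cases hi : i = c
      · subst hi; simp
      · simp [hi]
    rcases S.eq_empty_or_nonempty with rfl | ⟨q, hq⟩
    · have h : zString (insert c (∅ : Finset (Fin k))) = onQubit c gateZ := by
        rw [zString, hins, onQubit_eq_tens]
        simp
      rw [h]
      exact reachable_gateZ c
    · have hcq : c ≠ q := fun h => hc (h ▸ hq)
      have hg := mat_mem_circuits (.CNOT c q hcq)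
      refine ih.conj (circuits_le_reach hg) (LogicalGate.mat_unitary _) ?_
      rw [zString, zString, hins]
      exact cnot_mul_tens (by simp [hc]) (by simp [hq])

/-- The Pauli matrices `1, X, Y, Z`. -/
def pauli : Fin 4 → Matrix Bool Bool ℂ := ![1, gateX, gateY, gateZ]

/-- Clifford unitaries that carry `Z` to the Pauli matrices. -/
def pauliFrame : Fin 4 → Matrix Bool Bool ℂ := ![1, gateH, gateS * gateH, 1]

theorem pauliFrame_unitary (j : Fin 4) : (pauliFrame j)ᴴ * pauliFrame j = 1 := by
  fin_cases j
  · simp [pauliFrame]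
  · simp [pauliFrame, gateH_conjTranspose, gateH_mul_self]
  · simp only [pauliFrame]
    change (gateS * gateH)ᴴ * (gateS * gateH) = 1
    rw [Matrix.conjTranspose_mul, mul_assoc, ← mul_assoc gateSᴴ, gateS_unitary, one_mul,
      gateH_conjTranspose, gateH_mul_self]
  · simp [pauliFrame]

theorem pauliFrame_mul (j : Fin 4) :
    pauliFrame j * (if j = 0 then 1 else gateZ) = pauli j * pauliFrame j := by
  fin_cases j
  · simp [pauliFrame, pauli]
  · exact gateH_mul_gateZ
  · change gateS * gateH * gateZ = gateY * (gateS * gateH)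
    rw [mul_assoc, gateH_mul_gateZ, ← mul_assoc, gateS_mul_gateX, mul_assoc]
  · simp [pauliFrame, pauli]

theorem onQubit_pauliFrame_mem (a : Fin k) (j : Fin 4) : onQubit a (pauliFrame j) ∈ reach k := by
  fin_cases j
  · change onQubit a 1 ∈ reach k
    rw [onQubit_one]; exact Submonoid.one_mem _
  · exact onQubit_gateH_mem a
  · change onQubit a (gateS * gateH) ∈ reach k
    rw [onQubit_mul]
    exact Submonoid.mul_mem _ (onQubit_gateS_mem a) (onQubit_gateH_mem a)
  · change onQubit a 1 ∈ reach k
    rw [onQubit_one]; exact Submonoid.one_mem _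

/-- Single-qubit Clifford gates rotate each `Z` of a `Z`-string to the required letter. -/
theorem reachable_tens_pauli (f : Fin k → Fin 4) : Reachable (tens fun i => pauli (f i)) := by
  refine (reachable_zString (Finset.univ.filter fun i => f i ≠ 0)).conj
    (u := tens fun i => pauliFrame (f i)) ?_ ?_ ?_
  · rw [tens_eq_prod]
    refine Submonoid.list_prod_mem _ fun M hM => ?_
    obtain ⟨i, -, rfl⟩ := List.mem_map.1 hM
    exact onQubit_pauliFrame_mem i (f i)
  · rw [tens_conjTranspose, tens_mul, ← tens_one]
    congr 1
    funext i
    exact pauliFrame_unitary (f i)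
  · rw [zString, tens_mul, tens_mul]
    congr 1
    funext i
    rw [← pauliFrame_mul]
    simp only [Finset.mem_filter, Finset.mem_univ, true_and, ne_eq, ite_not]

theorem exists_pauli_coeff (M : Matrix Bool Bool ℂ) :
    ∃ c : Fin 4 → ℂ, M = ∑ j, c j • pauli j := by
  -- The coefficients are half the traces of `M` against the Pauli matrices.
  refine ⟨![(M false false + M true true) / 2, (M false true + M true false) / 2,
    Complex.I * (M false true - M true false) / 2, (M false false - M true true) / 2], ?_⟩
  have hI := Complex.I_mul_I
  apply bool_matrix_ext <;>
    simp [Fin.sum_univ_four, pauli, gateX, gateY, gateZ, Matrix.mul_apply] <;> grind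

theorem tens_mem_span (A : Fin k → Matrix Bool Bool ℂ) :
    ∃ c : (Fin k → Fin 4) → ℂ, tens A = ∑ f, c f • tens fun i => pauli (f i) := by
  choose c hc using fun i => exists_pauli_coeff (A i)
  refine ⟨fun f => ∏ i, c i (f i), ?_⟩
  ext x y
  simp only [tens, Matrix.of_apply, Matrix.sum_apply, Matrix.smul_apply, smul_eq_mul,
    ← Finset.prod_mul_distrib]
  have h : ∀ i, A i (x i) (y i) = ∑ j, c i j * pauli j (x i) (y i) := fun i => by
    conv_lhs => rw [hc i]
    simp [Matrix.sum_apply]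
  simp only [h]
  rw [Finset.prod_univ_sum, Fintype.piFinset_univ]

theorem exists_pauliString_coeff (A : Op (Fin k)) :
    ∃ c : (Fin k → Fin 4) → ℂ, A = ∑ f, c f • tens fun i => pauli (f i) := by
  choose c hc using fun p : (Fin k → Bool) × (Fin k → Bool) =>
    tens_mem_span fun i => Matrix.single (p.1 i) (p.2 i) (1 : ℂ)
  refine ⟨fun f => ∑ p : (Fin k → Bool) × (Fin k → Bool), A p.1 p.2 * c p f, ?_⟩
  conv_lhs => rw [matrix_eq_sum_tens A]
  simp only [Finset.sum_smul]
  conv_rhs => rw [Finset.sum_comm, Fintype.sum_prod_type]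
  refine Finset.sum_congr rfl fun x _ => Finset.sum_congr rfl fun y _ => ?_
  have hxy := hc (x, y)
  simp only at hxy
  rw [hxy, Finset.smul_sum]
  exact Finset.sum_congr rfl fun f _ => smul_smul _ _ _

theorem pauli_conjTranspose (j : Fin 4) : (pauli j)ᴴ = pauli j := by
  fin_cases j
  · exact Matrix.conjTranspose_one
  · exact gateX_conjTranspose
  · exact gateY_conjTranspose
  · exact gateZ_conjTranspose

/-- Pauli strings span the operators and are Hermitian, so averaging the expansion of `A` with its
adjoint gives real coefficients; real combinations of reachable operators are reachable. -/
theorem reachable_of_isHermitian {A : Op (Fin k)} (hA : Aᴴ = A) : Reachable A := by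
  obtain ⟨c, hc⟩ := exists_pauliString_coeff A
  have h : A = ∑ f, (((c f).re : ℝ) : ℂ) • tens fun i => pauli (f i) := by
    have h1 : Aᴴ = ∑ f, (starRingEnd ℂ) (c f) • tens fun i => pauli (f i) := by
      conv_lhs => rw [hc]
      rw [Matrix.conjTranspose_sum]
      refine Finset.sum_congr rfl fun f _ => ?_
      rw [Matrix.conjTranspose_smul, tens_conjTranspose]
      simp only [pauli_conjTranspose]
      rfl
    have h2 : A = (1 / 2 : ℂ) • (A + Aᴴ) := by
      rw [hA, ← two_smul ℂ A, smul_smul]; norm_num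
    rw [h2]
    conv_lhs => rw [h1]
    conv_lhs => rw [hc]
    rw [← Finset.sum_add_distrib, Finset.smul_sum]
    refine Finset.sum_congr rfl fun f _ => ?_
    rw [← add_smul, smul_smul, Complex.re_eq_add_conj]
    congr 1
    ring
  rw [h]
  exact Reachable.sum _ fun f _ => (reachable_tens_pauli f).smul _

/-- Every unitary is a multiple, by a phase, of one that does not have the eigenvalue `-1`. -/
theorem exists_phase (V : Op (Fin k)) :
    ∃ c : ℂ, ‖c‖ = 1 ∧ -1 ∉ spectrum ℂ (c • V) := by
  have hfin : (spectrum ℂ V).Finite := Matrix.finite_spectrum V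
  have hinf : (Metric.sphere (0 : ℂ) 1).Infinite := by
    have h1 : Set.InjOn (fun s : ℝ => Complex.exp (s * Complex.I)) (Set.Ioc (-Real.pi) Real.pi) := by
      intro s hs s' hs' h
      have := congrArg Complex.arg h
      simp only at this
      rwa [Complex.arg_exp_mul_I, Complex.arg_exp_mul_I, (toIocMod_eq_self _).2,
        (toIocMod_eq_self _).2] at this
      · rw [show -Real.pi + 2 * Real.pi = Real.pi by ring]; exact hs'
      · rw [show -Real.pi + 2 * Real.pi = Real.pi by ring]; exact hs
    have h2 := (Set.Ioc_infinite (show -Real.pi < Real.pi by linarith [Real.pi_pos])).image h1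
    refine h2.mono ?_
    rintro _ ⟨s, -, rfl⟩
    simp [Complex.norm_exp_ofReal_mul_I]
  obtain ⟨z, hz, hzV⟩ := hinf.exists_notMem_finite hfin
  have hz1 : ‖z‖ = 1 := by simpa using hz
  have hz0 : z ≠ 0 := by rintro rfl; simp at hz1
  -- Multiplication by `-z⁻¹` moves the unit complex number `z` outside the spectrum to `-1`.
  refine ⟨-z⁻¹, by rw [norm_neg, norm_inv, hz1, inv_one], fun h => hzV ?_⟩
  let u : ℂˣ := Units.mk0 (-z⁻¹) (neg_ne_zero.2 (inv_ne_zero hz0))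
  have h2 : u • z ∈ spectrum ℂ (u • V) := by
    have : u • z = -1 := by
      change -z⁻¹ * z = -1
      rw [neg_mul, inv_mul_cancel₀ hz0]
    rw [this]
    exact h
  exact spectrum.smul_mem_smul_iff.1 h2

/-- After a phase `-1` is not an eigenvalue, so the distance to `1` is below `2` and the unitary is
`exp(i a)` with `a` self-adjoint; all self-adjoint operators generate approximable unitaries. -/
theorem mem_reach_of_unitary {V : Op (Fin k)} (hV : V ∈ Matrix.unitaryGroup (Fin k → Bool) ℂ) :
    V ∈ reach k := by
  obtain ⟨c, hc, hspec⟩ := exists_phase V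
  have hc0 : c ≠ 0 := by rintro rfl; simp at hc
  have hcc : star c * c = 1 := by
    rw [Complex.star_def, Complex.conj_mul', hc]; simp
  have hu : c • V ∈ unitary (Op (Fin k)) := by
    rw [Unitary.mem_iff, star_smul, smul_mul_smul_comm, smul_mul_smul_comm, mul_comm c, hcc, one_smul,
      one_smul]
    exact ⟨Matrix.mem_unitaryGroup_iff'.1 hV, Matrix.mem_unitaryGroup_iff.1 hV⟩
  have hnorm := (Unitary.norm_sub_one_lt_two_iff hu).2 hspec
  have hexp := expUnitary_argSelfAdjoint (u := ⟨c • V, hu⟩) hnorm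
  set a := Unitary.argSelfAdjoint (⟨c • V, hu⟩ : unitary (Op (Fin k)))
  obtain ⟨b, hb, hgen⟩ := reachable_of_isHermitian (A := (a : Op (Fin k))) a.2.star_eq
  have hab : b = a := Subtype.ext hb
  have h1 := hgen 1
  rw [one_smul, hab, hexp] at h1
  have h2 := smul_mem_reach (c := c⁻¹) (by rw [norm_inv, hc, inv_one]) h1
  rwa [smul_smul, inv_mul_cancel₀ hc0, one_smul] at h2

/-- The gate set is universal. -/
theorem exists_compiles_of_unitary {V : Op (Fin k)}
    (hV : V ∈ Matrix.unitaryGroup (Fin k → Bool) ℂ) {η : ℝ} (hη : 0 < η) :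
    ∃ G, Compiles G V η :=
  exists_compiles (mem_reach_of_unitary hV) hη

end Approximation

/-! ### Preparation of the input state -/

section Preparation

/-- Every unit vector is prepared by a unitary from a given basis vector. -/
theorem exists_unitary_mulVec_ket {m : Type} [Fintype m] [DecidableEq m] {v : m → ℂ}
    (hv : ∑ x, ‖v x‖ ^ 2 = 1) (s : m) :
    ∃ W : Matrix.unitaryGroup m ℂ, W.1 *ᵥ ket s = v := by
  have hnorm : ‖(WithLp.toLp 2 v : EuclideanSpace ℂ m)‖ = 1 := by
    rw [EuclideanSpace.norm_eq, Real.sqrt_eq_one]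
    exact hv
  obtain ⟨b, hb⟩ := Orthonormal.exists_orthonormalBasis_extension_of_card_eq (𝕜 := ℂ)
    (E := EuclideanSpace ℂ m) (ι := m) (by simp) (v := fun _ => WithLp.toLp 2 v) (s := {s})
    ⟨fun _ => hnorm, fun i j hij => absurd (Subsingleton.elim i j) hij⟩
  refine ⟨⟨_, (EuclideanSpace.basisFun m ℂ).toMatrix_orthonormalBasis_mem_unitary b⟩, ?_⟩
  funext x
  have h := congrFun (congrArg WithLp.ofLp (hb s rfl)) x
  rw [ket, Matrix.mulVec_single_one]
  simpa [Module.Basis.toMatrix_apply] using h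

end Preparation

end DQC

end

theorem mainTheorem1 {r k : ℕ} (code : DQC.StabilizerCode r k)
    (U : Matrix.unitaryGroup (Fin k → Bool) ℂ)
    (ψ : (Fin k → Bool) → ℂ) (hψ : ∑ x, ‖ψ x‖ ^ 2 = 1) :
    -- the data that the protocol prescribes exist: a correction table, gate implementations, and
    -- a unitary that prepares the input state
    (∃ C, code.IsCorrectionTable C) ∧
    (∃ lib : DQC.GateLibrary r k, lib.Valid code) ∧
    (∃ W : Matrix.unitaryGroup (Fin k → Bool) ℂ, W.1 *ᵥ DQC.ket (fun _ => false) = ψ) ∧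
    -- every honest run outputs the correct state up to the compilation and magic-state errors
    (∀ W : Matrix.unitaryGroup (Fin k → Bool) ℂ, W.1 *ᵥ DQC.ket (fun _ => false) = ψ →
      ∀ (ε δ : ℝ) (t : ℕ) (p : DQC.Protocol r k t), p.code = code → p.Valid →
        DQC.Compiles p.gates (U.1 * W.1) ε → p.FactoryWithin δ →
        p.CompleteWithin (U.1 *ᵥ ψ) (ε + p.gates.countP DQC.LogicalGate.isT * δ)) ∧
    -- and, by the choice of the gate sequence and of the magic-state quality, the error of all
    -- honest runs can be made smaller than any prescribed positive number
    (∀ W : Matrix.unitaryGroup (Fin k → Bool) ℂ, W.1 *ᵥ DQC.ket (fun _ => false) = ψ →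
      ∀ ε > 0, ∃ G : List (DQC.LogicalGate k), DQC.Compiles G (U.1 * W.1) ε ∧
        ∃ δ > 0, ∀ (t : ℕ) (p : DQC.Protocol r k t),
          p.code = code → p.Valid → p.gates = G → p.FactoryWithin δ →
          p.CompleteWithin (U.1 *ᵥ ψ) ε) := by
  refine ⟨code.exists_isCorrectionTable, DQC.exists_gateLibrary code,
    DQC.exists_unitary_mulVec_ket hψ _, ?_, ?_⟩
  · rintro W hW ε δ t p rfl hp hG hδ
    have h := DQC.Protocol.completeWithin hp hδ (mul_mem U.2 W.2) hG
    rwa [← Matrix.mulVec_mulVec, hW] at h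
  · intro W hW ε hε
    obtain ⟨G, hG⟩ := DQC.exists_compiles_of_unitary (mul_mem U.2 W.2) (half_pos hε)
    obtain ⟨c, hc, hle⟩ := id hG
    -- Half of the error budget goes to compilation and half to the magic states; the `+ 1` keeps
    -- `δ` defined and positive when there is no `T` gate.
    refine ⟨G, ⟨c, hc, hle.trans (half_le_self hε.le)⟩,
      ε / 2 / (G.countP DQC.LogicalGate.isT + 1), by positivity, ?_⟩
    rintro t p rfl hp rfl hδ
    have h := DQC.Protocol.completeWithin hp hδ (mul_mem U.2 W.2) hG
    rw [← Matrix.mulVec_mulVec, hW] at h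
    have hle' : ε / 2 + p.gates.countP DQC.LogicalGate.isT *
        (ε / 2 / (p.gates.countP DQC.LogicalGate.isT + 1)) ≤ ε := by
      have h1 : (p.gates.countP DQC.LogicalGate.isT : ℝ) /
          (p.gates.countP DQC.LogicalGate.isT + 1) ≤ 1 := by
        rw [div_le_one (by positivity)]; linarith
      have h2 := mul_le_mul_of_nonneg_right h1 (half_pos hε).le
      have h3 : (p.gates.countP DQC.LogicalGate.isT : ℝ) *
          (ε / 2 / (p.gates.countP DQC.LogicalGate.isT + 1)) =
          p.gates.countP DQC.LogicalGate.isT /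
          (p.gates.countP DQC.LogicalGate.isT + 1) * (ε / 2) := by ring
      rw [h3]
      linarith
    exact ⟨h.1, h.2.1.trans hle', h.2.2.trans hle'⟩
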